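/- Let $M$ be a transitive set and $\mathcal{C}$ a set of subsets of $M$ such that $\mathcal{M}=(M,\mathcal{C})$ (with the true $\in$; elements of $M$ are the sets of the model, elements of $\mathcal{C}$ its classes) is a $\beta$-model of $\mathrm{MK}^*$. That is: $\mathcal{M}$ satisfies Morse–Kelley class theory (Extensionality, Pairing, Infinity, Union, Power Set for sets; Foundation, Extensionality, Replacement for class functions, full Class-Comprehension with quantification over sets and classes and with parameters, and Global Choice in the form of a class well-ordering of all sets) and the Class-Bounding scheme $\forall x\,\exists A\,\varphi(x,A)\to\exists B\,\forall x\,\exists y\,\varphi(x,(B)_y)$, where $(B)_y=\{z\mid (y,z)\in B\}$; and a class relation is well-founded in $\mathcal{M}$ if and only if it is really well-founded. A pair $(M_0,R)$ with $M_0,R\in\mathcal{C}$, $R$ a binary relation on $M_0$, is a coding pair if there is $a\in M_0$ such that: (a) for each $z\in M_0$ there is exactly one $n\in\omega$ for which there is an $R$-chain $z\,R\,z_{n-1}\,R\cdots R\,z_1\,R\,a$ of length $n$ (we say $z$ is on level $n$); (b) if $y\,R\,x$, $z\,R\,x$ and $y\ne z$, then $(M_0,R)\restriction y\not\cong(M_0,R)\restriction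 z$, where $(M_0,R)\restriction y$ is the restriction of $R$ to $y$ and all elements connected to $y$ by an $R$-chain; (c) if $y\neq z$ are on the same level, then no $v$ satisfies both $v\,R\,y$ and $v\,R\,z$; (d) $R$ is well-founded. Let $\tilde M_0$ be the quotient of $M_0$ by the equivalence relation $b\approx c\iff (M_0,R)\restriction b\cong(M_0,R)\restriction c$, with $[b]\,\tilde R\,[c]$ iff $b_0\,R\,c_0$ for some $b_0\approx b$, $c_0\approx c$. The coding pair $(M_0,R)$ is a coding pair for the set $x$ if $(\tilde M_0,\tilde R)\cong(\mathrm{TC}(\{x\}),\in)$. Let $$M^+=\{x\mid \text{there is a coding pair for } x\}.$$ For a set $C$ let $L_0(C)=\mathrm{TC}(\{C\})$, $L_{\beta+1}(C)=\mathrm{Def}(L_\beta(C))$ (the set of all subsets of $L_\beta(C)$ that are first-order definable with parameters over $(L_\beta(C),\in)$) and $L_\lambda(C)=\bigcup_{\beta<\lambda}L_\beta(C)$ for limit $\lambda$. Then the ordinals in $M^+$ are exactly the ordinals below some ordinal $\kappa^*$ (the height of $M^+$), and $$M^+=\bigcup_{C\in\mathcal{C}}L_{\kappa^*}(C).$$ 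-/

import Mathlib

universe u

/-! ## Two-sorted class theory -/

/-- Formulas of the two-sorted language of class theory: set variables `x_i`, class variables
`X_i` (named by natural numbers), membership of a set in a set or in a class, equality, and
quantifiers over sets and over classes. -/
inductive ClassFormula : Type
  | setEq (i j : ℕ) : ClassFormula
  | classEq (i j : ℕ) : ClassFormula
  | setMem (i j : ℕ) : ClassFormula
  | classMem (i j : ℕ) : ClassFormula
  | neg (φ : ClassFormula) : ClassFormula
  | and (φ ψ : ClassFormula) : ClassFormula
  | allSet (i : ℕ) (φ : ClassFormula) : ClassFormula
  | allClass (i : ℕ) (φ : ClassFormula) : ClassFormula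

/-- `(M, 𝒞) ⊨ φ` under the assignment `v` of the set variables and `V` of the class variables. -/
def ClassFormula.Sat (M 𝒞 : ZFSet.{u}) :
    ClassFormula → (ℕ → ZFSet.{u}) → (ℕ → ZFSet.{u}) → Prop
  | .setEq i j, v, _ => v i = v j
  | .classEq i j, _, V => V i = V j
  | .setMem i j, v, _ => v i ∈ v j
  | .classMem i j, v, V => v i ∈ V j
  | .neg φ, v, V => ¬ φ.Sat M 𝒞 v V
  | .and φ ψ, v, V => φ.Sat M 𝒞 v V ∧ ψ.Sat M 𝒞 v V
  | .allSet i φ, v, V => ∀ a ∈ M, φ.Sat M 𝒞 (Function.update v i a) V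
  | .allClass i φ, v, V => ∀ A ∈ 𝒞, φ.Sat M 𝒞 v (Function.update V i A)

/-- The section `(B)_y = {z ∈ M | (y, z) ∈ B}`. -/
def classSection (M B y : ZFSet.{u}) : ZFSet.{u} :=
  M.sep (fun z => ZFSet.pair y z ∈ B)

/-- `(M, 𝒞)` is a model of Morse-Kelley class theory whose sets are the elements of the
transitive set `M`, whose classes are the elements of `𝒞` (all of them subsets of `M`), and whose
membership relation is the true one. -/
structure IsMKModel (M 𝒞 : ZFSet.{u}) : Prop where
  transitive : M.IsTransitive
  class_subset : ∀ X ∈ 𝒞, X ⊆ M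
  /-- Extensionality for sets. -/
  set_ext : ∀ x ∈ M, ∀ y ∈ M, (∀ z ∈ M, z ∈ x ↔ z ∈ y) → x = y
  pairing : ∀ x ∈ M, ∀ y ∈ M, ({x, y} : ZFSet.{u}) ∈ M
  infinity : ∃ x ∈ M, ∅ ∈ x ∧ ∀ y ∈ x, insert y y ∈ x
  union : ∀ x ∈ M, (ZFSet.sUnion x) ∈ M
  power : ∀ x ∈ M, ∃ y ∈ M, ∀ z ∈ M, z ∈ y ↔ z ⊆ x
  /-- Foundation for classes. -/
  foundation : ∀ X ∈ 𝒞, X ≠ ∅ → ∃ x ∈ X, ∀ y ∈ X, y ∉ x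
  /-- Extensionality for classes. -/
  class_ext : ∀ X ∈ 𝒞, ∀ Y ∈ 𝒞, (∀ z ∈ M, z ∈ X ↔ z ∈ Y) → X = Y
  /-- Replacement for class functions. -/
  replacement : ∀ F ∈ 𝒞, (∀ p ∈ F, ∃ a b, p = ZFSet.pair a b) →
    (∀ a b c, ZFSet.pair a b ∈ F → ZFSet.pair a c ∈ F → b = c) →
    ∀ x ∈ M, ∃ y ∈ M, ∀ b, b ∈ y ↔ ∃ a ∈ x, ZFSet.pair a b ∈ F
  /-- Class-Comprehension, for formulas quantifying over sets and classes, with parameters. -/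
  comprehension : ∀ (φ : ClassFormula) (i : ℕ) (v V : ℕ → ZFSet.{u}),
    (∀ k, v k ∈ M) → (∀ k, V k ∈ 𝒞) →
    M.sep (fun x => φ.Sat M 𝒞 (Function.update v i x) V) ∈ 𝒞
  /-- Global Choice: a class strict well-ordering of all sets, in the sense of the model. -/
  globalChoice : ∃ W ∈ 𝒞,
    (∀ x ∈ M, ZFSet.pair x x ∉ W) ∧
    (∀ x ∈ M, ∀ y ∈ M, ∀ z ∈ M, ZFSet.pair x y ∈ W → ZFSet.pair y z ∈ W → ZFSet.pair x z ∈ W) ∧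
    (∀ x ∈ M, ∀ y ∈ M, ZFSet.pair x y ∈ W ∨ x = y ∨ ZFSet.pair y x ∈ W) ∧
    (∀ X ∈ 𝒞, X ≠ ∅ → ∃ x ∈ X, ∀ y ∈ X, ZFSet.pair y x ∉ W)

/-- Models of `MK*`: Morse-Kelley together with the scheme of Class-Bounding
`∀ x ∃ A φ(x, A) → ∃ B ∀ x ∃ y φ(x, (B)_y)`, with parameters. -/
structure IsMKStarModel (M 𝒞 : ZFSet.{u}) : Prop extends IsMKModel M 𝒞 where
  classBounding : ∀ (φ : ClassFormula) (i j : ℕ) (v V : ℕ → ZFSet.{u}),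
    (∀ k, v k ∈ M) → (∀ k, V k ∈ 𝒞) →
    (∀ x ∈ M, ∃ A ∈ 𝒞, φ.Sat M 𝒞 (Function.update v i x) (Function.update V j A)) →
    ∃ B ∈ 𝒞, ∀ x ∈ M, ∃ y ∈ M,
      φ.Sat M 𝒞 (Function.update v i x) (Function.update V j (classSection M B y))

/-- The binary relation on sets given by a set (or class) of ordered pairs. -/
def pairRel (R x y : ZFSet.{u}) : Prop := ZFSet.pair x y ∈ R

/-- The class relation `R` is well-founded in the sense of a model with classes `𝒞`: every
nonempty class of the model has an `R`-minimal element. -/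
def WellFoundedInModel (𝒞 R : ZFSet.{u}) : Prop :=
  ∀ X ∈ 𝒞, X ≠ ∅ → ∃ x ∈ X, ∀ y ∈ X, ¬ pairRel R y x

/-- `β`-models of `MK*`: a class relation is well-founded in the model if and only if it is
really well-founded. -/
structure IsBetaModelMKStar (M 𝒞 : ZFSet.{u}) : Prop extends IsMKStarModel M 𝒞 where
  beta : ∀ R ∈ 𝒞, WellFoundedInModel 𝒞 R ↔ WellFounded (pairRel R)

/-! ## Coding pairs and the sets they code -/

/-- There is an `R`-chain `z R z_{n-1} R ... R z_1 R a` of length `n`. -/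
def HasRDist (R a : ZFSet.{u}) : ℕ → ZFSet.{u} → Prop
  | 0, z => z = a
  | n + 1, z => ∃ w, pairRel R z w ∧ HasRDist R a n w

/-- The `R`-transitive closure below `y`: `y` and all elements of `M₀` connected to `y` by an
`R`-chain. -/
def nodesBelow (M₀ R y : ZFSet.{u}) : Set ZFSet.{u} :=
  {w | w ∈ M₀ ∧ Relation.ReflTransGen (pairRel R) w y}

/-- `(M₀, R) ↾ y` and `(M₀, R) ↾ z` are isomorphic. -/
def SubtreeIso (M₀ R y z : ZFSet.{u}) : Prop :=
  Nonempty ((fun s t : nodesBelow M₀ R y => pairRel R s.1 t.1) ≃r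
    (fun s t : nodesBelow M₀ R z => pairRel R s.1 t.1))

/-- `(M₀, R)` is a coding pair with distinguished element `a` in the model with classes `𝒞`. -/
structure IsCodingPair (𝒞 M₀ R a : ZFSet.{u}) : Prop where
  carrier_mem : M₀ ∈ 𝒞
  rel_mem : R ∈ 𝒞
  top_mem : a ∈ M₀
  rel_on : ∀ p ∈ R, ∃ x ∈ M₀, ∃ y ∈ M₀, p = ZFSet.pair x y
  level : ∀ z ∈ M₀, ∃! n : ℕ, HasRDist R a n z
  not_iso : ∀ x ∈ M₀, ∀ y ∈ M₀, ∀ z ∈ M₀, y ≠ z → pairRel R y x → pairRel R z x →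
    ¬ SubtreeIso M₀ R y z
  disjoint : ∀ y ∈ M₀, ∀ z ∈ M₀, y ≠ z → ∀ n : ℕ, HasRDist R a n y → HasRDist R a n z →
    ∀ v, pairRel R v y → ¬ pairRel R v z
  wf : WellFounded (pairRel R)

/-- The equivalence of nodes of `M₀`: the subtrees below them are isomorphic. -/
def nodeSetoid (M₀ R : ZFSet.{u}) : Setoid M₀ where
  r b c := SubtreeIso M₀ R b.1 c.1
  iseqv :=
    { refl := fun _ => ⟨RelIso.refl _⟩
      symm := fun ⟨e⟩ => ⟨e.symm⟩
      trans := fun ⟨e⟩ ⟨f⟩ => ⟨e.trans f⟩ }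

/-- The relation of the quotient structure: two equivalence classes are related iff they have
`R`-related members. (Up to isomorphism, it is immaterial that we use the equivalence classes
themselves instead of chosen representatives.) -/
def quotientRel (M₀ R : ZFSet.{u}) (p q : Quotient (nodeSetoid M₀ R)) : Prop :=
  ∃ b c : M₀, Quotient.mk (nodeSetoid M₀ R) b = p ∧ Quotient.mk (nodeSetoid M₀ R) c = q ∧
    pairRel R b.1 c.1

/-- The transitive closure `TC(x)`: the set of all elements of elements of ... of `x`. -/
noncomputable def transClosure (x : ZFSet.{u}) : ZFSet.{u} :=
  (ZFSet.vonNeumann x.rank).sep (fun z => Relation.TransGen (· ∈ ·) z x)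

theorem mem_transClosure {x z : ZFSet.{u}} :
    z ∈ transClosure x ↔ Relation.TransGen (· ∈ ·) z x := by
  rw [transClosure, ZFSet.mem_sep, ZFSet.mem_vonNeumann, and_iff_right_iff_imp]
  intro h
  induction h with
  | single h => exact ZFSet.rank_lt_of_mem h
  | tail _ h ih => exact ih.trans (ZFSet.rank_lt_of_mem h)

/-- The pair `(M₀, R)` codes `x`: its quotient structure is isomorphic to `(TC({x}), ∈)`. -/
def CodesSet (M₀ R x : ZFSet.{u}) : Prop :=
  Nonempty (quotientRel M₀ R ≃r
    (fun s t : transClosure ({x} : ZFSet.{u}) => (s : ZFSet.{u}) ∈ (t : ZFSet.{u})))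

/-- `M⁺`: the collection of all sets that have a coding pair in the model with classes `𝒞`. -/
def codedSets (𝒞 : ZFSet.{u}) : Set ZFSet.{u} :=
  {x | ∃ M₀ R a, IsCodingPair 𝒞 M₀ R a ∧ CodesSet M₀ R x}

/-! ## The constructible hierarchy over `TC({C})` -/

/-- The relation symbols of the language of set theory. -/
inductive SetRelSymbol : ℕ → Type
  | mem : SetRelSymbol 2

/-- The first-order language of set theory, with one binary relation symbol. -/
def setLanguage : FirstOrder.Language := ⟨fun _ => Empty, SetRelSymbol⟩

/-- The structure `(X, ∈)`. -/
instance memStructure (X : ZFSet.{u}) : setLanguage.Structure X where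
  funMap := fun f => Empty.elim f
  RelMap := fun {_} r =>
    match r with
    | .mem => fun w => (w 0 : ZFSet.{u}) ∈ (w 1 : ZFSet.{u})

/-- `Def(X)`: the subsets of `X` that are first-order definable over `(X, ∈)` with parameters. -/
noncomputable def defPowerset (X : ZFSet.{u}) : ZFSet.{u} :=
  X.powerset.sep (fun Y => (Set.univ : Set X).Definable₁ setLanguage {z : X | z.1 ∈ Y})

/-- The hierarchy `L_β(C)`, with `L_0(C) = TC({C})`, `L_{β+1}(C) = Def(L_β(C))` and unions at
limits. -/
noncomputable def constructibleFrom (C : ZFSet.{u}) (β : Ordinal.{u}) : ZFSet.{u} :=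
  Ordinal.limitRecOn β (transClosure {C}) (fun _ X => defPowerset X)
    (fun γ _ L => ZFSet.iUnion (fun δ : Set.Iio γ => L δ.1 δ.2))

theorem constructibleFrom_zero (C : ZFSet.{u}) :
    constructibleFrom C 0 = transClosure {C} := by
  simp [constructibleFrom]

theorem constructibleFrom_add_one (C : ZFSet.{u}) (β : Ordinal.{u}) :
    constructibleFrom C (β + 1) = defPowerset (constructibleFrom C β) := by
  simp [constructibleFrom]

theorem constructibleFrom_limit (C : ZFSet.{u}) (γ : Ordinal.{u}) (h : Order.IsSuccLimit γ) :
    constructibleFrom C γ = ZFSet.iUnion (fun δ : Set.Iio γ => constructibleFrom C δ.1) := by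
  simp [constructibleFrom, Ordinal.limitRecOn_limit _ _ _ _ h]

/-! The proof replaces coding pairs by arbitrary well-founded class relations. Let `U` be the
collection `collapseValues 𝒞` of Mostowski collapses, read off at the node `∅`, of well-founded
relations in `𝒞`. Then `M⁺ = U` (`IsMKModel.codedSets_eq`). For `⊆`, the isomorphism of the quotient
with `(TC({x}), ∈)` has to send the class of a node to the collapse of that node. For `⊇`, Global
Choice selects one node for each collapse value, and the resulting relation is unfolded into the
tree of its finite descending branches, which is a coding pair.

The next point is that `U` satisfies pairing, union, full separation and collection
(`IsBetaModelMKStar.separationCollectionClass`). Two nodes of well-founded class relations have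
equal collapses iff some class is a bisimulation relating them (`IsMKModel.bisimilar_iff`), and in a
`β`-model well-foundedness is first-order over the classes. Hence every first-order statement over
`(U, ∈)` translates into one about codes, quantifying over classes. Class-Comprehension then yields
separation and Class-Bounding yields collection. Moreover `U` is transitive and contains every class
and `ω`.

In such a `U` recursion on membership can be carried out. The operation `Def` is definable in `U`,
because it is obtained by iterating finitely many set operations `ω` times (`defRelFibres_eq`). So
`L_γ(C) ∈ U` whenever `C ∈ 𝒞` and `γ ∈ U`. With `κ` the least ordinal outside `U`, this gives
`L_κ(C) ⊆ U`.

Conversely, let `x ∈ U` be the collapse of `E`. The hierarchy over `E` builds approximations to the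
collapsing map of `E`, spending four levels for each step in the membership rank of the value
(`exists_isCollapseGraph_mem`). The level at which `x` appears is bounded by an ordinal computed
from `x` by recursion, which therefore lies in `U`, that is, below `κ`. So `x ∈ L_κ(E)`, and the
class `C` required is the code itself. -/

/-! ## First-order definability over `(U, ∈)` -/

/-- Parameter-free first-order definable relations over the structure `(U, ∈)`, as predicates on
assignments of finitely many variables. -/
inductive FOPure (U : Set ZFSet.{u}) : ∀ {n : ℕ}, ((Fin n → ZFSet.{u}) → Prop) → Prop
  | mem {n : ℕ} (i j : Fin n) : FOPure U (fun v : Fin n → ZFSet.{u} => v i ∈ v j)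
  | eq {n : ℕ} (i j : Fin n) : FOPure U (fun v : Fin n → ZFSet.{u} => v i = v j)
  | not {n : ℕ} {P : (Fin n → ZFSet.{u}) → Prop} : FOPure U P → FOPure U (fun v => ¬ P v)
  | and {n : ℕ} {P Q : (Fin n → ZFSet.{u}) → Prop} :
      FOPure U P → FOPure U Q → FOPure U (fun v => P v ∧ Q v)
  | all {n : ℕ} {P : (Fin (n + 1) → ZFSet.{u}) → Prop} : FOPure U P →
      FOPure U (fun v : Fin n → ZFSet.{u} => ∀ a ∈ U, P (Fin.snoc (α := fun _ => ZFSet.{u}) v a))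

/-- Relations on `U` that are first-order definable over `(U, ∈)` with parameters. -/
class FORel (U : Set ZFSet.{u}) {n : ℕ} (P : (Fin n → ZFSet.{u}) → Prop) : Prop where
  exists_pure : ∃ (m : ℕ) (p : Fin m → ZFSet.{u}) (Q : (Fin (m + n) → ZFSet.{u}) → Prop),
    (∀ i, p i ∈ U) ∧ FOPure U Q ∧ ∀ v, (∀ i, v i ∈ U) → (P v ↔ Q (Fin.append p v))

/-- Functions on `U` whose graph is first-order definable over `(U, ∈)` with parameters. -/
class FOFun (U : Set ZFSet.{u}) {n : ℕ} (f : (Fin n → ZFSet.{u}) → ZFSet.{u}) : Prop where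
  maps : ∀ v, (∀ i, v i ∈ U) → f v ∈ U
  graph : FORel U (fun w : Fin (n + 1) → ZFSet.{u} =>
    w (Fin.last n) = f (fun i => w i.castSucc))

/-- Transitive classes. -/
class TransClass (U : Set ZFSet.{u}) : Prop where
  mem_of_mem : ∀ {x y : ZFSet.{u}}, x ∈ U → y ∈ x → y ∈ U

theorem FOPure.rename {U : Set ZFSet.{u}} {n : ℕ} {P : (Fin n → ZFSet.{u}) → Prop}
    (h : FOPure U P) : ∀ {m : ℕ} (σ : Fin n → Fin m), FOPure U (fun v => P (fun i => v (σ i))) := by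
  induction h with
  | mem i j => exact fun σ => .mem (σ i) (σ j)
  | eq i j => exact fun σ => .eq (σ i) (σ j)
  | not _ ih => exact fun σ => .not (ih σ)
  | and _ _ ih ih' => exact fun σ => .and (ih σ) (ih' σ)
  | @all n P _ ih =>
    intro m σ
    have h := FOPure.all (ih (Fin.snoc (α := fun _ => Fin (m + 1)) (fun i => (σ i).castSucc)
      (Fin.last m)))
    convert h using 6
    rename_i v a _ i
    refine Fin.lastCases ?_ (fun i => ?_) i <;> simp

namespace FORel

variable {U : Set ZFSet.{u}} {n m : ℕ}

theorem congr {P Q : (Fin n → ZFSet.{u}) → Prop} (hQ : FORel U Q)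
    (h : ∀ v, (∀ i, v i ∈ U) → (P v ↔ Q v)) : FORel U P := by
  obtain ⟨k, p, R, hp, hR, hQR⟩ := hQ
  exact ⟨k, p, R, hp, hR, fun v hv => (h v hv).trans (hQR v hv)⟩

theorem of_pure {P : (Fin n → ZFSet.{u}) → Prop} (h : FOPure U P) : FORel U P := by
  refine ⟨0, Fin.elim0, fun w => P (fun i => w (Fin.natAdd 0 i)), fun i => i.elim0, h.rename _, ?_⟩
  intro v _
  simp

theorem not {P : (Fin n → ZFSet.{u}) → Prop} (h : FORel U P) : FORel U (fun v => ¬ P v) := by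
  obtain ⟨k, p, R, hp, hR, h⟩ := h
  exact ⟨k, p, _, hp, hR.not, fun v hv => not_congr (h v hv)⟩

theorem and {P Q : (Fin n → ZFSet.{u}) → Prop} (hP : FORel U P) (hQ : FORel U Q) :
    FORel U (fun v => P v ∧ Q v) := by
  obtain ⟨k, p, R, hp, hR, hPR⟩ := hP
  obtain ⟨l, q, S, hq, hS, hQS⟩ := hQ
  refine ⟨k + l, Fin.append p q, _, ?_, (hR.rename (m := k + l + n)
      (Fin.append (fun i : Fin k => (i.castAdd l).castAdd n) (Fin.natAdd (k + l)))).and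
      (hS.rename (m := k + l + n)
      (Fin.append (fun i : Fin l => (i.natAdd k).castAdd n) (Fin.natAdd (k + l)))), ?_⟩
  · intro i
    refine Fin.addCases (fun i => ?_) (fun i => ?_) i <;> simp [hp, hq]
  · intro v hv
    rw [hPR v hv, hQS v hv]
    refine and_congr (iff_of_eq (congrArg _ ?_)) (iff_of_eq (congrArg _ ?_)) <;>
    · funext i
      refine Fin.addCases (fun i => ?_) (fun i => ?_) i <;> simp

theorem rename {P : (Fin n → ZFSet.{u}) → Prop} (h : FORel U P) (σ : Fin n → Fin m) :
    FORel U (fun v => P (fun i => v (σ i))) := by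
  obtain ⟨k, p, R, hp, hR, h⟩ := h
  refine ⟨k, p, _, hp, hR.rename (m := k + m) (Fin.append (fun i : Fin k => i.castAdd m)
    (fun i => (σ i).natAdd k)), fun v hv => ?_⟩
  rw [h _ fun i => hv _]
  refine iff_of_eq (congrArg _ ?_)
  funext i
  refine Fin.addCases (fun i => ?_) (fun i => ?_) i <;> simp

/-- Substituting parameters for some of the variables. -/
theorem inst {P : (Fin (m + n) → ZFSet.{u}) → Prop} (h : FORel U P) (q : Fin m → ZFSet.{u})
    (hq : ∀ i, q i ∈ U) : FORel U (fun v : Fin n → ZFSet.{u} => P (Fin.append q v)) := by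
  obtain ⟨k, p, R, hp, hR, h⟩ := h
  refine ⟨k + m, Fin.append p q, _, ?_, hR.rename (m := k + m + n)
    (Fin.cast (Nat.add_assoc k m n).symm), fun v hv => ?_⟩
  · intro i
    refine Fin.addCases (fun i => ?_) (fun i => ?_) i <;> simp [hp, hq]
  · rw [h (Fin.append q v)]
    · refine iff_of_eq (congrArg _ ?_)
      rw [Fin.append_assoc]
      funext i
      simp
    · intro i
      refine Fin.addCases (fun i => ?_) (fun i => ?_) i <;> simp [hv, hq]

theorem all_snoc {P : (Fin (n + 1) → ZFSet.{u}) → Prop} (h : FORel U P) :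
    FORel U (fun v : Fin n → ZFSet.{u} =>
      ∀ a ∈ U, P (Fin.snoc (α := fun _ => ZFSet.{u}) v a)) := by
  obtain ⟨k, p, R, hp, hR, h⟩ := h
  refine ⟨k, p, _, hp, .all (n := k + n) hR, fun v hv => ?_⟩
  refine forall₂_congr fun a ha => ?_
  rw [h, Fin.append_snoc]
  intro i
  refine Fin.lastCases ?_ (fun i => ?_) i <;> simp [ha, hv]

/-- The closure rules are instances, so that definability of an explicitly written predicate is
found by instance search along its syntax. -/
instance instNot {P : (Fin n → ZFSet.{u}) → Prop} [h : FORel U P] : FORel U (fun v => ¬ P v) :=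
  h.not

instance instAnd {P Q : (Fin n → ZFSet.{u}) → Prop} [hP : FORel U P] [hQ : FORel U Q] :
    FORel U (fun v => P v ∧ Q v) := hP.and hQ

instance instOr {P Q : (Fin n → ZFSet.{u}) → Prop} [hP : FORel U P] [hQ : FORel U Q] :
    FORel U (fun v => P v ∨ Q v) :=
  (hP.not.and hQ.not).not.congr fun v _ => by tauto

instance instImp {P Q : (Fin n → ZFSet.{u}) → Prop} [hP : FORel U P] [hQ : FORel U Q] :
    FORel U (fun v => P v → Q v) :=
  (hP.and hQ.not).not.congr fun v _ => by tauto

instance instIff {P Q : (Fin n → ZFSet.{u}) → Prop} [hP : FORel U P] [hQ : FORel U Q] :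
    FORel U (fun v => P v ↔ Q v) :=
  ((hP.and hQ.not).not.and (hQ.and hP.not).not).congr fun v _ => by tauto

theorem all' {Q : (Fin n → ZFSet.{u}) → ZFSet.{u} → Prop}
    (h : FORel U (fun w : Fin (n + 1) → ZFSet.{u} =>
      Q (fun i => w i.castSucc) (w (Fin.last n)))) :
    FORel U (fun v => ∀ a ∈ U, Q v a) :=
  h.all_snoc.congr fun v _ => by simp

instance instAll {Q : (Fin n → ZFSet.{u}) → ZFSet.{u} → Prop}
    [h : FORel U (fun w : Fin (n + 1) → ZFSet.{u} =>
      Q (fun i => w i.castSucc) (w (Fin.last n)))] :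
    FORel U (fun v => ∀ a ∈ U, Q v a) := h.all'

instance instEx {Q : (Fin n → ZFSet.{u}) → ZFSet.{u} → Prop}
    [h : FORel U (fun w : Fin (n + 1) → ZFSet.{u} =>
      Q (fun i => w i.castSucc) (w (Fin.last n)))] :
    FORel U (fun v => ∃ a ∈ U, Q v a) :=
  (all' (Q := fun v a => ¬ Q v a) h.not).not.congr fun v _ => by push Not; rfl

instance (priority := low) instRename {P : (Fin n → ZFSet.{u}) → Prop} [h : FORel U P]
    {σ : Fin n → Fin m} : FORel U (fun v => P (fun i => v (σ i))) := h.rename σ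

theorem rename₁ {Q : (Fin n → ZFSet.{u}) → ZFSet.{u} → Prop}
    (h : FORel U (fun w : Fin (n + 1) → ZFSet.{u} =>
      Q (fun i => w i.castSucc) (w (Fin.last n)))) (σ : Fin n → Fin m) (k : Fin m) :
    FORel U (fun v : Fin m → ZFSet.{u} => Q (fun i => v (σ i)) (v k)) := by
  simpa using h.rename (Fin.snoc (α := fun _ => Fin m) σ k)

theorem inst₁ {Q : (Fin n → ZFSet.{u}) → ZFSet.{u} → Prop}
    (h : FORel U (fun w : Fin (n + 1) → ZFSet.{u} =>
      Q (fun i => w i.castSucc) (w (Fin.last n)))) {v : Fin n → ZFSet.{u}} (hv : ∀ i, v i ∈ U) :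
    FORel U (fun w : Fin 1 → ZFSet.{u} => Q v (w 0)) := by
  have h' := h.inst (m := n) (n := 1) v hv
  refine h'.congr fun w _ => iff_of_eq (congrArg₂ _ ?_ ?_)
  · funext i
    exact (Fin.append_left v w i).symm
  · exact (Fin.append_right v w 0).symm

theorem inst₂ {Q : (Fin n → ZFSet.{u}) → ZFSet.{u} → ZFSet.{u} → Prop}
    (h : FORel U (fun w : Fin (n + 2) → ZFSet.{u} =>
      Q (fun i => w i.castSucc.castSucc) (w (Fin.last n).castSucc) (w (Fin.last (n + 1)))))
    {v : Fin n → ZFSet.{u}} (hv : ∀ i, v i ∈ U) :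
    FORel U (fun w : Fin 2 → ZFSet.{u} => Q v (w 0) (w 1)) := by
  have h' := h.inst (m := n) (n := 2) v hv
  refine h'.congr fun w _ => iff_of_eq ?_
  have e : (fun i : Fin n => Fin.append v w (i.castSucc.castSucc : Fin (n + 2))) = v :=
    funext fun i => Fin.append_left v w i
  have e₀ : Fin.append v w ((Fin.last n).castSucc : Fin (n + 2)) = w 0 := Fin.append_right v w 0
  have e₁ : Fin.append v w (Fin.last (n + 1) : Fin (n + 2)) = w 1 := Fin.append_right v w 1
  rw [e, e₀, e₁]

end FORel

namespace FOFun

variable {U : Set ZFSet.{u}} {n m : ℕ}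

instance instVar (i : Fin n) : FOFun U (fun v => v i) where
  maps _ hv := hv i
  graph := .of_pure (.eq _ _)

theorem const {c : ZFSet.{u}} (hc : c ∈ U) : FOFun U (fun _ : Fin n → ZFSet.{u} => c) where
  maps _ _ := hc
  graph := by
    refine ⟨1, fun _ => c, _, fun _ => hc, .eq (n := 1 + (n + 1)) (Fin.natAdd 1 (Fin.last n))
      (Fin.castAdd (n + 1) 0), fun v _ => ?_⟩
    simp only [Fin.append_left, Fin.append_right]

instance instConst {c : ZFSet.{u}} [hc : Fact (c ∈ U)] :
    FOFun U (fun _ : Fin n → ZFSet.{u} => c) := const hc.out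

theorem rename {f : (Fin n → ZFSet.{u}) → ZFSet.{u}} (h : FOFun U f) (σ : Fin n → Fin m) :
    FOFun U (fun v => f (fun i => v (σ i))) where
  maps v hv := h.maps _ fun i => hv _
  graph := by
    simpa using h.graph.rename (Fin.snoc (α := fun _ => Fin (m + 1)) (fun i => (σ i).castSucc)
      (Fin.last m))

instance (priority := low) instRename {f : (Fin n → ZFSet.{u}) → ZFSet.{u}} [h : FOFun U f]
    {σ : Fin n → Fin m} : FOFun U (fun v => f (fun i => v (σ i))) := h.rename σ

end FOFun

namespace FORel

variable {U : Set ZFSet.{u}} {n m : ℕ}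

/-- A definable function is eliminated by quantifying over its value; this stays inside `U` because
the function maps into `U`. -/
theorem subst {Q : (Fin n → ZFSet.{u}) → ZFSet.{u} → Prop}
    (h : FORel U (fun w : Fin (n + 1) → ZFSet.{u} =>
      Q (fun i => w i.castSucc) (w (Fin.last n)))) {f : (Fin n → ZFSet.{u}) → ZFSet.{u}}
    (hf : FOFun U f) : FORel U (fun v => Q v (f v)) := by
  have := hf.graph
  have := instEx (U := U) (Q := fun v a => a = f v ∧ Q v a)
  refine this.congr fun v hv => ⟨fun h => ⟨_, hf.maps v hv, rfl, h⟩, ?_⟩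
  rintro ⟨_, _, rfl, h⟩
  exact h

instance instMem {f g : (Fin n → ZFSet.{u}) → ZFSet.{u}} [hf : FOFun U f] [hg : FOFun U g] :
    FORel U (fun v => f v ∈ g v) :=
  subst (Q := fun v a => f v ∈ a) (subst (Q := fun v a => a ∈ v (Fin.last n))
    (of_pure (.mem _ _)) (hf.rename _)) hg

instance instEq {f g : (Fin n → ZFSet.{u}) → ZFSet.{u}} [hf : FOFun U f] [hg : FOFun U g] :
    FORel U (fun v => f v = g v) :=
  subst (Q := fun v a => f v = a) (subst (Q := fun v a => a = v (Fin.last n))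
    (of_pure (.eq _ _)) (hf.rename _)) hg

variable [hU : TransClass U]

/-- Transitivity of `U` makes a quantifier bounded by an element of `U` the same as a relativized
quantifier over `U`. -/
instance instBall {f : (Fin n → ZFSet.{u}) → ZFSet.{u}} {Q : (Fin n → ZFSet.{u}) → ZFSet.{u} → Prop}
    [hf : FOFun U f] [h : FORel U (fun w : Fin (n + 1) → ZFSet.{u} =>
      Q (fun i => w i.castSucc) (w (Fin.last n)))] :
    FORel U (fun v => ∀ a ∈ f v, Q v a) :=
  (inferInstance : FORel U (fun v => ∀ a ∈ U, a ∈ f v → Q v a)).congr fun v hv =>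
    ⟨fun h a _ ha => h a ha, fun h a ha => h a (hU.mem_of_mem (hf.maps v hv) ha) ha⟩

instance instBex {f : (Fin n → ZFSet.{u}) → ZFSet.{u}} {Q : (Fin n → ZFSet.{u}) → ZFSet.{u} → Prop}
    [hf : FOFun U f] [h : FORel U (fun w : Fin (n + 1) → ZFSet.{u} =>
      Q (fun i => w i.castSucc) (w (Fin.last n)))] :
    FORel U (fun v => ∃ a ∈ f v, Q v a) :=
  (inferInstance : FORel U (fun v => ∃ a ∈ U, a ∈ f v ∧ Q v a)).congr fun v hv =>
    ⟨fun ⟨a, ha, h⟩ => ⟨a, hU.mem_of_mem (hf.maps v hv) ha, ha, h⟩, fun ⟨a, _, h⟩ => ⟨a, h⟩⟩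

instance instEqSingleton {f g : (Fin n → ZFSet.{u}) → ZFSet.{u}} [FOFun U f] [FOFun U g] :
    FORel U (fun v => f v = {g v}) :=
  (inferInstance : FORel U (fun v => g v ∈ f v ∧ ∀ a ∈ f v, a = g v)).congr fun v _ => by
    constructor
    · intro h; simp [h]
    · rintro ⟨h, h'⟩
      ext z
      simp only [ZFSet.mem_singleton]
      exact ⟨h' z, fun e => e ▸ h⟩

instance instEqUnordered {f g h : (Fin n → ZFSet.{u}) → ZFSet.{u}} [FOFun U f] [FOFun U g]
    [FOFun U h] : FORel U (fun v => f v = {g v, h v}) :=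
  (inferInstance : FORel U (fun v => g v ∈ f v ∧ h v ∈ f v ∧ ∀ a ∈ f v, a = g v ∨ a = h v)).congr
    fun v _ => by
    constructor
    · intro h; simp [h]
    · rintro ⟨h, h', h''⟩
      ext z
      simp only [ZFSet.mem_pair]
      exact ⟨h'' z, fun e => e.elim (fun e => e ▸ h) (fun e => e ▸ h')⟩

instance instEqPair {f g h : (Fin n → ZFSet.{u}) → ZFSet.{u}} [FOFun U f] [FOFun U g]
    [FOFun U h] : FORel U (fun v => f v = ZFSet.pair (g v) (h v)) :=
  (inferInstance : FORel U (fun v => (∃ a ∈ f v, a = {g v}) ∧ (∃ a ∈ f v, a = {g v, h v}) ∧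
    ∀ a ∈ f v, a = {g v} ∨ a = {g v, h v})).congr fun v _ => by
    constructor
    · intro h; simp [h, ZFSet.pair]
    · rintro ⟨⟨_, h, rfl⟩, ⟨_, h', rfl⟩, h''⟩
      ext z
      simp only [ZFSet.mem_pair, ZFSet.pair]
      exact ⟨h'' z, fun e => e.elim (fun e => e ▸ h) (fun e => e ▸ h')⟩

instance instPairMem {f g h : (Fin n → ZFSet.{u}) → ZFSet.{u}} [FOFun U f] [FOFun U g]
    [FOFun U h] : FORel U (fun v => ZFSet.pair (g v) (h v) ∈ f v) :=
  (inferInstance : FORel U (fun v => ∃ p ∈ f v, p = ZFSet.pair (g v) (h v))).congr fun v _ => by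
    simp

instance instPairRel {f g h : (Fin n → ZFSet.{u}) → ZFSet.{u}} [FOFun U f] [FOFun U g]
    [FOFun U h] : FORel U (fun v => pairRel (f v) (g v) (h v)) :=
  instPairMem

end FORel

/-! ### Transitive classes with separation and collection -/

/-- The union `⋃_{a ∈ x} f a`. -/
noncomputable def biUnion (x : ZFSet.{u}) (f : ZFSet.{u} → ZFSet.{u}) : ZFSet.{u} :=
  ZFSet.iUnion (fun a : x => f a.1)

@[simp] theorem mem_biUnion {x z : ZFSet.{u}} {f : ZFSet.{u} → ZFSet.{u}} :
    z ∈ biUnion x f ↔ ∃ a ∈ x, z ∈ f a := by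
  simp [biUnion]

/-- Transitive classes closed under pairing and union and satisfying full separation and
collection. -/
class SeparationCollectionClass (U : Set ZFSet.{u}) : Prop extends TransClass U where
  empty_mem : ∅ ∈ U
  unordered_mem : ∀ {x y : ZFSet.{u}}, x ∈ U → y ∈ U → ({x, y} : ZFSet.{u}) ∈ U
  sUnion_mem : ∀ {x : ZFSet.{u}}, x ∈ U → (ZFSet.sUnion x) ∈ U
  sep_mem : ∀ {P : ZFSet.{u} → Prop}, FORel U (fun v : Fin 1 → ZFSet.{u} => P (v 0)) →
    ∀ {x : ZFSet.{u}}, x ∈ U → x.sep P ∈ U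
  collection : ∀ {P : ZFSet.{u} → ZFSet.{u} → Prop},
    FORel U (fun v : Fin 2 → ZFSet.{u} => P (v 0) (v 1)) → ∀ {x : ZFSet.{u}}, x ∈ U →
    (∀ y ∈ x, ∃ z ∈ U, P y z) → ∃ w ∈ U, ∀ y ∈ x, ∃ z ∈ w, P y z

namespace FOFun

variable {U : Set ZFSet.{u}} {n m : ℕ}

/-- By extensionality in the transitive class `U`, the graph is definable as soon as membership in
the value is. -/
theorem of_mem [hU : TransClass U] {f : (Fin n → ZFSet.{u}) → ZFSet.{u}}
    (hf : ∀ v, (∀ i, v i ∈ U) → f v ∈ U)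
    (h : FORel U (fun w : Fin (n + 1) → ZFSet.{u} => w (Fin.last n) ∈ f (fun i => w i.castSucc))) :
    FOFun U f where
  maps := hf
  graph := by
    have h' := h.rename₁ (m := n + 2) (Q := fun v a => a ∈ f v) (fun i => i.castSucc.castSucc)
      (Fin.last (n + 1))
    refine FORel.congr (Q := fun w : Fin (n + 1) → ZFSet.{u} =>
      ∀ a ∈ U, (a ∈ w (Fin.last n) ↔ a ∈ f (fun i => w i.castSucc))) inferInstance fun w hw => ?_
    constructor
    · intro h; simp [h]
    · intro h
      ext z
      exact ⟨fun hz => (h z (hU.mem_of_mem (hw _) hz)).1 hz,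
        fun hz => (h z (hU.mem_of_mem (hf _ fun i => hw _) hz)).2 hz⟩

/-- Values of definable functions without arguments belong to the class. -/
theorem mem {c : ZFSet.{u}} (h : FOFun U (fun _ : Fin 0 → ZFSet.{u} => c)) : c ∈ U :=
  h.maps Fin.elim0 fun i => i.elim0

variable [hU : SeparationCollectionClass U]

instance instEmpty : FOFun U (fun _ : Fin n → ZFSet.{u} => ∅) := const hU.empty_mem

instance instUnordered {f g : (Fin n → ZFSet.{u}) → ZFSet.{u}} [hf : FOFun U f] [hg : FOFun U g] :
    FOFun U (fun v => ({f v, g v} : ZFSet.{u})) where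
  maps v hv := hU.unordered_mem (hf.maps v hv) (hg.maps v hv)
  graph := inferInstance

instance instSingleton {f : (Fin n → ZFSet.{u}) → ZFSet.{u}} [hf : FOFun U f] :
    FOFun U (fun v => ({f v} : ZFSet.{u})) where
  maps v hv := by
    rw [← ZFSet.pair_eq_singleton]
    exact hU.unordered_mem (hf.maps v hv) (hf.maps v hv)
  graph := inferInstance

instance instPair {f g : (Fin n → ZFSet.{u}) → ZFSet.{u}} [hf : FOFun U f] [hg : FOFun U g] :
    FOFun U (fun v => ZFSet.pair (f v) (g v)) := by
  unfold ZFSet.pair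
  infer_instance

instance instSUnion {f : (Fin n → ZFSet.{u}) → ZFSet.{u}} [hf : FOFun U f] :
    FOFun U (fun v => ZFSet.sUnion (f v)) := by
  refine .of_mem (fun v hv => hU.sUnion_mem (hf.maps v hv)) ?_
  simp only [ZFSet.mem_sUnion]
  infer_instance

instance instUnion {f g : (Fin n → ZFSet.{u}) → ZFSet.{u}} [hf : FOFun U f] [hg : FOFun U g] :
    FOFun U (fun v => f v ∪ g v) := by
  simp only [← ZFSet.sUnion_pair]
  infer_instance

instance instInsert {f g : (Fin n → ZFSet.{u}) → ZFSet.{u}} [hf : FOFun U f] [hg : FOFun U g] :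
    FOFun U (fun v => insert (f v) (g v)) := by
  simp only [ZFSet.insert_eq]
  infer_instance

instance instSep {f : (Fin n → ZFSet.{u}) → ZFSet.{u}} {Q : (Fin n → ZFSet.{u}) → ZFSet.{u} → Prop}
    [hf : FOFun U f] [h : FORel U (fun w : Fin (n + 1) → ZFSet.{u} =>
      Q (fun i => w i.castSucc) (w (Fin.last n)))] :
    FOFun U (fun v => ZFSet.sep (Q v) (f v)) := by
  refine .of_mem (fun v hv => hU.sep_mem (h.inst₁ hv) (hf.maps v hv)) ?_
  simp only [ZFSet.mem_sep]
  infer_instance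

instance instInter {f g : (Fin n → ZFSet.{u}) → ZFSet.{u}} [hf : FOFun U f] [hg : FOFun U g] :
    FOFun U (fun v => f v ∩ g v) := by
  simp only [← ZFSet.sep_mem]
  infer_instance

instance instDiff {f g : (Fin n → ZFSet.{u}) → ZFSet.{u}} [hf : FOFun U f] [hg : FOFun U g] :
    FOFun U (fun v => f v \ g v) := by
  simp only [← ZFSet.sep_notMem]
  infer_instance

/-- This is replacement: collection bounds the values `g v y` by a set, and separation cuts the
exact union out of the union of that bound. -/
instance instBiUnion {f : (Fin n → ZFSet.{u}) → ZFSet.{u}}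
    {g : (Fin n → ZFSet.{u}) → ZFSet.{u} → ZFSet.{u}}
    [hf : FOFun U f] [hg : FOFun U (fun w : Fin (n + 1) → ZFSet.{u} =>
      g (fun i => w i.castSucc) (w (Fin.last n)))] :
    FOFun U (fun v => biUnion (f v) (g v)) := by
  have hgr : FORel U (fun w : Fin (n + 2) → ZFSet.{u} => w (Fin.last (n + 1)) =
      g (fun i => w i.castSucc.castSucc) (w (Fin.last n).castSucc)) := hg.graph
  have hgm : FORel U (fun w : Fin (n + 2) → ZFSet.{u} => w (Fin.last n).castSucc ∈
      g (fun i => w i.castSucc.castSucc) (w (Fin.last (n + 1)))) := by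
    have := hg.rename (m := n + 2) (Fin.snoc (α := fun _ => Fin (n + 2))
      (fun i => i.castSucc.castSucc) (Fin.last (n + 1)))
    simp only [Fin.snoc_castSucc, Fin.snoc_last] at this
    infer_instance
  have hgU : ∀ v, (∀ i, v i ∈ U) → ∀ y ∈ U, g v y ∈ U := by
    intro v hv y hy
    have := hg.maps (Fin.snoc (α := fun _ => ZFSet.{u}) v y) (fun i => by
      refine Fin.lastCases ?_ (fun i => ?_) i <;> simp [hv, hy])
    simpa using this
  have hmem : FORel U (fun w : Fin (n + 1) → ZFSet.{u} => w (Fin.last n) ∈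
      biUnion (f (fun i => w i.castSucc)) (g (fun i => w i.castSucc))) := by
    simp only [mem_biUnion]
    infer_instance
  refine .of_mem (fun v hv => ?_) hmem
  obtain ⟨w, hw, h⟩ := hU.collection (P := fun y z => z = g v y)
    (FORel.inst₂ (Q := fun v y z => z = g v y) hgr hv)
    (hf.maps v hv) (fun y hy => ⟨_, hgU v hv y (hU.mem_of_mem (hf.maps v hv) hy), rfl⟩)
  convert hU.sep_mem (hmem.inst₁ (Q := fun v a => a ∈ biUnion (f v) (g v)) hv)
    (hU.sUnion_mem hw) using 1
  ext z
  simp only [mem_biUnion, ZFSet.mem_sep, ZFSet.mem_sUnion]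
  refine ⟨?_, fun h => h.2⟩
  rintro ⟨a, ha, hz⟩
  obtain ⟨_, hb, rfl⟩ := h a ha
  exact ⟨⟨_, hb, hz⟩, a, ha, hz⟩

end FOFun

/-- Definable functions of three arguments. -/
class FOFun₃ (U : Set ZFSet.{u}) (D : ZFSet.{u} → ZFSet.{u} → ZFSet.{u} → ZFSet.{u}) : Prop where
  comp : ∀ {n : ℕ} (f g h : (Fin n → ZFSet.{u}) → ZFSet.{u}) [FOFun U f] [FOFun U g] [FOFun U h],
    FOFun U (fun v => D (f v) (g v) (h v))

/-! ### Definition by recursion on membership -/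

/-- The function `G` with `G x = ⋃_{z ∈ x} D p z (G z)`. -/
noncomputable def unionRec (D : ZFSet.{u} → ZFSet.{u} → ZFSet.{u} → ZFSet.{u}) (p : ZFSet.{u}) :
    ZFSet.{u} → ZFSet.{u} :=
  ZFSet.mem_wf.fix fun x G => ZFSet.iUnion (fun z : x => D p z.1 (G z.1 z.2))

theorem unionRec_eq (D : ZFSet.{u} → ZFSet.{u} → ZFSet.{u} → ZFSet.{u}) (p x : ZFSet.{u}) :
    unionRec D p x = biUnion x (fun z => D p z (unionRec D p z)) := by
  rw [unionRec, WellFounded.fix_eq]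
  rfl

/-- `f` is a partial approximation of the graph of `unionRec D p`. -/
def IsRecApprox (U : Set ZFSet.{u}) (D : ZFSet.{u} → ZFSet.{u} → ZFSet.{u} → ZFSet.{u})
    (p f : ZFSet.{u}) : Prop :=
  ∀ x ∈ U, ∀ y ∈ U, ZFSet.pair x y ∈ f → (∀ z ∈ x, ∃ w ∈ U, ZFSet.pair z w ∈ f) ∧
    ∀ u ∈ U, u ∈ y ↔ ∃ z ∈ x, ∃ w ∈ U, ZFSet.pair z w ∈ f ∧ u ∈ D p z w

theorem FOFun₃.mem {U : Set ZFSet.{u}}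
    {D : ZFSet.{u} → ZFSet.{u} → ZFSet.{u} → ZFSet.{u}} [hD : FOFun₃ U D] {x y z : ZFSet.{u}} (hx : x ∈ U) (hy : y ∈ U) (hz : z ∈ U) : D x y z ∈ U := by
  have := Fact.mk hx
  have := Fact.mk hy
  have := Fact.mk hz
  exact FOFun.mem (hD.comp _ _ _)

theorem mem_and_mem_of_pair_mem {U : Set ZFSet.{u}} [hU : TransClass U] {x y : ZFSet.{u}}
    (h : ZFSet.pair x y ∈ U) : x ∈ U ∧ y ∈ U := by
  have : ({x, y} : ZFSet.{u}) ∈ U := hU.mem_of_mem h (by simp [ZFSet.pair])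
  exact ⟨hU.mem_of_mem this (by simp), hU.mem_of_mem this (by simp)⟩

section Recursion

variable {U : Set ZFSet.{u}} [hU : SeparationCollectionClass U]
  {D : ZFSet.{u} → ZFSet.{u} → ZFSet.{u} → ZFSet.{u}} [hD : FOFun₃ U D]

instance {n : ℕ} {f g h : (Fin n → ZFSet.{u}) → ZFSet.{u}} [FOFun U f] [FOFun U g] [FOFun U h] :
    FOFun U (fun v => D (f v) (g v) (h v)) := hD.comp f g h

instance {n : ℕ} {p f : (Fin n → ZFSet.{u}) → ZFSet.{u}} [FOFun U p] [FOFun U f] :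
    FORel U (fun v => IsRecApprox U D (p v) (f v)) := by
  unfold IsRecApprox
  infer_instance

/-- Uniqueness half of the recursion theorem, by induction on `x`: an approximation is defined at
all members of each of its arguments, so its values obey the recursion equation. -/
theorem IsRecApprox.eq_unionRec {p f : ZFSet.{u}} (hp : p ∈ U) (hf : f ∈ U)
    (h : IsRecApprox U D p f) (x : ZFSet.{u}) :
    ∀ y, ZFSet.pair x y ∈ f → y = unionRec D p x := by
  induction x using ZFSet.inductionOn with
  | h x ih =>
    intro y hxy
    obtain ⟨hx, hy⟩ := mem_and_mem_of_pair_mem (hU.mem_of_mem hf hxy)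
    obtain ⟨h₁, h₂⟩ := h x hx y hy hxy
    rw [unionRec_eq]
    ext u
    rw [mem_biUnion]
    constructor
    · intro hu
      obtain ⟨z, hz, w, _, hw, hu⟩ := (h₂ u (hU.mem_of_mem hy hu)).1 hu
      rw [ih z hz w hw] at hu
      exact ⟨z, hz, hu⟩
    · rintro ⟨z, hz, hu⟩
      obtain ⟨w, hwU, hw⟩ := h₁ z hz
      rw [← ih z hz w hw] at hu
      exact (h₂ u (hU.mem_of_mem (FOFun₃.mem hp (hU.mem_of_mem hx hz) hwU) hu)).2
        ⟨z, hz, w, hwU, hw, hu⟩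

/-- Existence half of the recursion theorem. Collection gathers approximations for all `z ∈ x`; by
uniqueness they agree, so their union `F` is again one, and the pair for `x` is adjoined to it. -/
theorem exists_isRecApprox {p : ZFSet.{u}} (hp : p ∈ U) (x : ZFSet.{u}) :
    x ∈ U → ∃ f ∈ U, IsRecApprox U D p f ∧ ZFSet.pair x (unionRec D p x) ∈ f := by
  induction x using ZFSet.inductionOn with
  | h x ih =>
    intro hx
    have := Fact.mk hp
    have := Fact.mk hx
    obtain ⟨W, hW, h⟩ := hU.collection (P := fun z f => IsRecApprox U D p f ∧
      ∃ w ∈ U, ZFSet.pair z w ∈ f) inferInstance hx (fun z hz => by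
        have hzU := hU.mem_of_mem hx hz
        obtain ⟨f, hf, h, hzf⟩ := ih z hz hzU
        exact ⟨f, hf, h, _, (mem_and_mem_of_pair_mem (hU.mem_of_mem hf hzf)).2, hzf⟩)
    have := Fact.mk hW
    have hW' : ZFSet.sep (fun f => IsRecApprox U D p f) W ∈ U := FOFun.mem inferInstance
    have := Fact.mk hW'
    generalize hFdef : ZFSet.sUnion (ZFSet.sep (fun f => IsRecApprox U D p f) W) = F
    have hF : F ∈ U := hFdef ▸ hU.sUnion_mem hW'
    have := Fact.mk hF
    have memF : ∀ {q}, q ∈ F ↔ ∃ f ∈ W, IsRecApprox U D p f ∧ q ∈ f := by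
      intro q; simp [← hFdef, and_assoc]
    have eqF : ∀ {z w}, ZFSet.pair z w ∈ F → w = unionRec D p z := by
      intro z w hzw
      obtain ⟨f, hf, h, hzw⟩ := memF.1 hzw
      exact h.eq_unionRec hp (hU.mem_of_mem hW hf) z w hzw
    have inF : ∀ {z}, z ∈ x → ZFSet.pair z (unionRec D p z) ∈ F := by
      intro z hz
      obtain ⟨f, hf, h, w, _, hw⟩ := h z hz
      have hF := memF.2 ⟨f, hf, h, hw⟩
      rwa [eqF hF] at hF
    have valU : ∀ {z w}, ZFSet.pair z w ∈ F → w ∈ U := fun h =>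
      (mem_and_mem_of_pair_mem (hU.mem_of_mem hF h)).2
    have hFapp : ∀ x ∈ U, ∀ y ∈ U, ZFSet.pair x y ∈ F → (∀ z ∈ x, ∃ w ∈ U, ZFSet.pair z w ∈ F) ∧
        ∀ u ∈ U, u ∈ y ↔ ∃ z ∈ x, ∃ w ∈ U, ZFSet.pair z w ∈ F ∧ u ∈ D p z w := by
      intro x hx y hy hxy
      obtain ⟨f, hf, h, hxyf⟩ := memF.1 hxy
      obtain ⟨h₁, h₂⟩ := h x hx y hy hxyf
      have h₁' : ∀ z ∈ x, ∃ w ∈ U, ZFSet.pair z w ∈ F := fun z hz => by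
        obtain ⟨w, hw, hzw⟩ := h₁ z hz
        exact ⟨w, hw, memF.2 ⟨f, hf, h, hzw⟩⟩
      refine ⟨h₁', fun u hu => (h₂ u hu).trans ?_⟩
      constructor
      · rintro ⟨z, hz, w, hw, hzw, hu⟩
        exact ⟨z, hz, w, hw, memF.2 ⟨f, hf, h, hzw⟩, hu⟩
      · rintro ⟨z, hz, w, hw, hzw, hu⟩
        obtain ⟨w', hw', hzw'⟩ := h₁ z hz
        rw [eqF hzw, ← eqF (memF.2 ⟨f, hf, h, hzw'⟩)] at hu
        exact ⟨z, hz, w', hw', hzw', hu⟩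
    have memy : ∀ u, u ∈ unionRec D p x ↔ ∃ z ∈ x, ∃ w ∈ U, ZFSet.pair z w ∈ F ∧ u ∈ D p z w := by
      intro u
      rw [unionRec_eq, mem_biUnion]
      constructor
      · rintro ⟨z, hz, hu⟩
        exact ⟨z, hz, _, valU (inF hz), inF hz, hu⟩
      · rintro ⟨z, hz, w, _, hzw, hu⟩
        rw [eqF hzw] at hu
        exact ⟨z, hz, hu⟩
    have hy : unionRec D p x ∈ U := by
      -- Definability of `unionRec` itself is not available yet. The values are instead read off
      -- from `F`, as second entries found in `⋃⋃F`.
      have : unionRec D p x = biUnion x (fun z => biUnion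
          (ZFSet.sep (fun w => ZFSet.pair z w ∈ F) (ZFSet.sUnion (ZFSet.sUnion F)))
          (fun w => D p z w)) := by
        ext u
        simp only [memy, mem_biUnion, ZFSet.mem_sep, ZFSet.mem_sUnion]
        constructor
        · rintro ⟨z, hz, w, _, hzw, hu⟩
          exact ⟨z, hz, w, ⟨⟨{z, w}, ⟨_, hzw, by simp [ZFSet.pair]⟩, by simp⟩, hzw⟩, hu⟩
        · rintro ⟨z, hz, w, ⟨_, hzw⟩, hu⟩
          exact ⟨z, hz, w, valU hzw, hzw, hu⟩
      rw [this]
      exact FOFun.mem inferInstance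
    have := Fact.mk hy
    refine ⟨insert (ZFSet.pair x (unionRec D p x)) F, FOFun.mem inferInstance, ?_, by simp⟩
    intro x' hx' y' hy' h'
    have key : (∀ z ∈ x', ∃ w ∈ U, ZFSet.pair z w ∈ F) ∧
        ∀ u ∈ U, u ∈ y' ↔ ∃ z ∈ x', ∃ w ∈ U, ZFSet.pair z w ∈ F ∧ u ∈ D p z w := by
      rcases ZFSet.mem_insert_iff.1 h' with h' | h'
      · obtain ⟨rfl, rfl⟩ := ZFSet.pair_inj.1 h'
        exact ⟨fun z hz => ⟨_, valU (inF hz), inF hz⟩, fun u _ => memy u⟩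
      · exact hFapp x' hx' y' hy' h'
    refine ⟨fun z hz => ?_, fun u hu => (key.2 u hu).trans ?_⟩
    · obtain ⟨w, hw, h⟩ := key.1 z hz
      exact ⟨w, hw, ZFSet.mem_insert_of_mem _ h⟩
    · constructor
      · rintro ⟨z, hz, w, hw, hzw, hu⟩
        exact ⟨z, hz, w, hw, ZFSet.mem_insert_of_mem _ hzw, hu⟩
      · rintro ⟨z, hz, w, hw, hzw, hu⟩
        -- If the pair used is the newly inserted one, `F` still contains a pair with the same first
        -- entry, and uniqueness of values identifies the two.
        refine ⟨z, hz, w, hw, ?_, hu⟩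
        rcases ZFSet.mem_insert_iff.1 hzw with e | e
        · obtain ⟨rfl, rfl⟩ := ZFSet.pair_inj.1 e
          obtain ⟨w', hw', hzw'⟩ := key.1 _ hz
          rwa [eqF hzw'] at hzw'
        · exact e

theorem unionRec_mem {p x : ZFSet.{u}} (hp : p ∈ U) (hx : x ∈ U) : unionRec D p x ∈ U := by
  obtain ⟨f, hf, _, h⟩ := exists_isRecApprox (D := D) hp x hx
  exact (mem_and_mem_of_pair_mem (hU.mem_of_mem hf h)).2

/-- The graph is defined by the existence of an approximation in `U` containing the pair; it is
correct by the two halves above. -/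
instance FOFun.instUnionRec {n : ℕ} {f g : (Fin n → ZFSet.{u}) → ZFSet.{u}} [hf : FOFun U f]
    [hg : FOFun U g] : FOFun U (fun v => unionRec D (f v) (g v)) where
  maps v hv := unionRec_mem (hf.maps v hv) (hg.maps v hv)
  graph := by
    refine FORel.congr (Q := fun w : Fin (n + 1) → ZFSet.{u} => ∃ F ∈ U,
      IsRecApprox U D (f (fun i => w i.castSucc)) F ∧
      ZFSet.pair (g (fun i => w i.castSucc)) (w (Fin.last n)) ∈ F) inferInstance fun w hw => ?_
    have hfU := hf.maps (fun i => w i.castSucc) (fun i => hw _)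
    constructor
    · intro h
      rw [h]
      exact exists_isRecApprox hfU _ (hg.maps _ fun i => hw _)
    · rintro ⟨F, hF, hap, h⟩
      exact hap.eq_unionRec hfU hF _ _ h

end Recursion

/-! ## One-sorted definability over the classes of a model -/

namespace ClassFormula

/-- Biconditional. -/
def iff (φ ψ : ClassFormula) : ClassFormula := .and (.neg (.and φ (.neg ψ))) (.neg (.and ψ (.neg φ)))

/-- Existential quantification over sets. -/
def exSet (i : ℕ) (φ : ClassFormula) : ClassFormula := .neg (.allSet i (.neg φ))

/-- Existential quantification over classes. -/
def exClass (i : ℕ) (φ : ClassFormula) : ClassFormula := .neg (.allClass i (.neg φ))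

variable {M 𝒞 : ZFSet.{u}} {v V : ℕ → ZFSet.{u}}

theorem sat_iff {φ ψ : ClassFormula} :
    (φ.iff ψ).Sat M 𝒞 v V ↔ (φ.Sat M 𝒞 v V ↔ ψ.Sat M 𝒞 v V) := by
  simp only [iff, Sat]; tauto

theorem sat_exSet {i : ℕ} {φ : ClassFormula} :
    (φ.exSet i).Sat M 𝒞 v V ↔ ∃ a ∈ M, φ.Sat M 𝒞 (Function.update v i a) V := by
  simp [exSet, Sat]

theorem sat_exClass {i : ℕ} {φ : ClassFormula} :
    (φ.exClass i).Sat M 𝒞 v V ↔ ∃ A ∈ 𝒞, φ.Sat M 𝒞 v (Function.update V i A) := by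
  simp [exClass, Sat]

end ClassFormula

namespace IsMKModel

variable {M 𝒞 : ZFSet.{u}} (h : IsMKModel M 𝒞)
include h

theorem mem_of_mem {x y : ZFSet.{u}} (hx : x ∈ M) (hy : y ∈ x) : y ∈ M :=
  h.transitive.subset_of_mem hx hy

theorem exists_set : ∃ x, x ∈ M := let ⟨x, hx, _⟩ := h.infinity; ⟨x, hx⟩

theorem exists_class : ∃ X, X ∈ 𝒞 := let ⟨X, hX, _⟩ := h.globalChoice; ⟨X, hX⟩

theorem univ_mem : M ∈ 𝒞 := by
  obtain ⟨x, hx⟩ := h.exists_set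
  obtain ⟨X, hX⟩ := h.exists_class
  convert h.comprehension (.setEq 0 0) 0 (fun _ => x) (fun _ => X) (fun _ => hx) (fun _ => hX)
    using 1
  ext z
  simp [ClassFormula.Sat]

theorem set_mem {x : ZFSet.{u}} (hx : x ∈ M) : x ∈ 𝒞 := by
  obtain ⟨X, hX⟩ := h.exists_class
  convert h.comprehension (.setMem 0 1) 0 (fun _ => x) (fun _ => X) (fun _ => hx) (fun _ => hX)
    using 1
  ext z
  simpa [ClassFormula.Sat] using h.mem_of_mem hx

/-- Elements of classes are sets of the model, and these are themselves classes. So `(𝒞, ∈)` can be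
handled as a one-sorted transitive structure, to which the calculus of `FORel` applies. -/
theorem transClass : TransClass (𝒞 : Set ZFSet.{u}) where
  mem_of_mem hx hy := h.set_mem (h.class_subset _ hx hy)

theorem pair_mem {x y : ZFSet.{u}} (hx : x ∈ M) (hy : y ∈ M) : ZFSet.pair x y ∈ M := by
  unfold ZFSet.pair
  refine h.pairing _ ?_ _ (h.pairing _ hx _ hy)
  rw [← ZFSet.pair_eq_singleton]
  exact h.pairing _ hx _ hx

theorem mem_of_pair_mem {x y : ZFSet.{u}} (hp : ZFSet.pair x y ∈ M) : x ∈ M ∧ y ∈ M := by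
  have : ({x, y} : ZFSet.{u}) ∈ M := h.mem_of_mem hp (by simp [ZFSet.pair])
  exact ⟨h.mem_of_mem this (by simp), h.mem_of_mem this (by simp)⟩

theorem mem_of_pairRel {E x y : ZFSet.{u}} (hE : E ∈ 𝒞) (hp : pairRel E x y) : x ∈ M ∧ y ∈ M :=
  h.mem_of_pair_mem (h.class_subset _ hE hp)

theorem empty_mem : ∅ ∈ M := by
  obtain ⟨x, hx, h0, _⟩ := h.infinity
  exact h.mem_of_mem hx h0

/-- Two-sorted formulas cannot say that a class belongs to a class, so membership is rendered by
"some set with the same elements belongs to it". In the quantifier case the class variable `n` is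
fresh and is exactly the one read by the last coordinate. -/
theorem exists_formula {n : ℕ} {Q : (Fin n → ZFSet.{u}) → Prop}
    (hQ : FOPure (𝒞 : Set ZFSet.{u}) Q) : ∃ φ : ClassFormula, ∀ v V : ℕ → ZFSet.{u},
      (∀ k, V k ∈ 𝒞) → (φ.Sat M 𝒞 v V ↔ Q (fun i => V i)) := by
  induction hQ with
  | mem i j =>
    refine ⟨.exSet 0 (.and (.allSet 1 (.iff (.setMem 1 0) (.classMem 1 i))) (.classMem 0 j)),
      fun v V hV => ?_⟩
    simp only [ClassFormula.sat_exSet, ClassFormula.Sat, ClassFormula.sat_iff]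
    simp only [Function.update_self, ne_eq, zero_ne_one, not_false_eq_true,
      Function.update_of_ne]
    constructor
    · rintro ⟨x, hx, h', hj⟩
      rwa [← h.class_ext x (h.set_mem hx) (V i) (hV i) h']
    · intro hij
      exact ⟨V i, h.class_subset _ (hV j) hij, fun z _ => Iff.rfl, hij⟩
  | eq i j =>
    exact ⟨.classEq i j, fun v V hV => Iff.rfl⟩
  | not _ ih =>
    obtain ⟨φ, hφ⟩ := ih
    exact ⟨.neg φ, fun v V hV => not_congr (hφ v V hV)⟩
  | and _ _ ih ih' =>
    obtain ⟨φ, hφ⟩ := ih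
    obtain ⟨ψ, hψ⟩ := ih'
    exact ⟨.and φ ψ, fun v V hV => and_congr (hφ v V hV) (hψ v V hV)⟩
  | @all n P _ ih =>
    obtain ⟨φ, hφ⟩ := ih
    refine ⟨.allClass n φ, fun v V hV => forall₂_congr fun A hA => ?_⟩
    rw [hφ]
    · refine iff_of_eq (congrArg _ (funext fun i => ?_))
      refine Fin.lastCases ?_ (fun i => ?_) i
      · simp
      · simp [i.2.ne]
    · intro k
      rcases eq_or_ne k n with rfl | hk
      · simpa using hA
      · simpa [hk] using hV k

/-- A definable relation on classes is expressed by a formula in which one of the arguments is a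
set variable. -/
theorem exists_formula_set {m k : ℕ} {P : (Fin k → ZFSet.{u}) → Prop}
    {p : Fin m → ZFSet.{u}} {Q : (Fin (m + k) → ZFSet.{u}) → Prop} (hp : ∀ i, p i ∈ 𝒞)
    (hQ : FOPure (𝒞 : Set ZFSet.{u}) Q)
    (hPQ : ∀ v, (∀ i, v i ∈ 𝒞) → (P v ↔ Q (Fin.append p v))) :
    ∃ (φ : ClassFormula) (V : ℕ → ZFSet.{u}), (∀ j, V j ∈ 𝒞) ∧ ∀ v x V', x ∈ M →
      (∀ j, V' j ∈ 𝒞) → (∀ j < m, V' j = V j) → (φ.Sat M 𝒞 (Function.update v 0 x) V' ↔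
        P (fun i => Function.update V' m x (m + i))) := by
  obtain ⟨φ, hφ⟩ := h.exists_formula hQ
  -- The set variable `0` is copied into the class variable `m`: a class with the same elements is
  -- quantified, and by extensionality it is that set. The class variables below `m` hold the
  -- parameters.
  refine ⟨.exClass m (.and (.allSet 1 (.iff (.classMem 1 m) (.setMem 1 0))) φ),
    fun j => if hj : j < m then p ⟨j, hj⟩ else M, ?_, ?_⟩
  · intro j
    dsimp only
    split
    · exact hp _
    · exact h.univ_mem
  · intro v x V' hx hV' heq
    have hV'' : ∀ A ∈ 𝒞, ∀ j, Function.update V' m A j ∈ 𝒞 := by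
      intro A hA j
      rcases eq_or_ne j m with rfl | hj
      · simpa using hA
      · simpa [hj] using hV' j
    have e : ∀ A ∈ 𝒞, ∀ w, φ.Sat M 𝒞 w (Function.update V' m A) ↔
        P (fun i => Function.update V' m A (m + i)) := by
      intro A hA w
      rw [hφ _ _ (hV'' A hA), hPQ _ (fun i => hV'' A hA _)]
      refine iff_of_eq (congrArg _ (funext fun i => ?_))
      refine Fin.addCases (fun i => ?_) (fun i => ?_) i
      · simp [heq i i.2, i.2.ne]
      · simp
    simp only [ClassFormula.sat_exClass, ClassFormula.Sat, ClassFormula.sat_iff]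
    simp only [Function.update_self, ne_eq, zero_ne_one, not_false_eq_true,
      Function.update_of_ne]
    constructor
    · rintro ⟨A, hA, h', hs⟩
      obtain rfl := h.class_ext A hA x (h.set_mem hx) h'
      exact (e A hA _).1 hs
    · intro hP
      exact ⟨x, h.set_mem hx, fun z _ => Iff.rfl, (e x (h.set_mem hx) _).2 hP⟩

/-- One-sorted form of Class-Comprehension. -/
theorem sep_mem {P : ZFSet.{u} → Prop}
    (hP : FORel (𝒞 : Set ZFSet.{u}) (fun v : Fin 1 → ZFSet.{u} => P (v 0))) : M.sep P ∈ 𝒞 := by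
  obtain ⟨m, p, Q, hp, hQ, hPQ⟩ := hP
  obtain ⟨φ, V, hV, hφ⟩ := h.exists_formula_set hp hQ hPQ
  obtain ⟨c, hc⟩ := h.exists_set
  convert h.comprehension φ 0 (fun _ => c) V (fun _ => hc) hV using 1
  ext x
  simp only [ZFSet.mem_sep]
  refine and_congr_right fun hx => ?_
  rw [hφ _ _ _ hx hV (fun _ _ => rfl)]
  simp

theorem classSection_mem {B y : ZFSet.{u}} (hB : B ∈ 𝒞) (hy : y ∈ M) :
    classSection M B y ∈ 𝒞 := by
  have := h.transClass
  have : Fact (B ∈ (𝒞 : Set ZFSet.{u})) := ⟨hB⟩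
  have : Fact (y ∈ (𝒞 : Set ZFSet.{u})) := ⟨h.set_mem hy⟩
  exact h.sep_mem inferInstance

omit h in
-- One-sorted form of Class-Bounding.
theorem _root_.IsMKStarModel.exists_bound (h : IsMKStarModel M 𝒞) {P : ZFSet.{u} → ZFSet.{u} → Prop}
    (hP : FORel (𝒞 : Set ZFSet.{u}) (fun v : Fin 2 → ZFSet.{u} => P (v 0) (v 1)))
    (hex : ∀ x ∈ M, ∃ A ∈ 𝒞, P x A) :
    ∃ B ∈ 𝒞, ∀ x ∈ M, ∃ y ∈ M, P x (classSection M B y) := by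
  obtain ⟨m, p, Q, hp, hQ, hPQ⟩ := hP
  obtain ⟨φ, V, hV, hφ⟩ := h.exists_formula_set hp hQ hPQ
  obtain ⟨c, hc⟩ := h.exists_set
  have key : ∀ x ∈ M, ∀ A ∈ 𝒞, φ.Sat M 𝒞 (Function.update (fun _ => c) 0 x)
      (Function.update V (m + 1) A) ↔ P x A := by
    intro x hx A hA
    rw [hφ _ _ _ hx]
    · simp
    · intro j
      rcases eq_or_ne j (m + 1) with rfl | hj
      · simpa using hA
      · simpa [hj] using hV j
    · intro j hj
      rw [Function.update_of_ne (by omega)]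
  -- Index `m + 1` because the classes below `m` are parameters and class `m` is reserved for the
  -- copy of the set argument.
  obtain ⟨B, hB, h'⟩ := h.classBounding φ 0 (m + 1) (fun _ => c) V (fun _ => hc) hV
    fun x hx => (hex x hx).imp fun A hA => ⟨hA.1, (key x hx A hA.1).2 hA.2⟩
  refine ⟨B, hB, fun x hx => (h' x hx).imp fun y hy => ⟨hy.1, ?_⟩⟩
  exact (key x hx _ (h.classSection_mem hB hy.1)).1 hy.2

end IsMKModel

/-! ## Sets coded by well-founded class relations -/

section Collapse

open Classical in
/-- The Mostowski collapse of the well-founded relation coded by `E` (junk if `E` is not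
well-founded). -/
noncomputable def collapse (E : ZFSet.{u}) : ZFSet.{u} → ZFSet.{u} :=
  if hE : WellFounded (pairRel E) then
    hE.fix fun z ih => ZFSet.iUnion fun y : (ZFSet.sUnion (ZFSet.sUnion E) : ZFSet.{u}) =>
      if hy : pairRel E y.1 z then {ih y.1 hy} else ∅
  else fun _ => ∅

/-- The index set `⋃⋃E` in the definition only keeps the union small: it contains every
`E`-predecessor, since `{y, z} ∈ (y, z)`. -/
theorem mem_collapse {E : ZFSet.{u}} (hE : WellFounded (pairRel E)) {u z : ZFSet.{u}} :
    u ∈ collapse E z ↔ ∃ y, pairRel E y z ∧ u = collapse E y := by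
  rw [collapse, dif_pos hE, WellFounded.fix_eq, ZFSet.mem_iUnion]
  constructor
  · rintro ⟨y, hy⟩
    split at hy
    · next h => exact ⟨y, h, by simpa using hy⟩
    · simp at hy
  · rintro ⟨y, hy, rfl⟩
    refine ⟨⟨y, ?_⟩, ?_⟩
    · rw [ZFSet.mem_sUnion]
      exact ⟨{y, z}, ZFSet.mem_sUnion.2 ⟨_, hy, by simp [ZFSet.pair]⟩, by simp⟩
    · simp [hy]

theorem collapse_mem {E : ZFSet.{u}} (hE : WellFounded (pairRel E)) {y z : ZFSet.{u}}
    (h : pairRel E y z) : collapse E y ∈ collapse E z := (mem_collapse hE).2 ⟨y, h, rfl⟩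

/-- A map that sends the predecessors of each point of a class onto the predecessors of its image
preserves collapses. -/
theorem collapse_eq_of_map {E F : ZFSet.{u}} (hE : WellFounded (pairRel E))
    (hF : WellFounded (pairRel F)) (f : ZFSet.{u} → ZFSet.{u})
    (hf : ∀ y z, pairRel E y z → pairRel F (f y) (f z))
    (hf' : ∀ w z, pairRel F w (f z) → ∃ y, pairRel E y z ∧ w = f y) (z : ZFSet.{u}) :
    collapse F (f z) = collapse E z := by
  induction z using hE.induction with
  | h z ih =>
    ext u
    rw [mem_collapse hF, mem_collapse hE]
    constructor
    · rintro ⟨w, hw, rfl⟩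
      obtain ⟨y, hy, rfl⟩ := hf' w z hw
      exact ⟨y, hy, ih y hy⟩
    · rintro ⟨y, hy, rfl⟩
      exact ⟨f y, hf y z hy, (ih y hy).symm⟩

end Collapse

/-- The sets that are collapses of well-founded class relations. -/
def collapseValues (𝒞 : ZFSet.{u}) : Set ZFSet.{u} :=
  {x | ∃ E ∈ 𝒞, WellFounded (pairRel E) ∧ x = collapse E ∅}

theorem pair_self_ne_empty (x : ZFSet.{u}) : ZFSet.pair x x ≠ ∅ := by
  intro e
  have : ({x} : ZFSet.{u}) ∈ ZFSet.pair x x := by simp [ZFSet.pair]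
  rw [e] at this
  exact ZFSet.notMem_empty _ this

/-- Some class is a bisimulation between the relations `E` and `F` relating `b` and `c`. -/
def Bisimilar (M 𝒞 E b F c : ZFSet.{u}) : Prop :=
  ∃ B ∈ (𝒞 : Set ZFSet.{u}), ZFSet.pair b c ∈ B ∧ ∀ b ∈ M, ∀ c ∈ M, ZFSet.pair b c ∈ B →
    (∀ b' ∈ M, pairRel E b' b → ∃ c' ∈ M, pairRel F c' c ∧ ZFSet.pair b' c' ∈ B) ∧
    (∀ c' ∈ M, pairRel F c' c → ∃ b' ∈ M, pairRel E b' b ∧ ZFSet.pair b' c' ∈ B)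

instance {M 𝒞 : ZFSet.{u}} [TransClass (𝒞 : Set ZFSet.{u})] [Fact (M ∈ (𝒞 : Set ZFSet.{u}))]
    {n : ℕ} {e b f c : (Fin n → ZFSet.{u}) → ZFSet.{u}} [FOFun (𝒞 : Set ZFSet.{u}) e]
    [FOFun (𝒞 : Set ZFSet.{u}) b] [FOFun (𝒞 : Set ZFSet.{u}) f] [FOFun (𝒞 : Set ZFSet.{u}) c] :
    FORel (𝒞 : Set ZFSet.{u}) (fun v => Bisimilar M 𝒞 (e v) (b v) (f v) (c v)) := by
  unfold Bisimilar
  infer_instance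

namespace IsMKModel

variable {M 𝒞 : ZFSet.{u}} (h : IsMKModel M 𝒞)
include h

theorem fact_univ : Fact (M ∈ (𝒞 : Set ZFSet.{u})) := ⟨h.univ_mem⟩

theorem fact_empty : Fact (∅ ∈ (𝒞 : Set ZFSet.{u})) := ⟨h.set_mem h.empty_mem⟩

/-- Bisimilar nodes have equal collapses by induction along `E`. Conversely the pairs of bisimilar
nodes together with `(b, c)` form a class by comprehension; it is a bisimulation because, by
induction, predecessors with equal collapses are already bisimilar. -/
theorem bisimilar_iff {E F : ZFSet.{u}} (hE : E ∈ 𝒞) (hF : F ∈ 𝒞) (wE : WellFounded (pairRel E))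
    (wF : WellFounded (pairRel F)) {b : ZFSet.{u}} : ∀ {c : ZFSet.{u}}, b ∈ M → c ∈ M →
    (Bisimilar M 𝒞 E b F c ↔ collapse E b = collapse F c) := by
  have := h.transClass
  have := h.fact_univ
  have : Fact (E ∈ (𝒞 : Set ZFSet.{u})) := ⟨hE⟩
  have : Fact (F ∈ (𝒞 : Set ZFSet.{u})) := ⟨hF⟩
  induction b using wE.induction with
  | h b ih =>
  intro c hb hc
  constructor
  · rintro ⟨B, hB, hbc, hB'⟩
    obtain ⟨h₁, h₂⟩ := hB' b hb c hc hbc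
    ext u
    rw [mem_collapse wE, mem_collapse wF]
    constructor
    · rintro ⟨b', hb', rfl⟩
      have hbM := (h.mem_of_pairRel hE hb').1
      obtain ⟨c', hcM, hc', hbc'⟩ := h₁ b' hbM hb'
      exact ⟨c', hc', (ih b' hb' hbM hcM).1 ⟨B, hB, hbc', hB'⟩⟩
    · rintro ⟨c', hc', rfl⟩
      have hcM := (h.mem_of_pairRel hF hc').1
      obtain ⟨b', hbM, hb', hbc'⟩ := h₂ c' hcM hc'
      exact ⟨b', hb', ((ih b' hb' hbM hcM).1 ⟨B, hB, hbc', hB'⟩).symm⟩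
  · intro heq
    have : Fact (b ∈ (𝒞 : Set ZFSet.{u})) := ⟨h.set_mem hb⟩
    have : Fact (c ∈ (𝒞 : Set ZFSet.{u})) := ⟨h.set_mem hc⟩
    have hmem : ∀ {x y}, x ∈ M → y ∈ M → (ZFSet.pair x y ∈ M.sep (fun q => q = ZFSet.pair b c ∨
        ∃ x ∈ M, ∃ y ∈ M, q = ZFSet.pair x y ∧ Bisimilar M 𝒞 E x F y) ↔
        (x = b ∧ y = c) ∨ Bisimilar M 𝒞 E x F y) := by
      intro x y hx hy
      simp only [ZFSet.mem_sep, h.pair_mem hx hy, true_and, ZFSet.pair_inj]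
      refine or_congr_right ⟨?_, fun hxy => ⟨x, hx, y, hy, ⟨rfl, rfl⟩, hxy⟩⟩
      rintro ⟨x, hx, y, hy, ⟨rfl, rfl⟩, hxy⟩
      exact hxy
    refine ⟨_, h.sep_mem (P := fun q => q = ZFSet.pair b c ∨
      ∃ x ∈ M, ∃ y ∈ M, q = ZFSet.pair x y ∧ Bisimilar M 𝒞 E x F y) inferInstance,
      (hmem hb hc).2 (Or.inl ⟨rfl, rfl⟩), fun x hx y hy hxy => ?_⟩
    rcases (hmem hx hy).1 hxy with ⟨rfl, rfl⟩ | ⟨B, hB, hxyB, hB'⟩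
    · constructor
      · intro x' hx' hr
        obtain ⟨y', hr', e⟩ := (mem_collapse wF).1 (heq ▸ collapse_mem wE hr)
        have hy' := (h.mem_of_pairRel hF hr').1
        exact ⟨y', hy', hr', (hmem hx' hy').2 (Or.inr ((ih x' hr hx' hy').2 e))⟩
      · intro y' hy' hr
        obtain ⟨x', hr', e⟩ := (mem_collapse wE).1 (heq.symm ▸ collapse_mem wF hr)
        have hx' := (h.mem_of_pairRel hE hr').1
        exact ⟨x', hx', hr', (hmem hx' hy').2 (Or.inr ((ih x' hr' hx' hy').2 e.symm))⟩
    · obtain ⟨h₁, h₂⟩ := hB' x hx y hy hxyB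
      constructor
      · intro x' hx' hr
        obtain ⟨y', hy', hr', hq⟩ := h₁ x' hx' hr
        exact ⟨y', hy', hr', (hmem hx' hy').2 (Or.inr ⟨B, hB, hq, hB'⟩)⟩
      · intro y' hy' hr
        obtain ⟨x', hx', hr', hq⟩ := h₂ y' hy' hr
        exact ⟨x', hx', hr', (hmem hx' hy').2 (Or.inr ⟨B, hB, hq, hB'⟩)⟩

/-- The set of the collapses of the members of a class is coded. -/
theorem mem_collapseValues_of_class {E S x : ZFSet.{u}} (hE : E ∈ 𝒞)
    (wE : WellFounded (pairRel E)) (hS : S ∈ 𝒞)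
    (hx : ∀ u, u ∈ x ↔ ∃ s ∈ S, u = collapse E s) : x ∈ collapseValues 𝒞 := by
  have := h.transClass
  have := h.fact_univ
  have := h.fact_empty
  have : Fact (E ∈ (𝒞 : Set ZFSet.{u})) := ⟨hE⟩
  have : Fact (S ∈ (𝒞 : Set ZFSet.{u})) := ⟨hS⟩
  -- Each node `y` is renamed `(y, y)`, which is never `∅`, so that `∅` is free to become a new top
  -- node with the members of `S` as predecessors.
  let P : ZFSet.{u} → Prop := fun q => (∃ y ∈ M, ∃ z ∈ M, pairRel E y z ∧
    ∃ y' ∈ M, ∃ z' ∈ M, y' = ZFSet.pair y y ∧ z' = ZFSet.pair z z ∧ q = ZFSet.pair y' z') ∨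
    ∃ s ∈ S, ∃ s' ∈ M, s' = ZFSet.pair s s ∧ q = ZFSet.pair s' ∅
  have hE' : M.sep P ∈ 𝒞 := h.sep_mem inferInstance
  have rel : ∀ {p q}, pairRel (M.sep P) p q ↔ (∃ y z, pairRel E y z ∧ p = ZFSet.pair y y ∧
      q = ZFSet.pair z z) ∨ ∃ s ∈ S, p = ZFSet.pair s s ∧ q = ∅ := by
    intro p q
    simp only [pairRel, ZFSet.mem_sep, P, ZFSet.pair_inj]
    constructor
    · rintro ⟨_, ⟨y, _, z, _, hyz, _, _, _, _, rfl, rfl, rfl, rfl⟩ | ⟨s, hs, _, _, rfl, rfl, rfl⟩⟩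
      · exact Or.inl ⟨y, z, hyz, rfl, rfl⟩
      · exact Or.inr ⟨s, hs, rfl, rfl⟩
    · rintro (⟨y, z, hyz, rfl, rfl⟩ | ⟨s, hs, rfl, rfl⟩)
      · obtain ⟨hy, hz⟩ := h.mem_of_pairRel hE hyz
        have hy' := h.pair_mem hy hy
        have hz' := h.pair_mem hz hz
        exact ⟨h.pair_mem hy' hz', Or.inl ⟨y, hy, z, hz, hyz, _, hy', _, hz', rfl, rfl, rfl, rfl⟩⟩
      · have hsM := h.class_subset _ hS hs
        have hs' := h.pair_mem hsM hsM
        exact ⟨h.pair_mem hs' h.empty_mem, Or.inr ⟨s, hs, _, hs', rfl, rfl, rfl⟩⟩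
  have relE : ∀ {p z}, pairRel (M.sep P) p (ZFSet.pair z z) ↔
      ∃ y, pairRel E y z ∧ p = ZFSet.pair y y := by
    intro p z
    rw [rel]
    constructor
    · rintro (⟨y, z', hyz, rfl, e⟩ | ⟨s, hs, rfl, e⟩)
      · obtain ⟨rfl, -⟩ := ZFSet.pair_inj.1 e
        exact ⟨y, hyz, rfl⟩
      · exact (pair_self_ne_empty z e).elim
    · rintro ⟨y, hyz, rfl⟩
      exact Or.inl ⟨y, z, hyz, rfl, rfl⟩
  have acc : ∀ z, Acc (pairRel (M.sep P)) (ZFSet.pair z z) := by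
    intro z
    induction z using wE.induction with
    | h z ih =>
      refine ⟨_, fun p hp => ?_⟩
      obtain ⟨y, hy, rfl⟩ := relE.1 hp
      exact ih y hy
  have wE' : WellFounded (pairRel (M.sep P)) := by
    refine ⟨fun q => ⟨_, fun p hp => ?_⟩⟩
    rcases rel.1 hp with ⟨y, z, _, rfl, _⟩ | ⟨s, _, rfl, _⟩ <;> exact acc _
  have hcol := collapse_eq_of_map wE wE' (fun z => ZFSet.pair z z)
    (fun y z hyz => relE.2 ⟨y, hyz, rfl⟩) (fun w z hw => relE.1 hw)
  refine ⟨_, hE', wE', ?_⟩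
  ext u
  rw [hx, mem_collapse wE']
  constructor
  · rintro ⟨s, hs, rfl⟩
    exact ⟨_, rel.2 (Or.inr ⟨s, hs, rfl, rfl⟩), (hcol s).symm⟩
  · rintro ⟨p, hp, rfl⟩
    rcases rel.1 hp with ⟨y, z, _, rfl, e⟩ | ⟨s, hs, rfl, _⟩
    · exact (pair_self_ne_empty z e.symm).elim
    · exact ⟨s, hs, hcol s⟩

theorem collapse_mem_collapseValues {E z : ZFSet.{u}} (hE : E ∈ 𝒞)
    (wE : WellFounded (pairRel E)) (hz : z ∈ M) : collapse E z ∈ collapseValues 𝒞 := by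
  have := h.transClass
  have : Fact (E ∈ (𝒞 : Set ZFSet.{u})) := ⟨hE⟩
  have : Fact (z ∈ (𝒞 : Set ZFSet.{u})) := ⟨h.set_mem hz⟩
  refine h.mem_collapseValues_of_class hE wE
    (h.sep_mem (P := fun y => pairRel E y z) inferInstance) fun u => ?_
  rw [mem_collapse wE]
  refine exists_congr fun y => and_congr_left fun _ => ?_
  rw [ZFSet.mem_sep]
  exact ⟨fun hy => ⟨(h.mem_of_pairRel hE hy).1, hy⟩, fun hy => hy.2⟩

theorem transClass_collapseValues : TransClass (collapseValues 𝒞) where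
  mem_of_mem := by
    rintro _ y ⟨E, hE, wE, rfl⟩ hy
    obtain ⟨z, hz, rfl⟩ := (mem_collapse wE).1 hy
    exact h.collapse_mem_collapseValues hE wE (h.mem_of_pairRel hE hz).1

/-- Membership restricted to `M` is a well-founded class relation which collapses to the identity on
`M`, and `C` is the set of collapses of its own elements. -/
theorem class_mem_collapseValues {C : ZFSet.{u}} (hC : C ∈ 𝒞) : C ∈ collapseValues 𝒞 := by
  have := h.transClass
  have := h.fact_univ
  let P : ZFSet.{u} → Prop := fun q => ∃ y ∈ M, ∃ z ∈ M, y ∈ z ∧ q = ZFSet.pair y z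
  have hE : M.sep P ∈ 𝒞 := h.sep_mem inferInstance
  have rel : ∀ {y z}, pairRel (M.sep P) y z ↔ y ∈ z ∧ z ∈ M := by
    intro y z
    simp only [pairRel, ZFSet.mem_sep, P, ZFSet.pair_inj]
    constructor
    · rintro ⟨_, y, _, z, hz, hyz, rfl, rfl⟩
      exact ⟨hyz, hz⟩
    · rintro ⟨hyz, hz⟩
      have hy := h.mem_of_mem hz hyz
      exact ⟨h.pair_mem hy hz, y, hy, z, hz, hyz, rfl, rfl⟩
  have wE : WellFounded (pairRel (M.sep P)) :=
    Subrelation.wf (fun hyz => (rel.1 hyz).1) ZFSet.mem_wf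
  have hcol : ∀ z ∈ M, collapse (M.sep P) z = z := by
    intro z
    induction z using ZFSet.inductionOn with
    | h z ih =>
      intro hz
      ext u
      rw [mem_collapse wE]
      constructor
      · rintro ⟨y, hy, rfl⟩
        have hy := (rel.1 hy).1
        rwa [ih y hy (h.mem_of_mem hz hy)]
      · intro hu
        exact ⟨u, rel.2 ⟨hu, hz⟩, (ih u hu (h.mem_of_mem hz hu)).symm⟩
  refine h.mem_collapseValues_of_class hE wE hC fun u => ⟨fun hu => ⟨u, hu, ?_⟩, ?_⟩
  · rw [hcol u (h.class_subset _ hC hu)]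
  · rintro ⟨s, hs, rfl⟩
    rwa [hcol s (h.class_subset _ hC hs)]

end IsMKModel

/-! ### Separation and collection for the coded sets -/

namespace IsBetaModelMKStar

variable {M 𝒞 : ZFSet.{u}} (h : IsBetaModelMKStar M 𝒞)
include h

/-- This is where the `β`-property enters: real well-foundedness is expressed by a quantifier over
the classes of the model only. -/
theorem foRel_wellFounded {n : ℕ} {f : (Fin n → ZFSet.{u}) → ZFSet.{u}}
    [hf : FOFun (𝒞 : Set ZFSet.{u}) f] :
    FORel (𝒞 : Set ZFSet.{u}) (fun v => WellFounded (pairRel (f v))) := by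
  have := h.transClass
  have := h.fact_empty
  refine FORel.congr (Q := fun v => ∀ X ∈ (𝒞 : Set ZFSet.{u}), ¬ X = ∅ →
    ∃ x ∈ X, ∀ y ∈ X, ¬ pairRel (f v) y x) inferInstance fun v hv => ?_
  exact (h.beta _ (hf.maps v hv)).symm

/-- The sets coded by the sections of a class form a coded set. -/
theorem exists_values_of_sections {B : ZFSet.{u}} (hB : B ∈ 𝒞) :
    ∃ w ∈ collapseValues 𝒞, ∀ u, u ∈ w ↔ ∃ i ∈ M,
      WellFounded (pairRel (classSection M B i)) ∧ u = collapse (classSection M B i) ∅ := by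
  have := h.transClass
  have := h.fact_univ
  have := h.fact_empty
  have : Fact (B ∈ (𝒞 : Set ZFSet.{u})) := ⟨hB⟩
  have := @h.foRel_wellFounded
  -- Well-foundedness of a section is restated through a class with the same elements, so that it
  -- becomes a definable condition on the index `i`.
  have hWF : ∀ i ∈ M, (WellFounded (pairRel (classSection M B i)) ↔
      ∃ A ∈ (𝒞 : Set ZFSet.{u}), (∀ z ∈ M, z ∈ A ↔ ZFSet.pair i z ∈ B) ∧
        WellFounded (pairRel A)) := by
    intro i hi
    have hsec := h.classSection_mem hB hi
    constructor
    · intro hw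
      exact ⟨_, hsec, fun z hz => by simp [classSection, hz], hw⟩
    · rintro ⟨A, hA, hAB, hw⟩
      rwa [h.class_ext _ hsec A hA fun z hz => by simp [classSection, hz, hAB z hz]]
  -- The disjoint sum of the well-founded sections, the node `y` of section `i` being `(i, y)`.
  -- Sections that are not well-founded are left out.
  let P : ZFSet.{u} → Prop := fun q => ∃ i ∈ M, (∃ A ∈ (𝒞 : Set ZFSet.{u}),
    (∀ z ∈ M, z ∈ A ↔ ZFSet.pair i z ∈ B) ∧ WellFounded (pairRel A)) ∧
    ∃ y ∈ M, ∃ z ∈ M, ∃ p ∈ M, p = ZFSet.pair y z ∧ ZFSet.pair i p ∈ B ∧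
    ∃ y' ∈ M, ∃ z' ∈ M, y' = ZFSet.pair i y ∧ z' = ZFSet.pair i z ∧ q = ZFSet.pair y' z'
  have hE : M.sep P ∈ 𝒞 := h.sep_mem inferInstance
  have rel : ∀ {p q}, pairRel (M.sep P) p q ↔ ∃ i ∈ M,
      WellFounded (pairRel (classSection M B i)) ∧ ∃ y z, pairRel (classSection M B i) y z ∧
      p = ZFSet.pair i y ∧ q = ZFSet.pair i z := by
    intro p q
    simp only [pairRel, ZFSet.mem_sep, P, ZFSet.pair_inj]
    constructor
    · rintro ⟨_, i, hi, hw, y, _, z, _, _, hp, rfl, hyz, _, _, _, _, rfl, rfl, rfl, rfl⟩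
      exact ⟨i, hi, (hWF i hi).2 hw, y, z, by simp [classSection, hp, hyz], rfl, rfl⟩
    · rintro ⟨i, hi, hw, y, z, hyz, rfl, rfl⟩
      obtain ⟨hp, hyz⟩ := ZFSet.mem_sep.1 hyz
      obtain ⟨hy, hz⟩ := h.mem_of_pair_mem hp
      have hy' := h.pair_mem hi hy
      have hz' := h.pair_mem hi hz
      exact ⟨h.pair_mem hy' hz', i, hi, (hWF i hi).1 hw, y, hy, z, hz, _, hp, rfl, hyz,
        _, hy', _, hz', rfl, rfl, rfl, rfl⟩
  have acc : ∀ i, WellFounded (pairRel (classSection M B i)) → ∀ z,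
      Acc (pairRel (M.sep P)) (ZFSet.pair i z) := by
    intro i hw z
    induction z using hw.induction with
    | h z ih =>
      refine ⟨_, fun p hp => ?_⟩
      obtain ⟨j, hj, _, y, z', hyz, rfl, e⟩ := rel.1 hp
      obtain ⟨rfl, rfl⟩ := ZFSet.pair_inj.1 e
      exact ih y hyz
  have wE : WellFounded (pairRel (M.sep P)) := by
    refine ⟨fun q => ⟨_, fun p hp => ?_⟩⟩
    obtain ⟨j, hj, hw, y, z', hyz, rfl, e⟩ := rel.1 hp
    exact acc j hw y
  have hcol : ∀ i ∈ M, WellFounded (pairRel (classSection M B i)) → ∀ z,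
      collapse (M.sep P) (ZFSet.pair i z) = collapse (classSection M B i) z := by
    intro i hi hw
    refine collapse_eq_of_map hw wE (fun z => ZFSet.pair i z)
      (fun y z hyz => rel.2 ⟨i, hi, hw, y, z, hyz, rfl, rfl⟩) (fun w z hwz => ?_)
    obtain ⟨j, hj, _, y, z', hyz, rfl, e⟩ := rel.1 hwz
    obtain ⟨rfl, rfl⟩ := ZFSet.pair_inj.1 e
    exact ⟨y, hyz, rfl⟩
  have hS : M.sep (fun q => ∃ i ∈ M, (∃ A ∈ (𝒞 : Set ZFSet.{u}),
      (∀ z ∈ M, z ∈ A ↔ ZFSet.pair i z ∈ B) ∧ WellFounded (pairRel A)) ∧ q = ZFSet.pair i ∅) ∈ 𝒞 :=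
    h.sep_mem inferInstance
  let w : ZFSet.{u} := ZFSet.range fun s : M.sep (fun q => ∃ i ∈ M, (∃ A ∈ (𝒞 : Set ZFSet.{u}),
      (∀ z ∈ M, z ∈ A ↔ ZFSet.pair i z ∈ B) ∧ WellFounded (pairRel A)) ∧
      q = ZFSet.pair i ∅) => collapse (M.sep P) s.1
  have hw : ∀ u, u ∈ w ↔ ∃ s ∈ M.sep (fun q => ∃ i ∈ M, (∃ A ∈ (𝒞 : Set ZFSet.{u}),
      (∀ z ∈ M, z ∈ A ↔ ZFSet.pair i z ∈ B) ∧ WellFounded (pairRel A)) ∧ q = ZFSet.pair i ∅),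
      u = collapse (M.sep P) s := by
    intro u
    simp only [w, ZFSet.mem_range]
    constructor
    · rintro ⟨⟨s, hs⟩, rfl⟩; exact ⟨s, hs, rfl⟩
    · rintro ⟨s, hs, rfl⟩; exact ⟨⟨s, hs⟩, rfl⟩
  refine ⟨w, h.mem_collapseValues_of_class hE wE hS hw, fun u => (hw u).trans ?_⟩
  constructor
  · rintro ⟨s, hs, rfl⟩
    obtain ⟨_, i, hi, hwf, rfl⟩ := ZFSet.mem_sep.1 hs
    have hwf := (hWF i hi).2 hwf
    exact ⟨i, hi, hwf, hcol i hi hwf ∅⟩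
  · rintro ⟨i, hi, hwf, rfl⟩
    exact ⟨_, ZFSet.mem_sep.2 ⟨h.pair_mem hi h.empty_mem, i, hi, (hWF i hi).1 hwf, rfl⟩,
      (hcol i hi hwf ∅).symm⟩

/-- First-order definability over the collection of coded sets translates to definability over
the classes. -/
theorem exists_translation_pure {n : ℕ} {P : (Fin n → ZFSet.{u}) → Prop}
    (hP : FOPure (collapseValues 𝒞) P) : ∃ Q : (Fin n → ZFSet.{u}) → Prop,
      FORel (𝒞 : Set ZFSet.{u}) Q ∧ ∀ X, (∀ i, X i ∈ 𝒞) → (∀ i, WellFounded (pairRel (X i))) →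
        (P (fun i => collapse (X i) ∅) ↔ Q X) := by
  have := h.transClass
  have := h.fact_univ
  have := h.fact_empty
  have := @h.foRel_wellFounded
  induction hP with
  | mem i j =>
    -- A collapse belongs to the collapse of `X j` at `∅` iff it is the collapse at some predecessor
    -- of `∅`.
    refine ⟨fun X => ∃ c ∈ M, pairRel (X j) c ∅ ∧ Bisimilar M 𝒞 (X i) ∅ (X j) c, inferInstance,
      fun X hX wX => ?_⟩
    dsimp only
    rw [mem_collapse (wX j)]
    constructor
    · rintro ⟨c, hc, e⟩
      have hcM := (h.mem_of_pairRel (hX j) hc).1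
      exact ⟨c, hcM, hc, (h.bisimilar_iff (hX i) (hX j) (wX i) (wX j) h.empty_mem hcM).2 e⟩
    · rintro ⟨c, hcM, hc, hb⟩
      exact ⟨c, hc, (h.bisimilar_iff (hX i) (hX j) (wX i) (wX j) h.empty_mem hcM).1 hb⟩
  | eq i j =>
    exact ⟨fun X => Bisimilar M 𝒞 (X i) ∅ (X j) ∅, inferInstance, fun X hX wX =>
      (h.bisimilar_iff (hX i) (hX j) (wX i) (wX j) h.empty_mem h.empty_mem).symm⟩
  | not _ ih =>
    obtain ⟨Q, hQ, hPQ⟩ := ih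
    exact ⟨_, hQ.not, fun X hX wX => not_congr (hPQ X hX wX)⟩
  | and _ _ ih ih' =>
    obtain ⟨Q, hQ, hPQ⟩ := ih
    obtain ⟨Q', hQ', hPQ'⟩ := ih'
    exact ⟨_, hQ.and hQ', fun X hX wX => and_congr (hPQ X hX wX) (hPQ' X hX wX)⟩
  | @all n P _ ih =>
    obtain ⟨Q, hQ, hPQ⟩ := ih
    -- A quantifier over coded sets becomes one over their codes, that is, over classes that are
    -- well-founded.
    have hall : FORel (𝒞 : Set ZFSet.{u}) (fun X : Fin (n + 1) → ZFSet.{u} =>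
      WellFounded (pairRel (X (Fin.last n))) → Q X) := inferInstance
    refine ⟨_, hall.all_snoc, fun X hX wX => ?_⟩
    have key : ∀ E ∈ 𝒞, WellFounded (pairRel E) →
        (P (Fin.snoc (α := fun _ => ZFSet.{u}) (fun i => collapse (X i) ∅) (collapse E ∅)) ↔
          Q (Fin.snoc (α := fun _ => ZFSet.{u}) X E)) := by
      intro E hE wE
      rw [← hPQ]
      · refine iff_of_eq (congrArg _ (funext fun i => ?_))
        refine Fin.lastCases ?_ (fun i => ?_) i <;> simp
      · intro i
        refine Fin.lastCases ?_ (fun i => ?_) i <;> simp [hE, hX]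
      · intro i
        refine Fin.lastCases ?_ (fun i => ?_) i <;> simp [wE, wX]
    simp only [Fin.snoc_last]
    constructor
    · intro H E hE wE
      exact (key E hE wE).1 (H _ ⟨E, hE, wE, rfl⟩)
    · rintro H _ ⟨E, hE, wE, rfl⟩
      exact (key E hE wE).2 (H E hE wE)

theorem exists_translation {n : ℕ} {P : (Fin n → ZFSet.{u}) → Prop}
    (hP : FORel (collapseValues 𝒞) P) : ∃ Q : (Fin n → ZFSet.{u}) → Prop,
      FORel (𝒞 : Set ZFSet.{u}) Q ∧ ∀ X, (∀ i, X i ∈ 𝒞) → (∀ i, WellFounded (pairRel (X i))) →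
        (P (fun i => collapse (X i) ∅) ↔ Q X) := by
  obtain ⟨m, p, R, hp, hR, hPR⟩ := hP
  choose E hE wE hpE using hp
  obtain ⟨Q, hQ, hRQ⟩ := h.exists_translation_pure hR
  refine ⟨_, hQ.inst E hE, fun X hX wX => ?_⟩
  rw [hPR _ fun i => ⟨X i, hX i, wX i, rfl⟩, ← hRQ]
  · refine iff_of_eq (congrArg _ (funext fun i => ?_))
    refine Fin.addCases (fun i => ?_) (fun i => ?_) i <;> simp [hpE]
  · intro i
    refine Fin.addCases (fun i => ?_) (fun i => ?_) i <;> simp [hE, hX]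
  · intro i
    refine Fin.addCases (fun i => ?_) (fun i => ?_) i <;> simp [wE, wX]

/-- Each axiom is verified on codes: it suffices to exhibit a class of nodes, or a class of
sections, whose collapses are the required elements. -/
theorem separationCollectionClass : SeparationCollectionClass (collapseValues 𝒞) where
  __ := h.transClass_collapseValues
  empty_mem := h.class_mem_collapseValues (h.set_mem h.empty_mem)
  unordered_mem := by
    rintro _ _ ⟨E, hE, wE, rfl⟩ ⟨F, hF, wF, rfl⟩
    have := h.transClass
    have := h.fact_univ
    have := h.fact_empty
    have : Fact (E ∈ (𝒞 : Set ZFSet.{u})) := ⟨hE⟩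
    have : Fact (F ∈ (𝒞 : Set ZFSet.{u})) := ⟨hF⟩
    -- One class whose section at `∅` is `E` and whose section at every other index is `F`; its
    -- coded sections are just the two given sets.
    let P : ZFSet.{u} → Prop := fun q => ∃ i ∈ M, ∃ z ∈ M, q = ZFSet.pair i z ∧
      (i = ∅ ∧ z ∈ E ∨ ¬ i = ∅ ∧ z ∈ F)
    have hB : M.sep P ∈ 𝒞 := h.sep_mem inferInstance
    have hmem : ∀ {i z}, i ∈ M → z ∈ M →
        (ZFSet.pair i z ∈ M.sep P ↔ (i = ∅ ∧ z ∈ E ∨ ¬ i = ∅ ∧ z ∈ F)) := by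
      intro i z hi hz
      simp only [ZFSet.mem_sep, h.pair_mem hi hz, true_and, P, ZFSet.pair_inj]
      constructor
      · rintro ⟨i, _, z, _, ⟨rfl, rfl⟩, hq⟩; exact hq
      · intro hq; exact ⟨i, hi, z, hz, ⟨rfl, rfl⟩, hq⟩
    have sec₀ : classSection M (M.sep P) ∅ = E := by
      refine h.class_ext _ (h.classSection_mem hB h.empty_mem) _ hE fun z hz => ?_
      simp [classSection, hz, -ZFSet.mem_sep, hmem h.empty_mem hz, ZFSet.mem_sep (x := M) (y := z)]
    have sec₁ : ∀ i ∈ M, i ≠ ∅ → classSection M (M.sep P) i = F := by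
      intro i hi hi0
      refine h.class_ext _ (h.classSection_mem hB hi) _ hF fun z hz => ?_
      simp [classSection, hz, hi0, -ZFSet.mem_sep, hmem hi hz, ZFSet.mem_sep (x := M) (y := z)]
    obtain ⟨w, hw, hmemw⟩ := h.exists_values_of_sections hB
    convert hw using 1
    ext u
    rw [hmemw, ZFSet.mem_pair]
    constructor
    · rintro (rfl | rfl)
      · exact ⟨∅, h.empty_mem, by rwa [sec₀], by rw [sec₀]⟩
      · have hi := h.pair_mem h.empty_mem h.empty_mem
        have e := sec₁ _ hi (pair_self_ne_empty ∅)
        exact ⟨_, hi, by rwa [e], by rw [e]⟩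
    · rintro ⟨i, hi, _, rfl⟩
      rcases eq_or_ne i ∅ with rfl | hi0
      · exact Or.inl (by rw [sec₀])
      · exact Or.inr (by rw [sec₁ i hi hi0])
  sUnion_mem := by
    rintro _ ⟨E, hE, wE, rfl⟩
    have := h.transClass
    have := h.fact_univ
    have := h.fact_empty
    have : Fact (E ∈ (𝒞 : Set ZFSet.{u})) := ⟨hE⟩
    refine h.mem_collapseValues_of_class hE wE (h.sep_mem
      (P := fun s => ∃ t ∈ M, pairRel E s t ∧ pairRel E t ∅) inferInstance) fun u => ?_
    simp only [ZFSet.mem_sUnion, mem_collapse wE, ZFSet.mem_sep]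
    constructor
    · rintro ⟨_, ⟨t, ht, rfl⟩, hu⟩
      obtain ⟨s, hs, rfl⟩ := (mem_collapse wE).1 hu
      obtain ⟨hsM, htM⟩ := h.mem_of_pairRel hE hs
      exact ⟨s, ⟨hsM, t, htM, hs, ht⟩, rfl⟩
    · rintro ⟨s, ⟨hsM, t, htM, hs, ht⟩, rfl⟩
      exact ⟨_, ⟨t, ht, rfl⟩, collapse_mem wE hs⟩
  sep_mem := by
    rintro P hP _ ⟨E, hE, wE, rfl⟩
    have := h.transClass
    have := h.fact_univ
    have := h.fact_empty
    have := @h.foRel_wellFounded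
    have : Fact (E ∈ (𝒞 : Set ZFSet.{u})) := ⟨hE⟩
    obtain ⟨Q, hQ, hPQ⟩ := h.exists_translation hP
    -- The translation `Q` speaks of codes read at `∅`, whereas an element of the given set is the
    -- collapse of `E` at a node `s`. Some class `F` recodes this element at `∅`, and bisimilarity
    -- says so definably.
    refine h.mem_collapseValues_of_class hE wE (h.sep_mem (P := fun s => pairRel E s ∅ ∧
      ∃ F ∈ (𝒞 : Set ZFSet.{u}), WellFounded (pairRel F) ∧ Bisimilar M 𝒞 E s F ∅ ∧ Q (fun _ => F))
      inferInstance) fun u => ?_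
    simp only [mem_collapse wE, ZFSet.mem_sep]
    constructor
    · rintro ⟨⟨s, hs, rfl⟩, hP⟩
      have hsM := (h.mem_of_pairRel hE hs).1
      obtain ⟨F, hF, wF, e⟩ := h.collapse_mem_collapseValues hE wE hsM
      refine ⟨s, ⟨hsM, hs, F, hF, wF, (h.bisimilar_iff hE hF wE wF hsM h.empty_mem).2 e, ?_⟩, rfl⟩
      rw [e] at hP
      exact (hPQ _ (fun _ => hF) (fun _ => wF)).1 hP
    · rintro ⟨s, ⟨hsM, hs, F, hF, wF, hb, hQF⟩, rfl⟩
      refine ⟨⟨s, hs, rfl⟩, ?_⟩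
      rw [(h.bisimilar_iff hE hF wE wF hsM h.empty_mem).1 hb]
      exact (hPQ _ (fun _ => hF) (fun _ => wF)).2 hQF
  collection := by
    rintro P hP _ ⟨E, hE, wE, rfl⟩ hex
    have := h.transClass
    have := h.fact_univ
    have := h.fact_empty
    have := @h.foRel_wellFounded
    have : Fact (E ∈ (𝒞 : Set ZFSet.{u})) := ⟨hE⟩
    obtain ⟨Q, hQ, hPQ⟩ := h.exists_translation hP
    have hQ' : FORel (𝒞 : Set ZFSet.{u}) (fun w : Fin 3 → ZFSet.{u} => Q ![w 2, w 1]) := by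
      refine (hQ.rename ![2, 1]).congr fun w _ => iff_of_eq (congrArg _ (funext fun i => ?_))
      fin_cases i <;> rfl
    have hPQ' : ∀ F ∈ 𝒞, ∀ A ∈ 𝒞, WellFounded (pairRel F) → WellFounded (pairRel A) →
        (P (collapse F ∅) (collapse A ∅) ↔ Q ![F, A]) := by
      intro F hF A hA wF wA
      exact hPQ ![F, A] (by simp [Fin.forall_fin_two, hF, hA])
        (by simp [Fin.forall_fin_two, wF, wA])
    have hR : FORel (𝒞 : Set ZFSet.{u}) (fun w : Fin 2 → ZFSet.{u} => pairRel E (w 0) ∅ →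
        ∃ F ∈ (𝒞 : Set ZFSet.{u}), WellFounded (pairRel F) ∧ WellFounded (pairRel (w 1)) ∧
          Bisimilar M 𝒞 E (w 0) F ∅ ∧ Q ![F, w 1]) := by
      have : FORel (𝒞 : Set ZFSet.{u}) (fun w : Fin 2 → ZFSet.{u} => ∃ F ∈ (𝒞 : Set ZFSet.{u}),
          WellFounded (pairRel F) ∧ WellFounded (pairRel (w 1)) ∧
          Bisimilar M 𝒞 E (w 0) F ∅ ∧ Q ![F, w 1]) :=
        @FORel.instEx _ _ _ (@FORel.instAnd _ _ _ _ inferInstance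
          (@FORel.instAnd _ _ _ _ inferInstance (@FORel.instAnd _ _ _ _ inferInstance hQ')))
      infer_instance
    -- Class-Bounding ranges over all sets `s`, so the condition is made vacuous off the
    -- predecessors of `∅`. Well-foundedness of `A` is part of it, which guarantees that the section
    -- found is among those whose values are collected. Superfluous sections do no harm.
    obtain ⟨B, hB, hbound⟩ := h.exists_bound (P := fun s A => pairRel E s ∅ →
      ∃ F ∈ (𝒞 : Set ZFSet.{u}), WellFounded (pairRel F) ∧ WellFounded (pairRel A) ∧
        Bisimilar M 𝒞 E s F ∅ ∧ Q ![F, A]) hR (fun s hsM => by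
      by_cases hs : pairRel E s ∅
      · obtain ⟨F, hF, wF, e⟩ := h.collapse_mem_collapseValues hE wE hsM
        obtain ⟨_, ⟨A, hA, wA, rfl⟩, hPA⟩ := hex _ (collapse_mem wE hs)
        refine ⟨A, hA, fun _ => ⟨F, hF, wF, wA,
          (h.bisimilar_iff hE hF wE wF hsM h.empty_mem).2 e, ?_⟩⟩
        rw [e] at hPA
        exact (hPQ' F hF A hA wF wA).1 hPA
      · exact ⟨E, hE, fun hs' => (hs hs').elim⟩)
    obtain ⟨w, hw, hmemw⟩ := h.exists_values_of_sections hB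
    refine ⟨w, hw, fun y hy => ?_⟩
    obtain ⟨s, hs, rfl⟩ := (mem_collapse wE).1 hy
    have hsM := (h.mem_of_pairRel hE hs).1
    obtain ⟨i, hi, hi'⟩ := hbound s hsM
    obtain ⟨F, hF, wF, wA, hb, hQF⟩ := hi' hs
    refine ⟨_, (hmemw _).2 ⟨i, hi, wA, rfl⟩, ?_⟩
    rw [(h.bisimilar_iff hE hF wE wF hsM h.empty_mem).1 hb]
    exact (hPQ' F hF _ (h.classSection_mem hB hi) wF wA).2 hQF

end IsBetaModelMKStar

/-! ## The definable power set -/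

section DefPowerset

open FirstOrder FirstOrder.Language

variable {X : ZFSet.{u}}

theorem FOPure.exists_boundedFormula {n : ℕ} {P : (Fin n → ZFSet.{u}) → Prop}
    (h : FOPure (X : Set ZFSet.{u}) P) : ∃ φ : setLanguage.BoundedFormula Empty n,
      ∀ (e : Empty → X) (v : Fin n → X), φ.Realize e v ↔ P (fun i => (v i : ZFSet.{u})) := by
  induction h with
  | mem i j =>
    refine ⟨.rel SetRelSymbol.mem ![.var (.inr i), .var (.inr j)], fun e v => ?_⟩
    simp only [BoundedFormula.Realize]
    rfl
  | eq i j =>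
    refine ⟨.equal (.var (.inr i)) (.var (.inr j)), fun e v => ?_⟩
    simp [BoundedFormula.Realize, SetLike.coe_eq_coe]
  | not _ ih =>
    obtain ⟨φ, hφ⟩ := ih
    exact ⟨φ.not, fun e v => by rw [BoundedFormula.realize_not, hφ]⟩
  | and _ _ ih ih' =>
    obtain ⟨φ, hφ⟩ := ih
    obtain ⟨ψ, hψ⟩ := ih'
    exact ⟨φ ⊓ ψ, fun e v => by rw [BoundedFormula.realize_inf, hφ, hψ]⟩
  | @all n P _ ih =>
    obtain ⟨φ, hφ⟩ := ih
    refine ⟨φ.all, fun e v => ?_⟩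
    rw [BoundedFormula.realize_all]
    have key : ∀ a : X, φ.Realize e (Fin.snoc v a) ↔
        P (Fin.snoc (α := fun _ => ZFSet.{u}) (fun i => (v i : ZFSet.{u})) a) := by
      intro a
      rw [hφ]
      refine iff_of_eq (congrArg _ (funext fun i => ?_))
      refine Fin.lastCases ?_ (fun i => ?_) i <;> simp
    exact ⟨fun h a ha => (key ⟨a, ha⟩).1 (h ⟨a, ha⟩), fun h a => (key a).2 (h a a.2)⟩

theorem exists_foFun_of_term {n : ℕ}
    (t : setLanguage.Term (((Set.univ : Set X) ⊕ Fin 1) ⊕ Fin n)) :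
    ∃ f : (Fin (1 + n) → ZFSet.{u}) → ZFSet.{u}, FOFun (X : Set ZFSet.{u}) f ∧
      ∀ w : Fin (1 + n) → X, f (fun i => (w i : ZFSet.{u})) =
        (t.realize (Sum.elim (Sum.elim (fun c => c.1) (fun i => w (Fin.castAdd n i)))
          (fun i => w (Fin.natAdd 1 i))) : X) := by
  match t with
  | .var (.inl (.inl c)) => exact ⟨_, .const c.1.2, fun w => rfl⟩
  | .var (.inl (.inr i)) => exact ⟨_, .instVar (Fin.castAdd n i), fun w => rfl⟩
  | .var (.inr i) => exact ⟨_, .instVar (Fin.natAdd 1 i), fun w => rfl⟩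
  | .func f _ => exact f.elim

theorem exists_foRel_of_boundedFormula {n : ℕ}
    (φ : setLanguage.BoundedFormula ((Set.univ : Set X) ⊕ Fin 1) n) :
    ∃ P : (Fin (1 + n) → ZFSet.{u}) → Prop, FORel (X : Set ZFSet.{u}) P ∧
      ∀ w : Fin (1 + n) → X, P (fun i => (w i : ZFSet.{u})) ↔
        φ.Realize (Sum.elim (fun c => c.1) (fun i => w (Fin.castAdd n i)))
          (fun i => w (Fin.natAdd 1 i)) := by
  induction φ with
  | @falsum n =>
    -- The arity is `1 + n`, so there is always a variable available for expressing falsity.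
    refine ⟨fun w => ¬ w (Fin.castAdd n 0) = w (Fin.castAdd n 0), inferInstance, fun w => ?_⟩
    simp [BoundedFormula.Realize]
  | equal t₁ t₂ =>
    obtain ⟨f, hf, hft⟩ := exists_foFun_of_term t₁
    obtain ⟨g, hg, hgt⟩ := exists_foFun_of_term t₂
    exact ⟨fun w => f w = g w, inferInstance, fun w =>
      (iff_of_eq (congrArg₂ (· = ·) (hft w) (hgt w))).trans SetLike.coe_eq_coe⟩
  | rel R ts =>
    cases R with
    | mem =>
      obtain ⟨f, hf, hft⟩ := exists_foFun_of_term (ts 0)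
      obtain ⟨g, hg, hgt⟩ := exists_foFun_of_term (ts 1)
      exact ⟨fun w => f w ∈ g w, inferInstance, fun w =>
        iff_of_eq (congrArg₂ (· ∈ ·) (hft w) (hgt w))⟩
  | imp _ _ ih ih' =>
    obtain ⟨P, hP, hP'⟩ := ih
    obtain ⟨Q, hQ, hQ'⟩ := ih'
    exact ⟨fun w => P w → Q w, inferInstance, fun w => imp_congr (hP' w) (hQ' w)⟩
  | @all n φ ih =>
    obtain ⟨P, hP, hP'⟩ := ih
    refine ⟨_, FORel.all_snoc (n := 1 + n) hP, fun w => ?_⟩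
    rw [BoundedFormula.realize_all]
    have key : ∀ a : X, P (Fin.snoc (α := fun _ => ZFSet.{u}) (fun i => (w i : ZFSet.{u})) a) ↔
        φ.Realize (Sum.elim (fun c => c.1) (fun i => w (Fin.castAdd n i)))
          (Fin.snoc (fun i => w (Fin.natAdd 1 i)) a) := by
      intro a
      have e : (Fin.snoc (α := fun _ => ZFSet.{u}) (fun i => (w i : ZFSet.{u})) a) =
          fun i => ((Fin.snoc (α := fun _ => X) w a i : X) : ZFSet.{u}) := by
        funext i
        refine Fin.lastCases ?_ (fun i => ?_) i <;> simp
      refine (iff_of_eq (congrArg P e)).trans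
        ((hP' (Fin.snoc (α := fun _ => X) w a)).trans (iff_of_eq ?_))
      congr 1
      · funext i
        rcases i with c | i
        · rfl
        · exact Fin.snoc_castSucc (α := fun _ => X) a w (Fin.castAdd n i)
      · funext i
        refine Fin.lastCases ?_ (fun i => ?_) i
        · exact (Fin.snoc_last (α := fun _ => X) a w).trans (by simp)
        · exact (Fin.snoc_castSucc (α := fun _ => X) a w (Fin.natAdd 1 i)).trans (by simp)
    exact ⟨fun h a => (key a).1 (h a a.2), fun h a ha => (key ⟨a, ha⟩).2 (h ⟨a, ha⟩)⟩

/-- The passage between formulas and `FORel`: parameters are constants of the expanded language on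
one side and a list prefixed to the variables on the other, and there are no function symbols to
translate. -/
theorem mem_defPowerset {Y : ZFSet.{u}} : Y ∈ defPowerset X ↔
    Y ⊆ X ∧ FORel (X : Set ZFSet.{u}) (fun v : Fin 1 → ZFSet.{u} => v 0 ∈ Y) := by
  rw [defPowerset, ZFSet.mem_sep, ZFSet.mem_powerset]
  refine and_congr_right fun _ => ?_
  rw [Set.Definable₁, Set.definable_iff_exists_formula_sum]
  constructor
  · rintro ⟨φ, hφ⟩
    obtain ⟨P, hP, hP'⟩ := exists_foRel_of_boundedFormula (n := 0) φ
    refine hP.congr fun v hv => ?_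
    refine Iff.trans ?_ (hP' (fun i => ⟨v i, hv i⟩)).symm
    have := Set.ext_iff.1 hφ (fun i => ⟨v i, hv i⟩)
    refine this.trans (iff_of_eq ?_)
    rw [Set.mem_ofPred_eq, Formula.Realize]
    congr 1
    exact Subsingleton.elim _ _
  · rintro ⟨m, p, Q, hp, hQ, hPQ⟩
    obtain ⟨φ, hφ⟩ := hQ.exists_boundedFormula
    refine ⟨φ.toFormula.relabel (Sum.elim Empty.elim (Fin.append
      (fun i => Sum.inl ⟨⟨p i, hp i⟩, Set.mem_univ _⟩) (fun i => Sum.inr i))), ?_⟩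
    ext v
    change (v 0 : ZFSet.{u}) ∈ Y ↔ Formula.Realize _ _
    rw [Formula.realize_relabel, BoundedFormula.realize_toFormula, hφ]
    refine (hPQ (fun i => (v i : ZFSet.{u})) fun i => (v i).2).trans (iff_of_eq (congrArg _ ?_))
    funext i
    refine Fin.addCases (fun i => ?_) (fun i => ?_) i <;> simp

end DefPowerset

/-! ## The definable power set by iterating set operations -/

open scoped Ordinal in
/-- The set of the finite ordinals. -/
noncomputable def finOrdinals : ZFSet.{u} := (ω : Ordinal.{u}).toZFSet

theorem mem_finOrdinals {x : ZFSet.{u}} :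
    x ∈ finOrdinals ↔ ∃ n : ℕ, x = (n : Ordinal.{u}).toZFSet := by
  rw [finOrdinals, Ordinal.mem_toZFSet_iff]
  constructor
  · rintro ⟨a, ha, rfl⟩
    obtain ⟨n, rfl⟩ := Ordinal.lt_omega0.1 ha
    exact ⟨n, rfl⟩
  · rintro ⟨n, rfl⟩
    exact ⟨n, Ordinal.natCast_lt_omega0 n, rfl⟩

theorem natCast_add_one_toZFSet (n : ℕ) : ((n + 1 : ℕ) : Ordinal.{u}).toZFSet =
    insert (n : Ordinal.{u}).toZFSet (n : Ordinal.{u}).toZFSet := by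
  rw [Nat.cast_add, Nat.cast_one, Ordinal.toZFSet_add_one]

/-- Inside `U` the finite ordinals are cut out of an inductive set `x` as the elements lying in all
inductive sets of `U`. -/
theorem finOrdinals_mem {U : Set ZFSet.{u}} [hU : SeparationCollectionClass U] {x : ZFSet.{u}}
    (hx : x ∈ U) (h₀ : ∅ ∈ x) (hs : ∀ y ∈ x, insert y y ∈ x) : finOrdinals ∈ U := by
  have : Fact (x ∈ U) := ⟨hx⟩
  let P : ZFSet.{u} → Prop := fun n => ∀ y ∈ U, ∅ ∈ y → (∀ z ∈ y, insert z z ∈ y) → n ∈ y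
  have hw : x.sep P ∈ U := FOFun.mem inferInstance
  have : Fact (x.sep P ∈ U) := ⟨hw⟩
  have hw₀ : ∅ ∈ x.sep P := ZFSet.mem_sep.2 ⟨h₀, fun y _ h _ => h⟩
  have hws : ∀ z ∈ x.sep P, insert z z ∈ x.sep P := by
    intro z hz
    obtain ⟨hz, hzP⟩ := ZFSet.mem_sep.1 hz
    exact ZFSet.mem_sep.2 ⟨hs z hz, fun y hy h₀ hs => hs z (hzP y hy h₀ hs)⟩
  convert hw using 1
  ext n
  rw [mem_finOrdinals]
  constructor
  · rintro ⟨n, rfl⟩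
    induction n with
    | zero => simpa using hw₀
    | succ n ih =>
      rw [natCast_add_one_toZFSet]
      exact hws _ ih
  · induction n using ZFSet.inductionOn with
    | h n ih =>
      intro hn
      by_cases h0 : n = ∅
      · exact ⟨0, by simp [h0]⟩
      by_cases hsucc : ∃ m ∈ x.sep P, n = insert m m
      · obtain ⟨m, hm, rfl⟩ := hsucc
        obtain ⟨k, rfl⟩ := ih m (by simp) hm
        exact ⟨k + 1, (natCast_add_one_toZFSet k).symm⟩
      exfalso
      have : Fact (n ∈ U) := ⟨hU.mem_of_mem hw hn⟩
      -- An element that is neither `∅` nor a successor of an element could be removed from the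
      -- least inductive set without spoiling inductiveness.
      have hd : (x.sep P).sep (fun z => ¬ z = n) ∈ U := FOFun.mem inferInstance
      refine (ZFSet.mem_sep.1 ((ZFSet.mem_sep.1 hn).2 _ hd ?_ ?_)).2 rfl
      · exact ZFSet.mem_sep.2 ⟨hw₀, fun e => h0 e.symm⟩
      · intro z hz
        obtain ⟨hz, _⟩ := ZFSet.mem_sep.1 hz
        exact ZFSet.mem_sep.2 ⟨hws z hz, fun e => hsucc ⟨z, hz, e.symm⟩⟩

section Iterate

variable {D : ZFSet.{u} → ZFSet.{u} → ZFSet.{u} → ZFSet.{u}} {p : ZFSet.{u}}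

theorem mem_unionRec {x u : ZFSet.{u}} :
    u ∈ unionRec D p x ↔ ∃ z ∈ x, u ∈ D p z (unionRec D p z) := by
  rw [unionRec_eq, mem_biUnion]

theorem unionRec_mono {x y : ZFSet.{u}} (h : x ⊆ y) : unionRec D p x ⊆ unionRec D p y := by
  intro u hu
  rw [mem_unionRec] at hu ⊢
  exact hu.imp fun z hz => ⟨h hz.1, hz.2⟩

/-- The iteration is cumulative, and what is contributed by `n ∈ ω` is already present at stage `n +
1`. -/
theorem mem_unionRec_finOrdinals {u : ZFSet.{u}} : u ∈ unionRec D p finOrdinals ↔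
    ∃ n : ℕ, u ∈ unionRec D p (n : Ordinal.{u}).toZFSet := by
  rw [mem_unionRec]
  constructor
  · rintro ⟨z, hz, hu⟩
    obtain ⟨n, rfl⟩ := mem_finOrdinals.1 hz
    refine ⟨n + 1, mem_unionRec.2 ⟨_, ?_, hu⟩⟩
    rw [natCast_add_one_toZFSet]
    exact ZFSet.mem_insert _ _
  · rintro ⟨n, hu⟩
    obtain ⟨z, hz, hu⟩ := mem_unionRec.1 hu
    obtain ⟨a, ha, rfl⟩ := Ordinal.mem_toZFSet_iff.1 hz
    obtain ⟨m, rfl⟩ := Ordinal.lt_omega0.1 (ha.trans (Ordinal.natCast_lt_omega0 n))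
    exact ⟨_, mem_finOrdinals.2 ⟨m, rfl⟩, hu⟩

theorem mem_unionRec_finOrdinals_of_step {u : ZFSet.{u}} (n : ℕ)
    (hu : u ∈ D p (n : Ordinal.{u}).toZFSet (unionRec D p (n : Ordinal.{u}).toZFSet)) :
    u ∈ unionRec D p finOrdinals :=
  mem_unionRec.2 ⟨_, mem_finOrdinals.2 ⟨n, rfl⟩, hu⟩

theorem unionRec_natCast_mono {m n : ℕ} (h : m ≤ n) :
    unionRec D p (m : Ordinal.{u}).toZFSet ⊆ unionRec D p (n : Ordinal.{u}).toZFSet :=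
  unionRec_mono (Ordinal.toZFSet_subset_toZFSet_iff.2 (by exact_mod_cast h))

/-- Induction principle for the union of a finite iteration. -/
theorem unionRec_finOrdinals_induction {T : ZFSet.{u} → Prop}
    (h : ∀ z y, (∀ u ∈ y, T u) → ∀ u ∈ D p z y, T u) :
    ∀ u ∈ unionRec D p finOrdinals, T u := by
  have key : ∀ x : ZFSet.{u}, ∀ u ∈ unionRec D p x, T u := by
    intro x
    induction x using ZFSet.inductionOn with
    | h x ih =>
      intro u hu
      obtain ⟨z, hz, hu⟩ := mem_unionRec.1 hu
      exact h z _ (ih z hz) u hu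
  exact key _

end Iterate

/-- Finite sequences coded by iterated pairs, the last entry being the outermost one. -/
def tuple : {n : ℕ} → (Fin n → ZFSet.{u}) → ZFSet.{u}
  | 0, _ => ∅
  | n + 1, v => ZFSet.pair (v (Fin.last n)) (tuple (fun i : Fin n => v i.castSucc))

@[simp] theorem tuple_zero (v : Fin 0 → ZFSet.{u}) : tuple v = ∅ := rfl

theorem tuple_succ {n : ℕ} (v : Fin (n + 1) → ZFSet.{u}) :
    tuple v = ZFSet.pair (v (Fin.last n)) (tuple (fun i : Fin n => v i.castSucc)) := rfl

theorem tuple_snoc {n : ℕ} (v : Fin n → ZFSet.{u}) (a : ZFSet.{u}) :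
    tuple (Fin.snoc (α := fun _ => ZFSet.{u}) v a) = ZFSet.pair a (tuple v) := by
  simp [tuple_succ]

theorem pair_ne_empty (x y : ZFSet.{u}) : ∅ ≠ ZFSet.pair x y := by
  intro e
  have : ({x} : ZFSet.{u}) ∈ ZFSet.pair x y := by simp [ZFSet.pair]
  rw [← e] at this
  exact ZFSet.notMem_empty _ this

/-- The operation whose iteration generates the finite sequences of elements of `X`. -/
noncomputable def finSeqsStep (X _z y : ZFSet.{u}) : ZFSet.{u} :=
  {∅} ∪ biUnion X (fun a => biUnion y (fun s => {ZFSet.pair a s}))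

/-- The set of (codes of) finite sequences of elements of `X`. -/
noncomputable def finSeqs (X : ZFSet.{u}) : ZFSet.{u} := unionRec finSeqsStep X finOrdinals

theorem empty_mem_finSeqs (X : ZFSet.{u}) : ∅ ∈ finSeqs X :=
  mem_unionRec_finOrdinals_of_step 0 (by simp [finSeqsStep])

theorem pair_mem_finSeqs {X a s : ZFSet.{u}} (ha : a ∈ X) (hs : s ∈ finSeqs X) :
    ZFSet.pair a s ∈ finSeqs X := by
  obtain ⟨n, hn⟩ := mem_unionRec_finOrdinals.1 hs
  refine mem_unionRec_finOrdinals_of_step n ?_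
  simp only [finSeqsStep, ZFSet.mem_union, mem_biUnion, ZFSet.mem_singleton]
  exact Or.inr ⟨a, ha, s, hn, rfl⟩

theorem tuple_mem_finSeqs {X : ZFSet.{u}} {n : ℕ} {v : Fin n → ZFSet.{u}} (hv : ∀ i, v i ∈ X) :
    tuple v ∈ finSeqs X := by
  induction n with
  | zero => exact empty_mem_finSeqs X
  | succ n ih => exact pair_mem_finSeqs (hv _) (ih fun i => hv _)

theorem exists_tuple_of_mem_finSeqs {X s : ZFSet.{u}} (hs : s ∈ finSeqs X) :
    ∃ (n : ℕ) (v : Fin n → ZFSet.{u}), (∀ i, v i ∈ X) ∧ s = tuple v := by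
  refine unionRec_finOrdinals_induction (T := fun s => ∃ (n : ℕ) (v : Fin n → ZFSet.{u}),
    (∀ i, v i ∈ X) ∧ s = tuple v) (fun z y ih u hu => ?_) s hs
  simp only [finSeqsStep, ZFSet.mem_union, mem_biUnion, ZFSet.mem_singleton] at hu
  rcases hu with rfl | ⟨a, ha, s, hs, rfl⟩
  · exact ⟨0, Fin.elim0, fun i => i.elim0, rfl⟩
  · obtain ⟨n, v, hv, rfl⟩ := ih s hs
    refine ⟨n + 1, Fin.snoc (α := fun _ => ZFSet.{u}) v a, fun i => ?_, (tuple_snoc v a).symm⟩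
    refine Fin.lastCases ?_ (fun i => ?_) i <;> simp [ha, hv]

/-- Projection of a relation along the last coordinate. -/
noncomputable def projRel (X S R : ZFSet.{u}) : ZFSet.{u} := S.sep (fun s => ∃ a ∈ X, ZFSet.pair a s ∈ R)

/-- Adding a dummy last coordinate. -/
noncomputable def cylRel (X S R : ZFSet.{u}) : ZFSet.{u} :=
  S.sep (fun t => ∃ a ∈ X, ∃ s ∈ R, t = ZFSet.pair a s)

/-- Inserting a dummy coordinate before the last one. -/
noncomputable def insRel (X S R : ZFSet.{u}) : ZFSet.{u} :=
  S.sep (fun t => ∃ a ∈ X, ∃ b ∈ X, ∃ s ∈ S, t = ZFSet.pair a (ZFSet.pair b s) ∧ ZFSet.pair a s ∈ R)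

/-- The last coordinate is a member of the preceding one. -/
noncomputable def memRel (X S : ZFSet.{u}) : ZFSet.{u} :=
  S.sep (fun t => ∃ a ∈ X, ∃ b ∈ X, ∃ s ∈ S, t = ZFSet.pair a (ZFSet.pair b s) ∧ a ∈ b)

/-- The last coordinate has the preceding one as a member. -/
noncomputable def niRel (X S : ZFSet.{u}) : ZFSet.{u} :=
  S.sep (fun t => ∃ a ∈ X, ∃ b ∈ X, ∃ s ∈ S, t = ZFSet.pair a (ZFSet.pair b s) ∧ b ∈ a)

/-- The last two coordinates are equal. -/
noncomputable def eqRel (X S : ZFSet.{u}) : ZFSet.{u} :=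
  S.sep (fun t => ∃ a ∈ X, ∃ b ∈ X, ∃ s ∈ S, t = ZFSet.pair a (ZFSet.pair b s) ∧ a = b)

/-- One step of the generation of the definable relations on `X`. -/
noncomputable def defRelsStep (X _z y : ZFSet.{u}) : ZFSet.{u} :=
  {memRel X (finSeqs X)} ∪ {niRel X (finSeqs X)} ∪ {eqRel X (finSeqs X)} ∪
  biUnion y (fun R => {finSeqs X \ R} ∪ {projRel X (finSeqs X) R} ∪ {cylRel X (finSeqs X) R} ∪
    {insRel X (finSeqs X) R} ∪ biUnion y (fun R' => {R ∩ R'}))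

/-- The definable relations on `X`. -/
noncomputable def defRels (X : ZFSet.{u}) : ZFSet.{u} := unionRec defRelsStep X finOrdinals

/-- The fibres of the definable relations on `X`. -/
noncomputable def defRelFibres (X : ZFSet.{u}) : ZFSet.{u} :=
  biUnion (defRels X) (fun R => biUnion (finSeqs X) (fun s => {X.sep (fun a => ZFSet.pair a s ∈ R)}))

/-! ### Definability of the operations generating `Def` -/

section Definability

variable {U : Set ZFSet.{u}} [hU : SeparationCollectionClass U] [hω : Fact (finOrdinals ∈ U)]

instance : FOFun₃ U finSeqsStep where
  comp f g h _ _ _ := by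
    unfold finSeqsStep
    infer_instance

instance {n : ℕ} {f : (Fin n → ZFSet.{u}) → ZFSet.{u}} [FOFun U f] :
    FOFun U (fun v => finSeqs (f v)) := by
  unfold finSeqs
  infer_instance

instance {n : ℕ} {f g : (Fin n → ZFSet.{u}) → ZFSet.{u}} [FOFun U f] [FOFun U g] :
    FOFun U (fun v => memRel (f v) (g v)) := by
  unfold memRel
  infer_instance

instance {n : ℕ} {f g : (Fin n → ZFSet.{u}) → ZFSet.{u}} [FOFun U f] [FOFun U g] :
    FOFun U (fun v => niRel (f v) (g v)) := by
  unfold niRel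
  infer_instance

instance {n : ℕ} {f g : (Fin n → ZFSet.{u}) → ZFSet.{u}} [FOFun U f] [FOFun U g] :
    FOFun U (fun v => eqRel (f v) (g v)) := by
  unfold eqRel
  infer_instance

instance {n : ℕ} {f g h : (Fin n → ZFSet.{u}) → ZFSet.{u}} [FOFun U f] [FOFun U g] [FOFun U h] :
    FOFun U (fun v => projRel (f v) (g v) (h v)) := by
  unfold projRel
  infer_instance

instance {n : ℕ} {f g h : (Fin n → ZFSet.{u}) → ZFSet.{u}} [FOFun U f] [FOFun U g] [FOFun U h] :
    FOFun U (fun v => cylRel (f v) (g v) (h v)) := by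
  unfold cylRel
  infer_instance

instance {n : ℕ} {f g h : (Fin n → ZFSet.{u}) → ZFSet.{u}} [FOFun U f] [FOFun U g] [FOFun U h] :
    FOFun U (fun v => insRel (f v) (g v) (h v)) := by
  unfold insRel
  infer_instance

instance : FOFun₃ U defRelsStep where
  comp f g h _ _ _ := by
    unfold defRelsStep
    infer_instance

instance {n : ℕ} {f : (Fin n → ZFSet.{u}) → ZFSet.{u}} [FOFun U f] :
    FOFun U (fun v => defRelFibres (f v)) := by
  unfold defRelFibres defRels
  infer_instance

end Definability

section Closure

variable {X R R' : ZFSet.{u}}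

theorem memRel_mem_defRels : memRel X (finSeqs X) ∈ defRels X :=
  mem_unionRec_finOrdinals_of_step 0 (by simp [defRelsStep])

theorem niRel_mem_defRels : niRel X (finSeqs X) ∈ defRels X :=
  mem_unionRec_finOrdinals_of_step 0 (by simp [defRelsStep])

theorem eqRel_mem_defRels : eqRel X (finSeqs X) ∈ defRels X :=
  mem_unionRec_finOrdinals_of_step 0 (by simp [defRelsStep])

theorem unary_mem_defRels (hR : R ∈ defRels X) :
    (finSeqs X \ R) ∈ defRels X ∧ projRel X (finSeqs X) R ∈ defRels X ∧
      cylRel X (finSeqs X) R ∈ defRels X ∧ insRel X (finSeqs X) R ∈ defRels X := by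
  obtain ⟨n, hn⟩ := mem_unionRec_finOrdinals.1 hR
  refine ⟨?_, ?_, ?_, ?_⟩ <;>
  · refine mem_unionRec_finOrdinals_of_step n ?_
    simp only [defRelsStep, ZFSet.mem_union, mem_biUnion, ZFSet.mem_singleton]
    exact Or.inr ⟨R, hn, by simp⟩

theorem inter_mem_defRels (hR : R ∈ defRels X) (hR' : R' ∈ defRels X) : R ∩ R' ∈ defRels X := by
  obtain ⟨n, hn⟩ := mem_unionRec_finOrdinals.1 hR
  obtain ⟨m, hm⟩ := mem_unionRec_finOrdinals.1 hR'
  refine mem_unionRec_finOrdinals_of_step (max n m) ?_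
  simp only [defRelsStep, ZFSet.mem_union, mem_biUnion, ZFSet.mem_singleton]
  exact Or.inr ⟨R, unionRec_natCast_mono (le_max_left _ _) hn,
    Or.inr ⟨R', unionRec_natCast_mono (le_max_right _ _) hm, rfl⟩⟩

end Closure

theorem FORel.prop {U : Set ZFSet.{u}} {n : ℕ} (c : Prop) :
    FORel U (fun _ : Fin n → ZFSet.{u} => c) := by
  have h : FORel U (fun _ : Fin n → ZFSet.{u} => ∀ a ∈ U, a = a) := inferInstance
  by_cases hc : c
  · exact h.congr fun v _ => by simp [hc]
  · exact h.not.congr fun v _ => by simp [hc]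

/-- The relations generated by the set operations are first-order definable. -/
theorem foRel_of_mem_defRels {X R : ZFSet.{u}} (hR : R ∈ defRels X) :
    ∀ n : ℕ, FORel (X : Set ZFSet.{u}) (fun v : Fin n → ZFSet.{u} => tuple v ∈ R) := by
  -- The three basic relations have a common form. In arities `0` and `1` no tuple is a pair whose
  -- second entry is a pair, so they define the empty relation.
  have atom : ∀ (r : ZFSet.{u} → ZFSet.{u} → Prop) (n : ℕ),
      (∀ i j : Fin n, FORel (X : Set ZFSet.{u}) (fun v : Fin n → ZFSet.{u} => r (v i) (v j))) →
      FORel (X : Set ZFSet.{u}) (fun v : Fin n → ZFSet.{u} => tuple v ∈ (finSeqs X).sep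
        (fun t => ∃ a ∈ X, ∃ b ∈ X, ∃ s ∈ finSeqs X, t = ZFSet.pair a (ZFSet.pair b s) ∧ r a b)) := by
    intro r n hr
    match n with
    | 0 => exact (FORel.prop False).congr fun v _ => by simp [pair_ne_empty]
    | 1 => exact (FORel.prop False).congr fun v _ => by
             simp [tuple_succ, ZFSet.pair_inj, pair_ne_empty]
    | n + 2 =>
      refine (hr (Fin.last (n + 1)) (Fin.last n).castSucc).congr fun v hv => ?_
      rw [ZFSet.mem_sep, and_iff_right (tuple_mem_finSeqs hv)]
      simp only [tuple_succ, ZFSet.pair_inj]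
      constructor
      · rintro ⟨a, _, b, _, s, _, ⟨rfl, rfl, _⟩, h⟩
        exact h
      · intro h
        exact ⟨_, hv _, _, hv _, _, tuple_mem_finSeqs fun i => hv _, ⟨rfl, rfl, rfl⟩, h⟩
  refine unionRec_finOrdinals_induction (T := fun R => ∀ n : ℕ, FORel (X : Set ZFSet.{u})
    (fun v : Fin n → ZFSet.{u} => tuple v ∈ R)) (fun z y ih R hR n => ?_) R hR
  simp only [defRelsStep, ZFSet.mem_union, mem_biUnion, ZFSet.mem_singleton] at hR
  rcases hR with ((rfl | rfl) | rfl) | ⟨R, hR, (((rfl | rfl) | rfl) | rfl) | ⟨R', hR', rfl⟩⟩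
  · exact atom (fun a b => a ∈ b) n fun i j => inferInstance
  · exact atom (fun a b => b ∈ a) n fun i j => inferInstance
  · exact atom (fun a b => a = b) n fun i j => inferInstance
  · refine (ih R hR n).not.congr fun v hv => ?_
    rw [ZFSet.mem_sdiff, and_iff_right (tuple_mem_finSeqs hv)]
  · refine (ih R hR (n + 1)).not.all_snoc.not.congr fun v hv => ?_
    rw [projRel, ZFSet.mem_sep, and_iff_right (tuple_mem_finSeqs hv)]
    simp [tuple_snoc]
  · cases n with
    | zero => exact (FORel.prop False).congr fun v _ => by simp [cylRel, pair_ne_empty]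
    | succ n =>
      refine ((ih R hR n).rename Fin.castSucc).congr fun v hv => ?_
      rw [cylRel, ZFSet.mem_sep, and_iff_right (tuple_mem_finSeqs hv)]
      simp only [tuple_succ, ZFSet.pair_inj]
      constructor
      · rintro ⟨_, _, _, hs, _, rfl⟩; exact hs
      · intro h; exact ⟨_, hv _, _, h, rfl, rfl⟩
  · match n with
    | 0 => exact (FORel.prop False).congr fun v _ => by simp [insRel, pair_ne_empty]
    | 1 => exact (FORel.prop False).congr fun v _ => by
             simp [insRel, tuple_succ, ZFSet.pair_inj, pair_ne_empty]
    | n + 2 =>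
      refine ((ih R hR (n + 1)).rename (m := n + 2) (Fin.snoc (α := fun _ => Fin (n + 2))
        (fun i => i.castSucc.castSucc) (Fin.last _))).congr fun v hv => ?_
      rw [insRel, ZFSet.mem_sep, and_iff_right (tuple_mem_finSeqs hv)]
      simp only [tuple_succ, ZFSet.pair_inj, Fin.snoc_last, Fin.snoc_castSucc]
      constructor
      · rintro ⟨_, _, _, _, _, _, ⟨rfl, rfl, rfl⟩, h⟩; exact h
      · intro h
        exact ⟨_, hv _, _, hv _, _, tuple_mem_finSeqs fun i => hv _, ⟨rfl, rfl, rfl⟩, h⟩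
  · refine ((ih R hR n).and (ih R' hR' n)).congr fun v hv => ?_
    rw [ZFSet.mem_inter]

/-- `R` represents the relation `P` on `X`. -/
def Represents (X R : ZFSet.{u}) {n : ℕ} (P : (Fin n → ZFSet.{u}) → Prop) : Prop :=
  R ∈ defRels X ∧ ∀ v, (∀ i, v i ∈ X) → (tuple v ∈ R ↔ P v)

section Represents

variable {X R : ZFSet.{u}} {n : ℕ}

theorem Represents.cyl {P : (Fin n → ZFSet.{u}) → Prop} (h : Represents X R P) :
    Represents X (cylRel X (finSeqs X) R)
      (fun v : Fin (n + 1) → ZFSet.{u} => P (fun i => v i.castSucc)) := by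
  refine ⟨(unary_mem_defRels h.1).2.2.1, fun v hv => ?_⟩
  beta_reduce
  rw [← h.2 _ fun i => hv _, cylRel, ZFSet.mem_sep, and_iff_right (tuple_mem_finSeqs hv)]
  simp only [tuple_succ, ZFSet.pair_inj]
  constructor
  · rintro ⟨_, _, _, hs, _, rfl⟩; exact hs
  · intro h; exact ⟨_, hv _, _, h, rfl, rfl⟩

theorem Represents.not {P : (Fin n → ZFSet.{u}) → Prop} (h : Represents X R P) :
    Represents X (finSeqs X \ R) (fun v => ¬ P v) := by
  refine ⟨(unary_mem_defRels h.1).1, fun v hv => ?_⟩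
  beta_reduce
  rw [← h.2 v hv, ZFSet.mem_sdiff, and_iff_right (tuple_mem_finSeqs hv)]

theorem Represents.and {P Q : (Fin n → ZFSet.{u}) → Prop} {R' : ZFSet.{u}} (h : Represents X R P)
    (h' : Represents X R' Q) : Represents X (R ∩ R') (fun v => P v ∧ Q v) := by
  refine ⟨inter_mem_defRels h.1 h'.1, fun v hv => ?_⟩
  beta_reduce
  rw [← h.2 v hv, ← h'.2 v hv, ZFSet.mem_inter]

theorem Represents.ex {P : (Fin (n + 1) → ZFSet.{u}) → Prop} (h : Represents X R P) :
    Represents X (projRel X (finSeqs X) R)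
      (fun v : Fin n → ZFSet.{u} => ∃ a ∈ X, P (Fin.snoc (α := fun _ => ZFSet.{u}) v a)) := by
  refine ⟨(unary_mem_defRels h.1).2.1, fun v hv => ?_⟩
  rw [projRel, ZFSet.mem_sep, and_iff_right (tuple_mem_finSeqs hv)]
  refine exists_congr fun a => and_congr_right fun ha => ?_
  rw [← h.2, tuple_snoc]
  intro i
  refine Fin.lastCases ?_ (fun i => ?_) i <;> simp [ha, hv]

theorem Represents.congr {P Q : (Fin n → ZFSet.{u}) → Prop} (h : Represents X R P)
    (hPQ : ∀ v, (∀ i, v i ∈ X) → (P v ↔ Q v)) : Represents X R Q :=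
  ⟨h.1, fun v hv => (h.2 v hv).trans (hPQ v hv)⟩

theorem exists_represents_prop (X : ZFSet.{u}) (n : ℕ) (c : Prop) :
    ∃ R, Represents X R (fun _ : Fin n → ZFSet.{u} => c) := by
  -- The complement of the empty relation, the latter written as `eqRel` intersected with its own
  -- complement.
  have h : Represents X (finSeqs X \ (eqRel X (finSeqs X) ∩ (finSeqs X \ eqRel X (finSeqs X))))
      (fun _ : Fin n → ZFSet.{u} => True) := by
    refine ⟨(unary_mem_defRels (inter_mem_defRels eqRel_mem_defRels
      (unary_mem_defRels eqRel_mem_defRels).1)).1, fun v hv => ?_⟩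
    simp only [ZFSet.mem_sdiff, ZFSet.mem_inter, tuple_mem_finSeqs hv]
    tauto
  by_cases hc : c
  · exact ⟨_, h.congr fun v _ => by simp [hc]⟩
  · exact ⟨_, h.not.congr fun v _ => by simp [hc]⟩

/-- Relations between the last and any other coordinate. -/
theorem exists_represents_last (r : ZFSet.{u} → ZFSet.{u} → Prop)
    (hr : ((finSeqs X).sep (fun t => ∃ a ∈ X, ∃ b ∈ X, ∃ s ∈ finSeqs X,
      t = ZFSet.pair a (ZFSet.pair b s) ∧ r a b)) ∈ defRels X) :
    ∀ {n : ℕ} (j : Fin n), ∃ R, Represents X R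
      (fun v : Fin (n + 1) → ZFSet.{u} => r (v (Fin.last n)) (v j.castSucc)) := by
  intro n
  induction n with
  | zero => exact fun j => j.elim0
  | succ n ih =>
    refine fun j => Fin.lastCases ?_ (fun j => ?_) j
    · refine ⟨_, hr, fun v hv => ?_⟩
      rw [ZFSet.mem_sep, and_iff_right (tuple_mem_finSeqs hv)]
      simp only [tuple_succ, ZFSet.pair_inj]
      constructor
      · rintro ⟨a, _, b, _, s, _, ⟨rfl, rfl, _⟩, h⟩
        exact h
      · intro h
        exact ⟨_, hv _, _, hv _, _, tuple_mem_finSeqs fun i => hv _, ⟨rfl, rfl, rfl⟩, h⟩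
    -- When `j` is not adjacent to the last coordinate, the adjacent one is a dummy: it is dropped
    -- for the induction hypothesis and restored by `insRel`.
    · obtain ⟨R, hR, hR'⟩ := ih j
      refine ⟨_, (unary_mem_defRels hR).2.2.2, fun v hv => ?_⟩
      have h := hR' (Fin.snoc (α := fun _ => ZFSet.{u}) (fun i => v i.castSucc.castSucc)
        (v (Fin.last _))) (fun i => by
          refine Fin.lastCases ?_ (fun i => ?_) i <;> simp [hv])
      rw [tuple_snoc] at h
      simp only [Fin.snoc_last, Fin.snoc_castSucc] at h
      beta_reduce
      rw [← h, insRel, ZFSet.mem_sep, and_iff_right (tuple_mem_finSeqs hv)]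
      simp only [tuple_succ, ZFSet.pair_inj]
      constructor
      · rintro ⟨_, _, _, _, _, _, ⟨rfl, rfl, rfl⟩, h⟩; exact h
      · intro h
        exact ⟨_, hv _, _, hv _, _, tuple_mem_finSeqs fun i => hv _, ⟨rfl, rfl, rfl⟩, h⟩

/-- If neither variable is the last coordinate, a dummy last coordinate is added. Otherwise the
relation or its converse, according to which variable is last, is treated by
`exists_represents_last`; on the diagonal it is constant. -/
theorem exists_represents_atom (r : ZFSet.{u} → ZFSet.{u} → Prop)
    (hr : ((finSeqs X).sep (fun t => ∃ a ∈ X, ∃ b ∈ X, ∃ s ∈ finSeqs X,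
      t = ZFSet.pair a (ZFSet.pair b s) ∧ r a b)) ∈ defRels X)
    (hr' : ((finSeqs X).sep (fun t => ∃ a ∈ X, ∃ b ∈ X, ∃ s ∈ finSeqs X,
      t = ZFSet.pair a (ZFSet.pair b s) ∧ r b a)) ∈ defRels X)
    {c : Prop} (hc : ∀ a, r a a ↔ c) :
    ∀ {n : ℕ} (i j : Fin n), ∃ R, Represents X R
      (fun v : Fin n → ZFSet.{u} => r (v i) (v j)) := by
  intro n
  induction n with
  | zero => exact fun i => i.elim0
  | succ n ih =>
    refine fun i j => Fin.lastCases ?_ (fun i => ?_) i <;>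
      refine Fin.lastCases ?_ (fun j => ?_) j
    · obtain ⟨R, hR⟩ := exists_represents_prop X (n + 1) c
      exact ⟨R, hR.congr fun v _ => (hc _).symm⟩
    · exact exists_represents_last r hr j
    · exact exists_represents_last (fun a b => r b a) hr' i
    · obtain ⟨R, hR⟩ := ih i j
      exact ⟨_, hR.cyl⟩

/-- Every first-order definable relation is generated by the set operations. -/
theorem FOPure.exists_represents {P : (Fin n → ZFSet.{u}) → Prop}
    (h : FOPure (X : Set ZFSet.{u}) P) : ∃ R, Represents X R P := by
  induction h with
  | mem i j =>
    exact exists_represents_atom (fun a b => a ∈ b) memRel_mem_defRels niRel_mem_defRels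
      (c := False) (fun a => by simp [ZFSet.mem_irrefl]) i j
  | eq i j =>
    refine exists_represents_atom (fun a b => a = b) eqRel_mem_defRels ?_ (c := True)
      (fun a => by simp) i j
    simp only [eq_comm (a := _) (b := _)]
    convert eqRel_mem_defRels (X := X) using 1
    ext t
    simp only [eqRel, ZFSet.mem_sep]
  | not _ ih =>
    obtain ⟨R, hR⟩ := ih
    exact ⟨_, hR.not⟩
  | and _ _ ih ih' =>
    obtain ⟨R, hR⟩ := ih
    obtain ⟨R', hR'⟩ := ih'
    exact ⟨_, hR.and hR'⟩
  | all _ ih =>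
    obtain ⟨R, hR⟩ := ih
    exact ⟨_, hR.not.ex.not.congr fun v _ => by simp⟩

end Represents

/-- The outermost entry of a tuple is its last coordinate. Hence the fibre of a relation over the
tuple of parameters is exactly the subset that they define. -/
theorem defRelFibres_eq (X : ZFSet.{u}) : defRelFibres X = defPowerset X := by
  ext Y
  rw [mem_defPowerset]
  simp only [defRelFibres, mem_biUnion, ZFSet.mem_singleton]
  constructor
  · rintro ⟨R, hR, s, hs, rfl⟩
    refine ⟨ZFSet.sep_subset, ?_⟩
    obtain ⟨m, q, hq, rfl⟩ := exists_tuple_of_mem_finSeqs hs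
    refine ((foRel_of_mem_defRels hR (m + 1)).inst₁
      (Q := fun v a => ZFSet.pair a (tuple v) ∈ R) hq).congr fun v hv => ?_
    exact ZFSet.mem_sep.trans (and_iff_right (hv 0))
  · rintro ⟨hY, m, p, Q, hp, hQ, hPQ⟩
    obtain ⟨R, hR, hR'⟩ := hQ.exists_represents
    refine ⟨R, hR, tuple p, tuple_mem_finSeqs hp, ?_⟩
    have key : ∀ a ∈ X, (a ∈ Y ↔ ZFSet.pair a (tuple p) ∈ R) := by
      intro a ha
      rw [← tuple_snoc, hR', hPQ (fun _ => a) fun _ => ha, Fin.append_right_eq_snoc]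
      intro i
      refine Fin.lastCases ?_ (fun i => ?_) i
      · simpa using ha
      · simpa using hp i
    ext a
    rw [ZFSet.mem_sep]
    exact ⟨fun h => ⟨hY h, (key a (hY h)).1 h⟩, fun h => (key a h.1).2 h.2⟩

instance {U : Set ZFSet.{u}} [SeparationCollectionClass U] [Fact (finOrdinals ∈ U)] {n : ℕ}
    {f : (Fin n → ZFSet.{u}) → ZFSet.{u}} [FOFun U f] :
    FOFun U (fun v => defPowerset (f v)) := by
  simp only [← defRelFibres_eq]
  infer_instance

/-! ## The constructible hierarchy -/

theorem sep_mem_defPowerset {X : ZFSet.{u}} {P : ZFSet.{u} → Prop}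
    (hP : FORel (X : Set ZFSet.{u}) (fun v : Fin 1 → ZFSet.{u} => P (v 0))) :
    X.sep P ∈ defPowerset X :=
  mem_defPowerset.2 ⟨ZFSet.sep_subset, hP.congr fun _ hv =>
    ZFSet.mem_sep.trans (and_iff_right (hv 0))⟩

/-- An element `a` of a transitive set `X` is the subset defined by `v ∈ a`, with `a` as parameter.
-/
theorem subset_defPowerset {X : ZFSet.{u}} (hX : X.IsTransitive) : X ⊆ defPowerset X := by
  intro a ha
  have : Fact (a ∈ (X : Set ZFSet.{u})) := ⟨ha⟩
  exact mem_defPowerset.2 ⟨hX.subset_of_mem ha, inferInstance⟩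

theorem isTransitive_transClosure (x : ZFSet.{u}) : (transClosure x).IsTransitive := by
  intro y hy z hz
  rw [mem_transClosure] at hy ⊢
  exact .head hz hy

/-- Brings the transitive closure into the scope of the recursion theorem for `U`. -/
theorem transClosure_eq_unionRec (x : ZFSet.{u}) :
    transClosure x = unionRec (fun _ z y => insert z y) ∅ x := by
  induction x using ZFSet.inductionOn with
  | h x ih =>
    ext u
    rw [mem_transClosure, unionRec_eq, mem_biUnion, Relation.TransGen.tail'_iff]
    refine exists_congr fun z => and_comm.trans (and_congr_right fun hz => ?_)
    rw [← ih z hz, ZFSet.mem_insert_iff, mem_transClosure, Relation.reflTransGen_iff_eq_or_transGen,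
      eq_comm]

/-- The step of the constructible hierarchy over `T`. -/
noncomputable def constructibleStep (T _z y : ZFSet.{u}) : ZFSet.{u} := defPowerset (T ∪ y)

theorem isTransitive_union_unionRec {T : ZFSet.{u}} (hT : T.IsTransitive) (x : ZFSet.{u}) :
    (T ∪ unionRec constructibleStep T x).IsTransitive := by
  induction x using ZFSet.inductionOn with
  | h x ih =>
    intro y hy u hu
    rw [ZFSet.mem_union] at hy ⊢
    rcases hy with hy | hy
    · exact Or.inl (hT.subset_of_mem hy hu)
    · obtain ⟨z, hz, hy⟩ := mem_unionRec.1 hy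
      exact Or.inr (mem_unionRec.2 ⟨z, hz, subset_defPowerset (ih z hz)
        ((mem_defPowerset.1 hy).1 hu)⟩)

/-- Zero, successor and limit stages merge into one membership recursion because the hierarchy is
cumulative. The bottom level is added separately, since the recursion is empty at `0`. -/
theorem constructibleFrom_eq (C : ZFSet.{u}) (β : Ordinal.{u}) : constructibleFrom C β =
    transClosure {C} ∪ unionRec constructibleStep (transClosure {C}) β.toZFSet := by
  have htr := isTransitive_union_unionRec (isTransitive_transClosure {C})
  induction β using Ordinal.limitRecOn with
  | zero =>
    rw [constructibleFrom_zero, Ordinal.toZFSet_zero]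
    ext u
    simp [mem_unionRec]
  | add_one β ih =>
    rw [constructibleFrom_add_one, ih]
    ext u
    rw [ZFSet.mem_union, mem_unionRec, Ordinal.toZFSet_add_one]
    constructor
    · exact fun hu => Or.inr ⟨_, ZFSet.mem_insert _ _, hu⟩
    · rintro (hu | ⟨z, hz, hu⟩)
      · exact subset_defPowerset (htr _) (ZFSet.mem_union.2 (Or.inl hu))
      · rcases ZFSet.mem_insert_iff.1 hz with rfl | hz
        · exact hu
        · exact subset_defPowerset (htr _)
            (ZFSet.mem_union.2 (Or.inr (mem_unionRec.2 ⟨z, hz, hu⟩)))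
  | limit γ hγ ih =>
    rw [constructibleFrom_limit C γ hγ]
    ext u
    rw [ZFSet.mem_iUnion, ZFSet.mem_union]
    constructor
    · rintro ⟨⟨δ, hδ⟩, hu⟩
      rw [ih δ hδ, ZFSet.mem_union] at hu
      exact hu.imp_right fun hu =>
        unionRec_mono (Ordinal.toZFSet_subset_toZFSet_iff.2 (le_of_lt hδ)) hu
    · rintro (hu | hu)
      · refine ⟨⟨0, hγ.bot_lt⟩, ?_⟩
        rw [constructibleFrom_zero]
        exact hu
      · obtain ⟨z, hz, hu⟩ := mem_unionRec.1 hu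
        obtain ⟨δ, hδ, rfl⟩ := Ordinal.mem_toZFSet_iff.1 hz
        have hδ' : δ + 1 < γ := hγ.add_one_lt hδ
        refine ⟨⟨δ + 1, hδ'⟩, ?_⟩
        rw [ih _ hδ', ZFSet.mem_union, Ordinal.toZFSet_add_one]
        exact Or.inr (mem_unionRec.2 ⟨_, ZFSet.mem_insert _ _, hu⟩)

theorem isTransitive_constructibleFrom (C : ZFSet.{u}) (β : Ordinal.{u}) :
    (constructibleFrom C β).IsTransitive := by
  rw [constructibleFrom_eq]
  exact isTransitive_union_unionRec (isTransitive_transClosure _) _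

theorem mem_constructibleFrom {C u : ZFSet.{u}} {β : Ordinal.{u}} : u ∈ constructibleFrom C β ↔
    u ∈ transClosure {C} ∨ ∃ γ < β, u ∈ defPowerset (constructibleFrom C γ) := by
  rw [constructibleFrom_eq, ZFSet.mem_union, mem_unionRec]
  refine or_congr_right ?_
  constructor
  · rintro ⟨z, hz, hu⟩
    obtain ⟨δ, hδ, rfl⟩ := Ordinal.mem_toZFSet_iff.1 hz
    refine ⟨δ, hδ, ?_⟩
    rwa [constructibleFrom_eq]
  · rintro ⟨γ, hγ, hu⟩
    rw [constructibleFrom_eq] at hu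
    exact ⟨_, Ordinal.toZFSet_mem_toZFSet_iff.2 hγ, hu⟩

theorem constructibleFrom_mono {C : ZFSet.{u}} {γ β : Ordinal.{u}} (h : γ ≤ β) :
    constructibleFrom C γ ⊆ constructibleFrom C β := by
  intro u hu
  rw [mem_constructibleFrom] at hu ⊢
  exact hu.imp_right fun ⟨δ, hδ, hu⟩ => ⟨δ, hδ.trans_le h, hu⟩

theorem transClosure_subset_constructibleFrom (C : ZFSet.{u}) (β : Ordinal.{u}) :
    transClosure {C} ⊆ constructibleFrom C β :=
  fun _ hu => mem_constructibleFrom.2 (Or.inl hu)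

theorem ZFSet.IsTransitive.transClass {X : ZFSet.{u}} (hX : X.IsTransitive) :
    TransClass (X : Set ZFSet.{u}) where
  mem_of_mem hx hy := hX.subset_of_mem hx hy

/-! ### Rebuilding a collapse inside the hierarchy over its code -/

/-- Four times the rank of a set, as a bound for the level at which its code is collapsed. -/
noncomputable def levelBound : ZFSet.{u} → Ordinal.{u} :=
  ZFSet.mem_wf.fix fun x ih => ⨆ y : x, ih y.1 y.2 + 1 + 1 + 1 + 1

theorem levelBound_eq (x : ZFSet.{u}) :
    levelBound x = ⨆ y : x, levelBound y.1 + 1 + 1 + 1 + 1 := by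
  rw [levelBound, WellFounded.fix_eq]

theorem levelBound_le_of_mem {x y : ZFSet.{u}} (h : y ∈ x) :
    levelBound y + 1 + 1 + 1 + 1 ≤ levelBound x := by
  rw [levelBound_eq x]
  exact Ordinal.le_iSup (fun y : x => levelBound y.1 + 1 + 1 + 1 + 1) ⟨y, h⟩

section SeparationCollection

variable {U : Set ZFSet.{u}} [hU : SeparationCollectionClass U]

theorem transClosure_mem {x : ZFSet.{u}} (hx : x ∈ U) : transClosure x ∈ U := by
  have : FOFun₃ U (fun _ z y => insert z y) := ⟨fun f g h _ _ _ => inferInstance⟩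
  rw [transClosure_eq_unionRec]
  exact unionRec_mem hU.empty_mem hx

theorem constructibleFrom_mem [hω : Fact (finOrdinals ∈ U)] {C : ZFSet.{u}} (hC : C ∈ U)
    {β : Ordinal.{u}} (hβ : β.toZFSet ∈ U) : constructibleFrom C β ∈ U := by
  have : FOFun₃ U constructibleStep := ⟨fun f g h _ _ _ => by
    unfold constructibleStep
    infer_instance⟩
  have : Fact (C ∈ U) := ⟨hC⟩
  have : Fact (β.toZFSet ∈ U) := ⟨hβ⟩
  have : Fact (transClosure {C} ∈ U) := ⟨transClosure_mem (FOFun.mem inferInstance)⟩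
  rw [constructibleFrom_eq]
  exact FOFun.mem inferInstance

theorem defPowerset_mem [hω : Fact (finOrdinals ∈ U)] {X : ZFSet.{u}} (hX : X ∈ U) :
    defPowerset X ∈ U := by
  have : Fact (X ∈ U) := ⟨hX⟩
  exact FOFun.mem inferInstance

theorem add_one_toZFSet_mem {α : Ordinal.{u}} (h : α.toZFSet ∈ U) : (α + 1).toZFSet ∈ U := by
  have : Fact (α.toZFSet ∈ U) := ⟨h⟩
  rw [Ordinal.toZFSet_add_one]
  exact FOFun.mem inferInstance

/-- The supremum of ordinals is their union as sets, so the bound is itself a membership recursion,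
with step four successors. -/
theorem levelBound_toZFSet_mem {x : ZFSet.{u}} (hx : x ∈ U) : (levelBound x).toZFSet ∈ U := by
  let s : ZFSet.{u} → ZFSet.{u} := fun y => insert y y
  have hs : ∀ {n : ℕ} {f : (Fin n → ZFSet.{u}) → ZFSet.{u}} [FOFun U f],
      FOFun U (fun v => s (f v)) := fun {n f} _ => by
    simp only [s]
    infer_instance
  have : FOFun₃ U (fun _ _ y => s (s (s (s y)))) := ⟨fun f g h _ _ _ => inferInstance⟩
  have key : ∀ x, (levelBound x).toZFSet = unionRec (fun _ _ y => s (s (s (s y)))) ∅ x := by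
    intro x
    induction x using ZFSet.inductionOn with
    | h x ih =>
      rw [unionRec_eq, levelBound_eq]
      ext u
      rw [Ordinal.mem_toZFSet_iff, mem_biUnion]
      have e : ∀ z ∈ x, s (s (s (s (unionRec (fun _ _ y => s (s (s (s y)))) ∅ z)))) =
          (levelBound z + 1 + 1 + 1 + 1).toZFSet := by
        intro z hz
        simp only [← ih z hz, Ordinal.toZFSet_add_one, s]
      constructor
      · rintro ⟨a, ha, rfl⟩
        obtain ⟨⟨z, hz⟩, ha⟩ := Ordinal.lt_iSup_iff.1 ha
        refine ⟨z, hz, ?_⟩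
        rw [e z hz]
        exact Ordinal.toZFSet_mem_toZFSet_iff.2 ha
      · rintro ⟨z, hz, hu⟩
        rw [e z hz] at hu
        obtain ⟨a, ha, rfl⟩ := Ordinal.mem_toZFSet_iff.1 hu
        exact ⟨a, Ordinal.lt_iSup_iff.2 ⟨⟨z, hz⟩, ha⟩, rfl⟩
  rw [key]
  exact unionRec_mem hU.empty_mem hx

end SeparationCollection

/-- `F` is a bisimulation between the relation `E` and membership. -/
def IsCollapseGraph (E F : ZFSet.{u}) : Prop :=
  ∀ z u, ZFSet.pair z u ∈ F → (∀ y, pairRel E y z → ∃ v ∈ u, ZFSet.pair y v ∈ F) ∧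
    ∀ v ∈ u, ∃ y, pairRel E y z ∧ ZFSet.pair y v ∈ F

/-- Collapse graphs are only partial, but wherever one is defined well-foundedness of `E` determines
its value. -/
theorem IsCollapseGraph.eq_collapse {E F : ZFSet.{u}} (hF : IsCollapseGraph E F)
    (wE : WellFounded (pairRel E)) (z : ZFSet.{u}) :
    ∀ u, ZFSet.pair z u ∈ F → u = collapse E z := by
  induction z using wE.induction with
  | h z ih =>
    intro u hzu
    obtain ⟨h₁, h₂⟩ := hF z u hzu
    ext v
    rw [mem_collapse wE]
    constructor
    · intro hv
      obtain ⟨y, hy, hyv⟩ := h₂ v hv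
      exact ⟨y, hy, ih y hy v hyv⟩
    · rintro ⟨y, hy, rfl⟩
      obtain ⟨v, hv, hyv⟩ := h₁ y hy
      rwa [← ih y hy v hyv]

instance {U : Set ZFSet.{u}} [hU : TransClass U] {n : ℕ} {e f : (Fin n → ZFSet.{u}) → ZFSet.{u}}
    [he : FOFun U e] [hf : FOFun U f] : FORel U (fun v => IsCollapseGraph (e v) (f v)) := by
  refine FORel.congr (Q := fun v => ∀ z ∈ U, ∀ u ∈ U, ZFSet.pair z u ∈ f v →
    (∀ y ∈ U, pairRel (e v) y z → ∃ w ∈ u, ZFSet.pair y w ∈ f v) ∧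
    ∀ w ∈ u, ∃ y ∈ U, pairRel (e v) y z ∧ ZFSet.pair y w ∈ f v) inferInstance fun v hv => ?_
  have heU : ∀ {y z}, pairRel (e v) y z → y ∈ U ∧ z ∈ U := fun h =>
    mem_and_mem_of_pair_mem (hU.mem_of_mem (he.maps v hv) h)
  have hfU : ∀ {y z}, ZFSet.pair y z ∈ f v → y ∈ U ∧ z ∈ U := fun h =>
    mem_and_mem_of_pair_mem (hU.mem_of_mem (hf.maps v hv) h)
  constructor
  · intro h z _ u _ hzu
    obtain ⟨h₁, h₂⟩ := h z u hzu
    refine ⟨fun y _ hy => h₁ y hy, fun w hw => ?_⟩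
    obtain ⟨y, hy, hyw⟩ := h₂ w hw
    exact ⟨y, (heU hy).1, hy, hyw⟩
  · intro h z u hzu
    obtain ⟨h₁, h₂⟩ := h z (hfU hzu).1 u (hfU hzu).2 hzu
    refine ⟨fun y hy => h₁ y (heU hy).1 hy, fun w hw => ?_⟩
    obtain ⟨y, _, hy, hyw⟩ := h₂ w hw
    exact ⟨y, hy, hyw⟩

theorem constructibleFrom_sep_mem {C : ZFSet.{u}} {β : Ordinal.{u}} {P : ZFSet.{u} → Prop}
    (hP : FORel (constructibleFrom C β : Set ZFSet.{u}) (fun v : Fin 1 → ZFSet.{u} => P (v 0))) :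
    (constructibleFrom C β).sep P ∈ constructibleFrom C (β + 1) := by
  rw [constructibleFrom_add_one]
  exact sep_mem_defPowerset hP

theorem unordered_mem_constructibleFrom {C x y : ZFSet.{u}} {β : Ordinal.{u}}
    (hx : x ∈ constructibleFrom C β) (hy : y ∈ constructibleFrom C β) :
    ({x, y} : ZFSet.{u}) ∈ constructibleFrom C (β + 1) := by
  have : Fact (x ∈ (constructibleFrom C β : Set ZFSet.{u})) := ⟨hx⟩
  have : Fact (y ∈ (constructibleFrom C β : Set ZFSet.{u})) := ⟨hy⟩
  convert constructibleFrom_sep_mem (C := C) (β := β) (P := fun z => z = x ∨ z = y)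
    inferInstance using 1
  ext z
  rw [ZFSet.mem_pair, ZFSet.mem_sep, iff_and_self]
  rintro (rfl | rfl) <;> assumption

/-- A level of the constructible hierarchy over a code contains the graph of the collapse below
a given point. -/
theorem exists_isCollapseGraph_mem {E : ZFSet.{u}} (wE : WellFounded (pairRel E)) (z : ZFSet.{u}) :
    z ∈ transClosure {E} → ∃ F ∈ constructibleFrom E (levelBound (collapse E z) + 1 + 1 + 1 + 1),
      IsCollapseGraph E F ∧ ZFSet.pair z (collapse E z) ∈ F := by
  induction z using wE.induction with
  | h z ih =>
  intro hz
  obtain ⟨lam, hlam⟩ : ∃ lam, lam = levelBound (collapse E z) := ⟨_, rfl⟩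
  rw [← hlam]
  obtain ⟨A, hA⟩ : ∃ A, A = constructibleFrom E lam := ⟨_, rfl⟩
  have htr : A.IsTransitive := hA ▸ isTransitive_constructibleFrom E lam
  have hTA : transClosure {E} ⊆ A := hA ▸ transClosure_subset_constructibleFrom E lam
  have := htr.transClass
  have hET : E ∈ transClosure {E} := mem_transClosure.2 (.single (by simp))
  have : Fact (E ∈ (A : Set ZFSet.{u})) := ⟨hTA hET⟩
  have : Fact (z ∈ (A : Set ZFSet.{u})) := ⟨hTA hz⟩
  have hch : ∀ y, pairRel E y z → ∃ F ∈ A, IsCollapseGraph E F ∧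
      ZFSet.pair y (collapse E y) ∈ F := by
    intro y hy
    have hyT : y ∈ transClosure {E} := (mem_and_mem_of_pair_mem
      (hU := (isTransitive_transClosure {E}).transClass)
      ((isTransitive_transClosure {E}).subset_of_mem hET hy)).1
    obtain ⟨F, hF, hFc, hyF⟩ := ih y hy hyT
    refine ⟨F, ?_, hFc, hyF⟩
    rw [hA, hlam]
    exact constructibleFrom_mono (levelBound_le_of_mem (collapse_mem wE hy)) hF
  -- All collapse graphs lying in level `lam` agree, so their union is a collapse graph. It is
  -- definable over that level, hence appears at `lam + 1`.
  have hG : A.sep (fun p => ∃ F ∈ A, IsCollapseGraph E F ∧ p ∈ F) ∈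
      constructibleFrom E (lam + 1) := by
    subst hA
    exact constructibleFrom_sep_mem inferInstance
  have memG : ∀ {p}, p ∈ A.sep (fun p => ∃ F ∈ A, IsCollapseGraph E F ∧ p ∈ F) ↔
      ∃ F ∈ A, IsCollapseGraph E F ∧ p ∈ F := by
    intro p
    rw [ZFSet.mem_sep, and_iff_right_iff_imp]
    rintro ⟨F, hF, _, hp⟩
    exact htr.subset_of_mem hF hp
  generalize A.sep (fun p => ∃ F ∈ A, IsCollapseGraph E F ∧ p ∈ F) = G at hG memG
  have hGc : IsCollapseGraph E G := by
    intro x u hxu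
    obtain ⟨F, hF, hFc, hp⟩ := memG.1 hxu
    obtain ⟨h₁, h₂⟩ := hFc x u hp
    refine ⟨fun y hy => (h₁ y hy).imp fun v hv => ⟨hv.1, memG.2 ⟨F, hF, hFc, hv.2⟩⟩,
      fun v hv => (h₂ v hv).imp fun y hy => ⟨hy.1, memG.2 ⟨F, hF, hFc, hy.2⟩⟩⟩
  -- By induction every predecessor of `z` is treated by a graph in level `lam`, so the collapse of
  -- `z` is definable over that level too.
  have hval : collapse E z ∈ constructibleFrom E (lam + 1) := by
    have : A.sep (fun v => ∃ y ∈ A, pairRel E y z ∧ ∃ F ∈ A, IsCollapseGraph E F ∧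
        ZFSet.pair y v ∈ F) = collapse E z := by
      ext v
      rw [ZFSet.mem_sep, mem_collapse wE]
      constructor
      · rintro ⟨_, y, _, hy, F, _, hFc, hp⟩
        exact ⟨y, hy, hFc.eq_collapse wE y v hp⟩
      · rintro ⟨y, hy, rfl⟩
        obtain ⟨F, hF, hFc, hp⟩ := hch y hy
        obtain ⟨hyA, hvA⟩ := mem_and_mem_of_pair_mem (hU := htr.transClass)
          (htr.subset_of_mem hF hp)
        exact ⟨hvA, y, hyA, hy, F, hF, hFc, hp⟩
    rw [← this]
    subst hA
    exact constructibleFrom_sep_mem inferInstance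
  have step : ∀ {β : Ordinal.{u}} {a : ZFSet.{u}}, a ∈ constructibleFrom E β →
      a ∈ constructibleFrom E (β + 1) := fun h => constructibleFrom_mono le_self_add h
  have hz₀ : z ∈ constructibleFrom E lam := hA ▸ hTA hz
  -- From `lam + 1`, one level is spent on the unordered pairs and one on the ordered pair;
  -- inserting it into `G` costs the fourth.
  have hpair : ZFSet.pair z (collapse E z) ∈ constructibleFrom E (lam + 1 + 1 + 1) := by
    refine unordered_mem_constructibleFrom ?_ (unordered_mem_constructibleFrom (step hz₀) hval)
    rw [← ZFSet.pair_eq_singleton]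
    exact step (unordered_mem_constructibleFrom hz₀ hz₀)
  refine ⟨insert (ZFSet.pair z (collapse E z)) G, ?_, ?_, ZFSet.mem_insert _ _⟩
  · have htr' := isTransitive_constructibleFrom E (lam + 1 + 1 + 1)
    have : Fact (ZFSet.pair z (collapse E z) ∈
      (constructibleFrom E (lam + 1 + 1 + 1) : Set ZFSet.{u})) := ⟨hpair⟩
    have : Fact (G ∈ (constructibleFrom E (lam + 1 + 1 + 1) : Set ZFSet.{u})) :=
      ⟨step (step hG)⟩
    convert constructibleFrom_sep_mem (C := E) (β := lam + 1 + 1 + 1)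
      (P := fun p => p = ZFSet.pair z (collapse E z) ∨ p ∈ G) inferInstance using 1
    ext p
    rw [ZFSet.mem_insert_iff, ZFSet.mem_sep, iff_and_self]
    rintro (rfl | hp)
    · exact hpair
    · exact htr'.subset_of_mem (step (step hG)) hp
  · intro x u hxu
    rcases ZFSet.mem_insert_iff.1 hxu with e | hxu
    · obtain ⟨rfl, rfl⟩ := ZFSet.pair_inj.1 e
      constructor
      · intro y hy
        obtain ⟨F, hF, hFc, hp⟩ := hch y hy
        exact ⟨_, collapse_mem wE hy, ZFSet.mem_insert_of_mem _ (memG.2 ⟨F, hF, hFc, hp⟩)⟩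
      · intro v hv
        obtain ⟨y, hy, rfl⟩ := (mem_collapse wE).1 hv
        obtain ⟨F, hF, hFc, hp⟩ := hch y hy
        exact ⟨y, hy, ZFSet.mem_insert_of_mem _ (memG.2 ⟨F, hF, hFc, hp⟩)⟩
    · obtain ⟨h₁, h₂⟩ := hGc x u hxu
      exact ⟨fun y hy => (h₁ y hy).imp fun v hv => ⟨hv.1, ZFSet.mem_insert_of_mem _ hv.2⟩,
        fun v hv => (h₂ v hv).imp fun y hy => ⟨hy.1, ZFSet.mem_insert_of_mem _ hy.2⟩⟩

/-- Codes are read at the node `∅`, which must therefore lie in the bottom level. -/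
theorem empty_mem_transClosure_singleton (E : ZFSet.{u}) : ∅ ∈ transClosure {E} := by
  have : ∀ x : ZFSet.{u}, x ∈ transClosure {E} → ∅ ∈ transClosure {E} := by
    intro x
    induction x using ZFSet.inductionOn with
    | h x ih =>
      intro hx
      rcases ZFSet.eq_empty_or_nonempty x with rfl | ⟨y, hy⟩
      · exact hx
      · exact ih y hy ((isTransitive_transClosure _).subset_of_mem hx hy)
  exact this E (mem_transClosure.2 (.single (by simp)))

theorem collapse_mem_constructibleFrom {E : ZFSet.{u}} (wE : WellFounded (pairRel E)) :
    collapse E ∅ ∈ constructibleFrom E (levelBound (collapse E ∅) + 1 + 1 + 1 + 1) := by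
  obtain ⟨F, hF, _, hp⟩ := exists_isCollapseGraph_mem wE ∅ (empty_mem_transClosure_singleton E)
  have htr := isTransitive_constructibleFrom E (levelBound (collapse E ∅) + 1 + 1 + 1 + 1)
  exact (mem_and_mem_of_pair_mem (hU := htr.transClass) (htr.subset_of_mem hF hp)).2

/-! ## Coding pairs -/

section SubtreeIso

variable {M₀ R : ZFSet.{u}}

theorem rank_collapse_lt_or_eq (wR : WellFounded (pairRel R)) {w b : ZFSet.{u}}
    (h : Relation.ReflTransGen (pairRel R) w b) :
    w = b ∨ (collapse R w).rank < (collapse R b).rank := by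
  induction h with
  | refl => exact Or.inl rfl
  | tail _ hcd ih =>
    have := ZFSet.rank_lt_of_mem (collapse_mem wR hcd)
    rcases ih with rfl | ih
    · exact Or.inr this
    · exact Or.inr (ih.trans this)

/-- An isomorphism of subtrees preserves collapses by induction. Since it is not assumed to send `b`
to `c`, the tops are matched by rank: the collapse of a top has strictly larger rank than that of
any other node below it. -/
theorem collapse_eq_of_subtreeIso (wR : WellFounded (pairRel R))
    (hR : ∀ y z, pairRel R y z → y ∈ M₀) {b c : ZFSet.{u}} (hb : b ∈ M₀) (hc : c ∈ M₀)
    (h : SubtreeIso M₀ R b c) : collapse R b = collapse R c := by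
  obtain ⟨e⟩ := h
  have hcol : ∀ (w : ZFSet.{u}) (hw : w ∈ nodesBelow M₀ R b),
      collapse R w = collapse R (e ⟨w, hw⟩).1 := by
    intro w
    induction w using wR.induction with
    | h w ih =>
      intro hw
      ext u
      rw [mem_collapse wR, mem_collapse wR]
      constructor
      · rintro ⟨y, hy, rfl⟩
        have hy' : y ∈ nodesBelow M₀ R b := ⟨hR _ _ hy, .head hy hw.2⟩
        exact ⟨_, e.map_rel_iff.2 (show pairRel R (⟨y, hy'⟩ : nodesBelow M₀ R b).1 _ from hy),
          ih y hy hy'⟩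
      · rintro ⟨y, hy, rfl⟩
        have hy' : y ∈ nodesBelow M₀ R c := ⟨hR _ _ hy, .head hy (e ⟨w, hw⟩).2.2⟩
        obtain ⟨⟨v, hv⟩, hve⟩ := e.surjective ⟨y, hy'⟩
        have hvw : pairRel R v w := by
          have : pairRel R (e ⟨v, hv⟩).1 (e ⟨w, hw⟩).1 := by rw [hve]; exact hy
          exact e.map_rel_iff.1 this
        refine ⟨v, hvw, ?_⟩
        rw [ih v hvw hv, hve]
  have hb' : b ∈ nodesBelow M₀ R b := ⟨hb, .refl⟩
  obtain ⟨⟨w, hw⟩, hwe⟩ := e.surjective ⟨c, hc, .refl⟩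
  have h₁ := hcol b hb'
  have h₂ := hcol w hw
  rw [hwe] at h₂
  rcases rank_collapse_lt_or_eq wR (e ⟨b, hb'⟩).2.2 with e' | h₃
  · rw [h₁, e']
  · exfalso
    rw [← h₁] at h₃
    change (collapse R b).rank < (collapse R c).rank at h₃
    rw [← h₂] at h₃
    rcases rank_collapse_lt_or_eq wR hw.2 with rfl | h₄
    · exact lt_irrefl _ h₃
    · exact lt_asymm h₃ h₄

end SubtreeIso

/-- By `∈`-induction, the isomorphism onto `TC({x})` sends the class of a node to the collapse of
that node. So `x` is the collapse of `R` at the node sent to it. -/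
theorem IsMKModel.codedSets_subset {M 𝒞 : ZFSet.{u}} (h : IsMKModel M 𝒞) :
    codedSets 𝒞 ⊆ collapseValues 𝒞 := by
  rintro x ⟨M₀, R, a, hp, ⟨e⟩⟩
  have hR : ∀ y z, pairRel R y z → y ∈ M₀ ∧ z ∈ M₀ := by
    intro y z hyz
    obtain ⟨y', hy, z', hz, e'⟩ := hp.rel_on _ hyz
    obtain ⟨rfl, rfl⟩ := ZFSet.pair_inj.1 e'
    exact ⟨hy, hz⟩
  have key : ∀ (t : ZFSet.{u}) (b : M₀), (e (Quotient.mk _ b) : ZFSet.{u}) = t →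
      t = collapse R b := by
    intro t
    induction t using ZFSet.inductionOn with
    | h t ih =>
      rintro b rfl
      ext u
      rw [mem_collapse hp.wf]
      constructor
      · intro hu
        have huT : u ∈ transClosure {x} :=
          (isTransitive_transClosure _).subset_of_mem (e (Quotient.mk _ b)).2 hu
        obtain ⟨q, hq⟩ := e.surjective ⟨u, huT⟩
        have hrel : quotientRel M₀ R q (Quotient.mk _ b) := by
          apply e.map_rel_iff.1
          rw [hq]
          exact hu
        obtain ⟨c₀, b₀, rfl, hb₀, hcb⟩ := hrel
        have hcol : collapse R b₀ = collapse R b :=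
          collapse_eq_of_subtreeIso hp.wf (fun y z h => (hR y z h).1) b₀.2 b.2
            (Quotient.exact hb₀)
        have hu' : u = collapse R c₀ := ih u hu c₀ (by rw [hq])
        rw [hu']
        exact (mem_collapse hp.wf).1 (hcol ▸ collapse_mem hp.wf hcb)
      · rintro ⟨y, hy, rfl⟩
        have hrel : quotientRel M₀ R (Quotient.mk _ ⟨y, (hR _ _ hy).1⟩) (Quotient.mk _ b) :=
          ⟨_, _, rfl, rfl, hy⟩
        have hmem : (e (Quotient.mk _ ⟨y, (hR _ _ hy).1⟩) : ZFSet.{u}) ∈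
          (e (Quotient.mk _ b) : ZFSet.{u}) := e.map_rel_iff.2 hrel
        have := ih _ hmem _ rfl
        rwa [this] at hmem
  obtain ⟨q, hq⟩ := e.surjective ⟨x, mem_transClosure.2 (.single (by simp))⟩
  obtain ⟨b, rfl⟩ := Quotient.exists_rep q
  rw [key x b (by rw [hq])]
  exact h.collapse_mem_collapseValues hp.rel_mem hp.wf (h.class_subset _ hp.carrier_mem b.2)

/-! ### Unfolding a well-founded relation to a tree -/

/-- Finite sequences descending along `E` to the point `a`, listed from the lowest point. -/
inductive IsBranch (E a : ZFSet.{u}) : List ZFSet.{u} → Prop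
  | root : IsBranch E a [a]
  | cons {y z : ZFSet.{u}} {l : List ZFSet.{u}} :
      pairRel E y z → IsBranch E a (z :: l) → IsBranch E a (y :: z :: l)

/-- The set coding a list. -/
def listCode (l : List ZFSet.{u}) : ZFSet.{u} := l.foldr ZFSet.pair ∅

theorem listCode_injective : Function.Injective (listCode : List ZFSet.{u} → ZFSet.{u}) := by
  intro l
  induction l with
  | nil =>
    intro l' h
    cases l' with
    | nil => rfl
    | cons y l' => exact (pair_ne_empty _ _ h).elim
  | cons x l ih =>
    intro l' h
    cases l' with
    | nil => exact (pair_ne_empty _ _ h.symm).elim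
    | cons y l' =>
      obtain ⟨rfl, h'⟩ := ZFSet.pair_inj.1 h
      rw [ih h']

theorem IsBranch.exists_cons {E a : ZFSet.{u}} {l : List ZFSet.{u}} (h : IsBranch E a l) :
    ∃ z l', l = z :: l' := by
  cases h <;> exact ⟨_, _, rfl⟩

theorem IsBranch.of_cons {E a y z : ZFSet.{u}} {l : List ZFSet.{u}}
    (h : IsBranch E a (y :: z :: l)) : pairRel E y z ∧ IsBranch E a (z :: l) := by
  cases h with
  | cons h h' => exact ⟨h, h'⟩

theorem IsBranch.append {E a z : ZFSet.{u}} {l m : List ZFSet.{u}}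
    (hm : IsBranch E z (m ++ [z])) (hl : IsBranch E a (z :: l)) : IsBranch E a (m ++ z :: l) := by
  induction m with
  | nil => exact hl
  | cons x m ih =>
    cases m with
    | nil => exact .cons (IsBranch.of_cons hm).1 hl
    | cons y m => exact .cons (IsBranch.of_cons hm).1 (ih (IsBranch.of_cons hm).2)

theorem IsBranch.of_append {E a z : ZFSet.{u}} {l m : List ZFSet.{u}}
    (h : IsBranch E a (m ++ z :: l)) : IsBranch E z (m ++ [z]) := by
  induction m with
  | nil => exact .root
  | cons x m ih =>
    cases m with
    | nil => exact .cons (IsBranch.of_cons h).1 .root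
    | cons y m => exact .cons (IsBranch.of_cons h).1 (ih (IsBranch.of_cons h).2)

/-- `T` is the set of codes of branches and `R` is the extension relation. -/
structure IsUnfolding (E a T R : ZFSet.{u}) : Prop where
  mem_iff : ∀ s, s ∈ T ↔ ∃ l, IsBranch E a l ∧ s = listCode l
  rel_iff : ∀ s t, pairRel R s t ↔ ∃ y l, IsBranch E a (y :: l) ∧ IsBranch E a l ∧
    s = listCode (y :: l) ∧ t = listCode l
  pairs : ∀ p ∈ R, ∃ s t, p = ZFSet.pair s t

namespace IsUnfolding

variable {E a T R : ZFSet.{u}} (h : IsUnfolding E a T R)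
include h

theorem rel_cons {y z : ZFSet.{u}} {l : List ZFSet.{u}} (hl : IsBranch E a (y :: z :: l)) :
    pairRel R (listCode (y :: z :: l)) (listCode (z :: l)) :=
  (h.rel_iff _ _).2 ⟨_, _, hl, hl.of_cons.2, rfl, rfl⟩

theorem exists_of_rel {s : ZFSet.{u}} {l : List ZFSet.{u}} (hs : pairRel R s (listCode l)) :
    ∃ y z l', l = z :: l' ∧ pairRel E y z ∧ IsBranch E a (y :: l) ∧ s = listCode (y :: l) := by
  obtain ⟨y, l', hyl, hl', rfl, e⟩ := (h.rel_iff _ _).1 hs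
  obtain rfl := listCode_injective e
  obtain ⟨z, l', rfl⟩ := hl'.exists_cons
  exact ⟨y, z, l', rfl, hyl.of_cons.1, hyl, rfl⟩

theorem wellFounded (wE : WellFounded (pairRel E)) : WellFounded (pairRel R) := by
  have acc : ∀ z l, Acc (pairRel R) (listCode (z :: l)) := by
    intro z
    induction z using wE.induction with
    | h z ih =>
      refine fun l => ⟨_, fun s hs => ?_⟩
      obtain ⟨y, z', l', e, hy, _, rfl⟩ := h.exists_of_rel hs
      obtain ⟨rfl, rfl⟩ := List.cons_eq_cons.1 e
      exact ih y hy _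
  refine ⟨fun q => ⟨_, fun p hp => ?_⟩⟩
  obtain ⟨y, l, _, _, rfl, _⟩ := (h.rel_iff _ _).1 hp
  exact acc y l

/-- The one-step extensions of a branch correspond to the predecessors of its lowest point, so its
collapse depends on that point alone. -/
theorem collapse_eq (wE : WellFounded (pairRel E)) (z : ZFSet.{u}) :
    ∀ l, IsBranch E a (z :: l) → collapse R (listCode (z :: l)) = collapse E z := by
  have wR := h.wellFounded wE
  induction z using wE.induction with
  | h z ih =>
    intro l hl
    ext u
    rw [mem_collapse wR, mem_collapse wE]
    constructor
    · rintro ⟨s, hs, rfl⟩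
      obtain ⟨y, z', l', e, hy, hyl, rfl⟩ := h.exists_of_rel hs
      obtain ⟨rfl, rfl⟩ := List.cons_eq_cons.1 e
      exact ⟨y, hy, ih y hy _ hyl⟩
    · rintro ⟨y, hy, rfl⟩
      exact ⟨_, h.rel_cons (.cons hy hl), (ih y hy _ (.cons hy hl)).symm⟩

theorem hasRDist_iff (n : ℕ) : ∀ l, IsBranch E a l →
    (HasRDist R (listCode [a]) n (listCode l) ↔ l.length = n + 1) := by
  induction n with
  | zero =>
    intro l hl
    rw [HasRDist]
    constructor
    · intro e
      rw [listCode_injective e]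
      rfl
    · intro e
      cases hl with
      | root => rfl
      | cons _ _ => simp at e
  | succ n ih =>
    intro l hl
    rw [HasRDist]
    constructor
    · rintro ⟨w, hw, hd⟩
      obtain ⟨y, l', hyl, hl', e, rfl⟩ := (h.rel_iff _ _).1 hw
      rw [listCode_injective e, List.length_cons, (ih l' hl').1 hd]
    · intro e
      cases hl with
      | root => simp at e
      | cons hy hl' =>
        exact ⟨_, h.rel_cons (.cons hy hl'), (ih _ hl').2 (by simpa using e)⟩

/-- The model on the left mentions only `E` and `z`: the tree below a branch is the tree of branches
descending from its lowest point `z`. Hence branches with the same lowest point have isomorphic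
subtrees. -/
theorem nonempty_relIso {z : ZFSet.{u}} {l : List ZFSet.{u}} (hl : IsBranch E a (z :: l)) :
    Nonempty ((fun m m' : {m : List ZFSet.{u} // IsBranch E z (m ++ [z])} => ∃ y, m.1 = y :: m'.1)
      ≃r (fun s t : nodesBelow T R (listCode (z :: l)) => pairRel R s.1 t.1)) := by
  have hmem : ∀ m : List ZFSet.{u}, IsBranch E z (m ++ [z]) →
      listCode (m ++ z :: l) ∈ nodesBelow T R (listCode (z :: l)) := by
    intro m hm
    refine ⟨(h.mem_iff _).2 ⟨_, hm.append hl, rfl⟩, ?_⟩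
    induction m with
    | nil => exact .refl
    | cons x m ih =>
      cases m with
      | nil => exact .single (h.rel_cons (hm.append hl))
      | cons y m => exact .head (h.rel_cons (hm.append hl)) (ih (IsBranch.of_cons hm).2)
  have hsurj : ∀ s, Relation.ReflTransGen (pairRel R) s (listCode (z :: l)) →
      ∃ m, IsBranch E z (m ++ [z]) ∧ s = listCode (m ++ z :: l) := by
    intro s hs
    induction hs using Relation.ReflTransGen.head_induction_on with
    | refl => exact ⟨[], .root, rfl⟩
    | head hst _ ih =>
      obtain ⟨m, hm, rfl⟩ := ih
      obtain ⟨y, _, _, _, _, hyl, rfl⟩ := h.exists_of_rel hst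
      exact ⟨y :: m, IsBranch.of_append (m := y :: m) hyl, rfl⟩
  refine ⟨⟨Equiv.ofBijective (fun m => ⟨_, hmem m.1 m.2⟩) ⟨?_, ?_⟩, ?_⟩⟩
  · intro m m' e
    exact Subtype.ext (List.append_cancel_right (listCode_injective (congrArg Subtype.val e)))
  · rintro ⟨s, _, hs⟩
    obtain ⟨m, hm, rfl⟩ := hsurj s hs
    exact ⟨⟨m, hm⟩, rfl⟩
  · rintro ⟨m, hm⟩ ⟨m', hm'⟩
    change pairRel R (listCode (m ++ z :: l)) (listCode (m' ++ z :: l)) ↔ ∃ y, m = y :: m'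
    constructor
    · intro hr
      obtain ⟨y, _, _, _, _, _, e⟩ := h.exists_of_rel hr
      exact ⟨y, List.append_cancel_right (bs := z :: l) (listCode_injective e)⟩
    · rintro ⟨y, rfl⟩
      exact (h.rel_iff _ _).2 ⟨y, _, hm.append hl, hm'.append hl, rfl, rfl⟩

theorem subtreeIso {z : ZFSet.{u}} {l l' : List ZFSet.{u}} (hl : IsBranch E a (z :: l))
    (hl' : IsBranch E a (z :: l')) :
    SubtreeIso T R (listCode (z :: l)) (listCode (z :: l')) := by
  obtain ⟨e⟩ := h.nonempty_relIso hl
  obtain ⟨e'⟩ := h.nonempty_relIso hl'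
  exact ⟨e.symm.trans e'⟩

/-- The level of a branch is its length minus one. Isomorphic siblings have lowest points with equal
collapses, so injectivity makes them equal. A branch has only one tail, which gives the disjointness
condition on any level. -/
theorem isCodingPair {𝒞 : ZFSet.{u}} (hT : T ∈ 𝒞) (hR : R ∈ 𝒞) (wE : WellFounded (pairRel E))
    (hinj : ∀ y l y' l', IsBranch E a (y :: l) → IsBranch E a (y' :: l') →
      collapse E y = collapse E y' → y = y') :
    IsCodingPair 𝒞 T R (listCode [a]) where
  carrier_mem := hT
  rel_mem := hR
  top_mem := (h.mem_iff _).2 ⟨_, .root, rfl⟩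
  rel_on := by
    intro p hp
    obtain ⟨s, t, rfl⟩ := h.pairs p hp
    obtain ⟨y, l, hyl, hl, rfl, rfl⟩ := (h.rel_iff _ _).1 hp
    exact ⟨_, (h.mem_iff _).2 ⟨_, hyl, rfl⟩, _, (h.mem_iff _).2 ⟨_, hl, rfl⟩, rfl⟩
  level := by
    intro s hs
    obtain ⟨l, hl, rfl⟩ := (h.mem_iff _).1 hs
    obtain ⟨z, l', rfl⟩ := hl.exists_cons
    refine ⟨l'.length, (h.hasRDist_iff _ _ hl).2 rfl, fun n hn => ?_⟩
    have := (h.hasRDist_iff _ _ hl).1 hn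
    simpa using this.symm
  not_iso := by
    intro x hx y hy z hz hne hyx hzx hiso
    have wR := h.wellFounded wE
    have hcol := collapse_eq_of_subtreeIso wR (fun s t hst => by
      obtain ⟨y, l, hyl, _, rfl, _⟩ := (h.rel_iff _ _).1 hst
      exact (h.mem_iff _).2 ⟨_, hyl, rfl⟩) hy hz hiso
    obtain ⟨l, hl, rfl⟩ := (h.mem_iff _).1 hx
    obtain ⟨b, w, l', rfl, -, hbl, rfl⟩ := h.exists_of_rel hyx
    obtain ⟨c, w', l'', e, -, hcl, rfl⟩ := h.exists_of_rel hzx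
    obtain ⟨rfl, rfl⟩ := List.cons_eq_cons.1 e
    rw [h.collapse_eq wE _ _ hbl, h.collapse_eq wE _ _ hcl] at hcol
    exact hne (by rw [hinj b _ c _ hbl hcl hcol])
  disjoint := by
    intro y _ z _ hne _ _ _ v hvy hvz
    obtain ⟨b, l, _, _, rfl, rfl⟩ := (h.rel_iff _ _).1 hvy
    obtain ⟨c, l', _, _, e, rfl⟩ := (h.rel_iff _ _).1 hvz
    obtain ⟨-, rfl⟩ := List.cons_eq_cons.1 (listCode_injective e)
    exact hne rfl
  wf := h.wellFounded wE

/-- Under injectivity, two branches have isomorphic subtrees iff they have the same collapse. So the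
collapse factors through the quotient as a bijection onto `TC({x})`. -/
theorem codesSet (wE : WellFounded (pairRel E))
    (hinj : ∀ y l y' l', IsBranch E a (y :: l) → IsBranch E a (y' :: l') →
      collapse E y = collapse E y' → y = y') : CodesSet T R (collapse E a) := by
  have wR := h.wellFounded wE
  have hRT : ∀ s t, pairRel R s t → s ∈ T ∧ t ∈ T := by
    intro s t hst
    obtain ⟨y, l, hyl, hl, rfl, rfl⟩ := (h.rel_iff _ _).1 hst
    exact ⟨(h.mem_iff _).2 ⟨_, hyl, rfl⟩, (h.mem_iff _).2 ⟨_, hl, rfl⟩⟩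
  have hcons : ∀ s ∈ T, ∃ z l, IsBranch E a (z :: l) ∧ s = listCode (z :: l) := by
    intro s hs
    obtain ⟨l, hl, rfl⟩ := (h.mem_iff _).1 hs
    obtain ⟨z, l', rfl⟩ := hl.exists_cons
    exact ⟨z, l', hl, rfl⟩
  have hbr : ∀ l, IsBranch E a l → ∀ z l', l = z :: l' →
      collapse E z ∈ transClosure {collapse E a} := by
    intro l hl
    induction hl with
    | root =>
      intro z l' e
      obtain ⟨rfl, -⟩ := List.cons_eq_cons.1 e
      exact mem_transClosure.2 (.single (by simp))
    | cons hy _ ih =>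
      intro z l' e
      obtain ⟨rfl, -⟩ := List.cons_eq_cons.1 e
      exact (isTransitive_transClosure _).subset_of_mem (ih _ _ rfl) (collapse_mem wE hy)
  have hmem : ∀ s : T, collapse R s.1 ∈ transClosure {collapse E a} := by
    rintro ⟨s, hs⟩
    obtain ⟨z, l, hl, rfl⟩ := hcons s hs
    rw [h.collapse_eq wE z l hl]
    exact hbr _ hl _ _ rfl
  have hiso : ∀ s t : T, collapse R s.1 = collapse R t.1 → SubtreeIso T R s.1 t.1 := by
    rintro ⟨s, hs⟩ ⟨t, ht⟩ e
    obtain ⟨z, l, hl, rfl⟩ := hcons s hs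
    obtain ⟨z', l', hl', rfl⟩ := hcons t ht
    rw [h.collapse_eq wE z l hl, h.collapse_eq wE z' l' hl'] at e
    obtain rfl := hinj _ _ _ _ hl hl' e
    exact h.subtreeIso hl hl'
  let f : Quotient (nodeSetoid T R) → transClosure ({collapse E a} : ZFSet.{u}) :=
    Quotient.lift (fun s : T => ⟨collapse R s.1, hmem s⟩) fun s t hst =>
      Subtype.ext (collapse_eq_of_subtreeIso wR (fun y z hyz => (hRT y z hyz).1) s.2 t.2 hst)
  have hsurj : ∀ u, u ∈ transClosure {collapse E a} →
      ∃ z l, IsBranch E a (z :: l) ∧ u = collapse E z := by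
    intro u hu
    rw [mem_transClosure] at hu
    induction hu using Relation.TransGen.head_induction_on with
    | single hu => exact ⟨a, [], .root, by simpa using hu⟩
    | head huv _ ih =>
      obtain ⟨z, l, hl, rfl⟩ := ih
      obtain ⟨y, hy, rfl⟩ := (mem_collapse wE).1 huv
      exact ⟨y, _, .cons hy hl, rfl⟩
  refine ⟨⟨Equiv.ofBijective f ⟨?_, ?_⟩, ?_⟩⟩
  · intro p q
    induction p using Quotient.inductionOn with | h s
    induction q using Quotient.inductionOn with | h t
    exact fun e => Quotient.sound (hiso s t (congrArg Subtype.val e))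
  · rintro ⟨u, hu⟩
    obtain ⟨z, l, hl, rfl⟩ := hsurj u hu
    refine ⟨Quotient.mk _ ⟨listCode (z :: l), (h.mem_iff _).2 ⟨_, hl, rfl⟩⟩, Subtype.ext ?_⟩
    exact h.collapse_eq wE z l hl
  · intro p q
    induction p using Quotient.inductionOn with | h s
    induction q using Quotient.inductionOn with | h t
    change collapse R s.1 ∈ collapse R t.1 ↔ _
    constructor
    · intro hst
      obtain ⟨v, hv, e⟩ := (mem_collapse wR).1 hst
      exact ⟨⟨v, (hRT _ _ hv).1⟩, t, Quotient.sound (hiso _ s e.symm), rfl, hv⟩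
    · rintro ⟨s', t', hs, ht, hr⟩
      have e : ∀ s s' : T, Quotient.mk (nodeSetoid T R) s' = Quotient.mk (nodeSetoid T R) s →
          collapse R s' = collapse R s := fun s s' e => congrArg Subtype.val (congrArg f e)
      rw [← e s s' hs, ← e t t' ht]
      exact collapse_mem wR hr

end IsUnfolding

/-! ### Coding pairs for all collapses of class relations -/

namespace IsMKModel

variable {M 𝒞 : ZFSet.{u}} (h : IsMKModel M 𝒞)
include h

theorem listCode_mem {E a : ZFSet.{u}} (hE : E ∈ 𝒞) (ha : a ∈ M) {l : List ZFSet.{u}}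
    (hl : IsBranch E a l) : listCode l ∈ M := by
  induction hl with
  | root => exact h.pair_mem ha h.empty_mem
  | cons hy _ ih => exact h.pair_mem (h.mem_of_pairRel hE hy).1 ih

/-- The unfolding of a class relation is a class. -/
theorem exists_isUnfolding {E a : ZFSet.{u}} (hE : E ∈ 𝒞) (ha : a ∈ M) :
    ∃ T ∈ 𝒞, ∃ R ∈ 𝒞, IsUnfolding E a T R := by
  have := h.transClass
  have := h.fact_univ
  have : Fact (E ∈ (𝒞 : Set ZFSet.{u})) := ⟨hE⟩
  have hroot : listCode [a] ∈ M := listCode_mem h hE ha .root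
  have : Fact (listCode [a] ∈ (𝒞 : Set ZFSet.{u})) := ⟨h.set_mem hroot⟩
  -- The class of branch codes is obtained by comprehension as the intersection of all classes that
  -- contain the root and are closed under extending a branch downwards.
  let Closed : ZFSet.{u} → Prop := fun X => listCode [a] ∈ X ∧ ∀ t ∈ M, t ∈ X →
    ∀ z ∈ M, ∀ r ∈ M, t = ZFSet.pair z r → ∀ y ∈ M, pairRel E y z →
    ∀ s ∈ M, s = ZFSet.pair y t → s ∈ X
  let P : ZFSet.{u} → Prop := fun s => ∀ X ∈ (𝒞 : Set ZFSet.{u}), Closed X → s ∈ X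
  have hT : M.sep P ∈ 𝒞 := h.sep_mem inferInstance
  have : Fact (M.sep P ∈ (𝒞 : Set ZFSet.{u})) := ⟨hT⟩
  have hcl : Closed (M.sep P) := by
    refine ⟨ZFSet.mem_sep.2 ⟨hroot, fun X _ hX => hX.1⟩, ?_⟩
    intro t htM ht z hz r hr e y hy hyz s hs e'
    exact ZFSet.mem_sep.2 ⟨hs, fun X hX hcl =>
      hcl.2 t htM ((ZFSet.mem_sep.1 ht).2 X hX hcl) z hz r hr e y hy hyz s hs e'⟩
  have hmem : ∀ s, s ∈ M.sep P ↔ ∃ l, IsBranch E a l ∧ s = listCode l := by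
    intro s
    constructor
    · induction s using (InvImage.wf ZFSet.rank wellFounded_lt).induction with
      | h s ih' =>
      have ih : ∀ y t, s = ZFSet.pair y t → t ∈ M.sep P →
          ∃ l, IsBranch E a l ∧ t = listCode l := by
        rintro y t rfl ht
        refine ih' t ?_ ht
        have h₁ : t ∈ ({y, t} : ZFSet.{u}) := by simp
        have h₂ : ({y, t} : ZFSet.{u}) ∈ ZFSet.pair y t := by simp [ZFSet.pair]
        exact (ZFSet.rank_lt_of_mem h₁).trans (ZFSet.rank_lt_of_mem h₂)
      intro hs
      -- A member of the least closed class that codes no branch could be removed from it: it is not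
      -- the root, and by induction on rank it is no legitimate extension of a member.
      by_contra hne
      have : Fact (s ∈ (𝒞 : Set ZFSet.{u})) := ⟨h.set_mem (ZFSet.mem_sep.1 hs).1⟩
      have hd : M.sep (fun t => t ∈ M.sep P ∧ ¬ t = s) ∈ 𝒞 := h.sep_mem inferInstance
      refine (ZFSet.mem_sep.1 ((ZFSet.mem_sep.1 hs).2 _ hd ⟨?_, ?_⟩)).2.2 rfl
      · exact ZFSet.mem_sep.2 ⟨hroot, hcl.1, fun e => hne ⟨_, .root, e.symm⟩⟩
      · intro t htM ht z hz r hr e y hy hyz s' hs' e'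
        refine ZFSet.mem_sep.2 ⟨hs', hcl.2 t htM (ZFSet.mem_sep.1 ht).2.1 z hz r hr e y hy hyz s'
          hs' e', ?_⟩
        rintro rfl
        obtain ⟨l, hl, rfl⟩ := ih y t e' (ZFSet.mem_sep.1 ht).2.1
        obtain ⟨z', l', rfl⟩ := hl.exists_cons
        obtain ⟨rfl, -⟩ := ZFSet.pair_inj.1 e
        exact hne ⟨_, .cons hyz hl, e'⟩
    · rintro ⟨l, hl, rfl⟩
      induction hl with
      | root => exact hcl.1
      | @cons y z l hyz hl ih =>
        obtain ⟨hy, hz⟩ := h.mem_of_pairRel hE hyz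
        have hm := listCode_mem h hE ha hl
        exact hcl.2 _ hm ih z hz _ (h.mem_of_pair_mem hm).2 rfl y hy hyz _ (h.pair_mem hy hm) rfl
  have hR : M.sep (fun q => ∃ s ∈ M.sep P, ∃ t ∈ M.sep P, ∃ y ∈ M, s = ZFSet.pair y t ∧
      q = ZFSet.pair s t) ∈ 𝒞 := h.sep_mem inferInstance
  refine ⟨_, hT, _, hR, hmem, fun s t => ?_, ?_⟩
  · simp only [pairRel, ZFSet.mem_sep (x := M) (y := ZFSet.pair s t), ZFSet.pair_inj]
    constructor
    · rintro ⟨_, _, hs, _, ht, y, _, e, rfl, rfl⟩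
      obtain ⟨l, hl, rfl⟩ := (hmem _).1 ht
      obtain ⟨l', hl', rfl⟩ := (hmem _).1 hs
      obtain rfl : l' = y :: l := listCode_injective e
      exact ⟨y, l, hl', hl, rfl, rfl⟩
    · rintro ⟨y, l, hyl, hl, rfl, rfl⟩
      have hs := listCode_mem h hE ha hyl
      exact ⟨h.pair_mem hs (listCode_mem h hE ha hl), _, (hmem _).2 ⟨_, hyl, rfl⟩, _,
        (hmem _).2 ⟨_, hl, rfl⟩, y, (h.mem_of_pair_mem hs).1, rfl, rfl, rfl⟩
  · intro p hp
    obtain ⟨_, s, _, t, _, _, _, _, rfl⟩ := ZFSet.mem_sep.1 hp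
    exact ⟨s, t, rfl⟩

/-- Every well-founded class relation can be replaced by one that is injectively collapsed, by
choosing representatives. -/
theorem exists_injective_collapse {E : ZFSet.{u}} (hE : E ∈ 𝒞) (wE : WellFounded (pairRel E)) :
    ∃ F ∈ 𝒞, WellFounded (pairRel F) ∧ ∃ a ∈ M, collapse F a = collapse E ∅ ∧
      ∀ y l y' l', IsBranch F a (y :: l) → IsBranch F a (y' :: l') →
        collapse F y = collapse F y' → y = y' := by
  have := h.transClass
  have := h.fact_univ
  have : Fact (E ∈ (𝒞 : Set ZFSet.{u})) := ⟨hE⟩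
  obtain ⟨W, hW, _, _, htri, hmin⟩ := h.globalChoice
  have : Fact (W ∈ (𝒞 : Set ZFSet.{u})) := ⟨hW⟩
  have hbis : ∀ b ∈ M, ∀ c ∈ M, (Bisimilar M 𝒞 E b E c ↔ collapse E b = collapse E c) :=
    fun b hb c hc => h.bisimilar_iff hE hE wE wE hb hc
  -- Representatives are the nodes least in the class well-ordering `W` among all nodes with the
  -- same collapse.
  let Rep : ZFSet.{u} → Prop := fun y => ∀ c ∈ M, Bisimilar M 𝒞 E c E y → ¬ pairRel W c y
  have rep_inj : ∀ y ∈ M, ∀ z ∈ M, Rep y → Rep z → collapse E y = collapse E z → y = z := by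
    intro y hy z hz hry hrz e
    rcases htri y hy z hz with hyz | rfl | hzy
    · exact (hrz y hy ((hbis y hy z hz).2 e) hyz).elim
    · rfl
    · exact (hry z hz ((hbis z hz y hy).2 e.symm) hzy).elim
  have rep_ex : ∀ b ∈ M, ∃ y ∈ M, Rep y ∧ collapse E y = collapse E b := by
    intro b hb
    have : Fact (b ∈ (𝒞 : Set ZFSet.{u})) := ⟨h.set_mem hb⟩
    have hX : M.sep (fun y => Bisimilar M 𝒞 E y E b) ∈ 𝒞 := h.sep_mem inferInstance
    have hne : M.sep (fun y => Bisimilar M 𝒞 E y E b) ≠ ∅ := by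
      intro e
      have : b ∈ M.sep (fun y => Bisimilar M 𝒞 E y E b) :=
        ZFSet.mem_sep.2 ⟨hb, (hbis b hb b hb).2 rfl⟩
      rw [e] at this
      exact ZFSet.notMem_empty _ this
    obtain ⟨y, hy, hymin⟩ := hmin _ hX hne
    obtain ⟨hyM, hyb⟩ := ZFSet.mem_sep.1 hy
    have hcol := (hbis y hyM b hb).1 hyb
    refine ⟨y, hyM, fun c hc hcy => hymin c (ZFSet.mem_sep.2 ⟨hc, ?_⟩), hcol⟩
    exact (hbis c hc b hb).2 (((hbis c hc y hyM).1 hcy).trans hcol)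
  let P : ZFSet.{u} → Prop := fun q => ∃ y ∈ M, ∃ z ∈ M, q = ZFSet.pair y z ∧ Rep y ∧ Rep z ∧
    ∃ c ∈ M, pairRel E c z ∧ Bisimilar M 𝒞 E y E c
  have hF : M.sep P ∈ 𝒞 := h.sep_mem inferInstance
  have rel : ∀ {y z}, pairRel (M.sep P) y z ↔ (y ∈ M ∧ Rep y) ∧ (z ∈ M ∧ Rep z) ∧
      collapse E y ∈ collapse E z := by
    intro y z
    simp only [pairRel, ZFSet.mem_sep, P, ZFSet.pair_inj]
    constructor
    · rintro ⟨_, y, hy, z, hz, ⟨rfl, rfl⟩, hry, hrz, c, hc, hcz, hb⟩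
      rw [hbis y hy c hc] at hb
      exact ⟨⟨hy, hry⟩, ⟨hz, hrz⟩, hb ▸ collapse_mem wE hcz⟩
    · rintro ⟨⟨hy, hry⟩, ⟨hz, hrz⟩, hyz⟩
      obtain ⟨c, hcz, e⟩ := (mem_collapse wE).1 hyz
      have hc := (h.mem_of_pairRel hE hcz).1
      exact ⟨h.pair_mem hy hz, y, hy, z, hz, ⟨rfl, rfl⟩, hry, hrz, c, hc, hcz,
        (hbis y hy c hc).2 e⟩
  have wF : WellFounded (pairRel (M.sep P)) :=
    Subrelation.wf (fun hyz => (rel.1 hyz).2.2) (InvImage.wf (collapse E) ZFSet.mem_wf)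
  have hcol : ∀ z, z ∈ M → Rep z → collapse (M.sep P) z = collapse E z := by
    intro z
    induction z using wF.induction with
    | h z ih =>
      intro hz hrz
      ext u
      rw [mem_collapse wF]
      constructor
      · rintro ⟨y, hy, rfl⟩
        obtain ⟨⟨hyM, hry⟩, _, hyz⟩ := rel.1 hy
        rwa [ih y hy hyM hry]
      · intro hu
        obtain ⟨c, hcz, rfl⟩ := (mem_collapse wE).1 hu
        obtain ⟨y, hy, hry, e⟩ := rep_ex c (h.mem_of_pairRel hE hcz).1
        rw [← e] at hu ⊢
        have hyz := rel.2 ⟨⟨hy, hry⟩, ⟨hz, hrz⟩, hu⟩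
        exact ⟨y, hyz, (ih y hyz hy hry).symm⟩
  obtain ⟨a, ha, hra, e⟩ := rep_ex ∅ h.empty_mem
  have hbr : ∀ y l, IsBranch (M.sep P) a (y :: l) → y ∈ M ∧ Rep y := by
    intro y l hl
    cases hl with
    | root => exact ⟨ha, hra⟩
    | cons hyz _ => exact (rel.1 hyz).1
  refine ⟨_, hF, wF, a, ha, (hcol a ha hra).trans e, fun y l y' l' hl hl' e => ?_⟩
  obtain ⟨hy, hry⟩ := hbr y l hl
  obtain ⟨hy', hry'⟩ := hbr y' l' hl'
  rw [hcol y hy hry, hcol y' hy' hry'] at e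
  exact rep_inj y hy y' hy' hry hry' e

/-- Reduces the theorem to collapses of arbitrary well-founded class relations, which are easier to
construct than coding pairs. -/
theorem codedSets_eq : codedSets 𝒞 = collapseValues 𝒞 := by
  refine h.codedSets_subset.antisymm ?_
  rintro _ ⟨E, hE, wE, rfl⟩
  obtain ⟨F, hF, wF, a, ha, hx, hinj⟩ := h.exists_injective_collapse hE wE
  obtain ⟨T, hT, R, hR, hTR⟩ := h.exists_isUnfolding hF ha
  exact ⟨T, R, _, hTR.isCodingPair hT hR wF hinj, hx ▸ hTR.codesSet wF hinj⟩

end IsMKModel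

/-! ### The height of `M⁺` and its decomposition into constructible levels -/

theorem corollary15 (M 𝒞 : ZFSet.{u}) (h : IsBetaModelMKStar M 𝒞) :
    ∃ κ : Ordinal.{u}, (∀ α : Ordinal.{u}, α.toZFSet ∈ codedSets 𝒞 ↔ α < κ) ∧
      codedSets 𝒞 = ⋃ C ∈ 𝒞, {x | x ∈ constructibleFrom C κ} := by
  rw [h.codedSets_eq]
  have hU := h.separationCollectionClass
  have tr : ∀ {x y : ZFSet.{u}}, x ∈ y → y ∈ collapseValues 𝒞 → x ∈ collapseValues 𝒞 :=
    fun hxy hy => TransClass.mem_of_mem hy hxy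
  have hcl : ∀ C ∈ 𝒞, C ∈ collapseValues 𝒞 := fun C hC => h.class_mem_collapseValues hC
  have : Fact (finOrdinals ∈ collapseValues 𝒞) := by
    obtain ⟨x, hx, h₀, hs⟩ := h.infinity
    exact ⟨finOrdinals_mem (hcl x (h.set_mem hx)) h₀ hs⟩
  have hne : ∃ α : Ordinal.{u}, α.toZFSet ∉ collapseValues 𝒞 := by
    by_contra! hall
    -- Since `𝒞` is a set, the ranks of all collapses have a supremum `b`, and `b + 1` is not coded.
    -- Relations that are not well-founded contribute the junk value `∅`, which is harmless.
    let b : Ordinal.{u} := ⨆ E : Shrink.{u} 𝒞,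
      (collapse ((equivShrink 𝒞).symm E : ZFSet.{u}) ∅).rank
    obtain ⟨E, hE, -, e⟩ := hall (b + 1)
    have hle : (collapse E ∅).rank ≤ b := by
      have := Ordinal.le_iSup (fun E : Shrink.{u} 𝒞 =>
        (collapse ((equivShrink 𝒞).symm E : ZFSet.{u}) ∅).rank) (equivShrink 𝒞 ⟨E, hE⟩)
      simpa using this
    rw [← e, Ordinal.rank_toZFSet] at hle
    exact absurd hle (not_le.2 (lt_add_one b))
  let κ : Ordinal.{u} := sInf {α | α.toZFSet ∉ collapseValues 𝒞}
  have hκ : ∀ α : Ordinal.{u}, α.toZFSet ∈ collapseValues 𝒞 ↔ α < κ := by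
    intro α
    constructor
    · intro hα
      by_contra! hle
      have hκ : κ.toZFSet ∉ collapseValues 𝒞 := csInf_mem hne
      rcases hle.eq_or_lt with e | hlt
      · exact hκ (e ▸ hα)
      · exact hκ (tr (Ordinal.toZFSet_mem_toZFSet_iff.2 hlt) hα)
    · intro hα
      by_contra hn
      exact absurd (csInf_le' hn) (not_le.2 hα)
  refine ⟨κ, hκ, Set.Subset.antisymm ?_ ?_⟩
  · intro x hx
    have hlev := levelBound_toZFSet_mem hx
    obtain ⟨E, hE, wE, rfl⟩ := hx
    -- The four successors are those of `collapse_mem_constructibleFrom`; `U` is closed under each,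
    -- so the level stays below `κ`.
    have := (hκ _).1 (add_one_toZFSet_mem (add_one_toZFSet_mem (add_one_toZFSet_mem
      (add_one_toZFSet_mem hlev))))
    exact Set.mem_biUnion hE (constructibleFrom_mono this.le (collapse_mem_constructibleFrom wE))
  · intro x hx
    obtain ⟨C, hC, hx⟩ := Set.mem_iUnion₂.1 hx
    have hCU := hcl C hC
    rcases mem_constructibleFrom.1 hx with hx | ⟨γ, hγ, hx⟩
    · have : Fact (C ∈ collapseValues 𝒞) := ⟨hCU⟩
      have hs : ({C} : ZFSet.{u}) ∈ collapseValues 𝒞 := FOFun.mem inferInstance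
      exact tr hx (transClosure_mem hs)
    · exact tr hx (defPowerset_mem (constructibleFrom_mem hCU ((hκ γ).2 hγ)))
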